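/- Let $X=[0,1]$ with Lebesgue measure $m$. A map $f:X\to X$ is piecewise $C^2$ if there is a partition of $X$ into finitely many disjoint nondegenerate intervals $X_j$ such that, for each $j$, the restriction of $f$ to $X_j$ extends to a $C^2$-diffeomorphism of $\mathrm{Clos}(X_j)$ onto its image. It is piecewise expanding if moreover for some $k\ge1$ the infimum of $|(f^k)'|$ over all points where this derivative exists is $>1$. A turning point of $f$ is a point of $X$ at which the derivative of $f$ (one-sided at $0$ and $1$) does not exist. At a discontinuity $f$ is regarded as two-valued: the images of a point $x$ are the one-sided limits $f(x^-)$ and $f(x^+)$ (just $f(x)$ if $f$ is continuous at $x$). A turning point $c$ is periodic if for some $n\ge1$ there are points $c=x_0,x_1,\dots,x_n=c$ such that each $x_{i+1}$ is an image of $x_i$. For real $h\in L^1(X)$ let $\mathrm{var}(h)=\sup\int_X\varphi' h\,dx$ over all compactly supported $\varphi\in C^1(\mathbb R)$ with $|\varphi|\le 1$ (and let $\mathrm{var}(h)=\sup|\int_X\varphi' h\,dx|$ over complex-valued such $\varphi$ if $h$ is complex), and let $\mathrm{BV}$ be the set of all $h\in L^1(X)$ with $\mathrm{var}(h)<\infty$.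 Let $\mathbb P_f$ be the Perron–Frobenius operator of $f$, i.e. $\int_A \mathbb P_f h\,dx=\int_{f^{-1}A}h\,dx$ for all measurable $A\subseteq X$, and let $\theta$ be its essential spectral radius on complex-valued $\mathrm{BV}$: the smallest $\theta\ge0$ such that all elements of the spectrum of modulus $>\theta$ are isolated eigenvalues of finite multiplicity. For each $\varepsilon>0$ let $Q_\varepsilon(x,A)$ be transition probabilities on $X$ for which $A\mapsto\int_X Q_\varepsilon(x,A)\,dx$ is absolutely continuous with respect to $m$, and let $Q_\varepsilon h$ denote the density of $A\mapsto\int_X Q_\varepsilon(x,A)h(x)\,dx$. Suppose that (locality) $Q_\varepsilon(x,A)=0$ whenever $\mathrm{dist}(x,A)>\varepsilon$; (smallness) $\|Q_\varepsilon h-h\|_{L^1}\le d(\varepsilon)\,\mathrm{var}(h)$ for all real $h\in\mathrm{BV}$, where $d(\varepsilon)\to0$ as $\varepsilon\to0$; (regularity) $\mathrm{var}(Q_\varepsilon h)\le\mathrm{var}(h)+C_0\|h\|_{L^1}$ for all real $h\in\mathrm{BV}$, with a constant $C_0$ independent of $\varepsilon$ and $h$. Put $P_\varepsilon=Q_\varepsilon\mathbb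 P_f$. Let $f$ be a piecewise expanding map without periodic turning points and let $\tilde\theta$ be any number with $\theta<\tilde\theta<1$. Then there are an integer $N\ge1$ and constants $C\ge0$ and $\varepsilon_0>0$ such that $$\mathrm{var}(P_\varepsilon^N h)\le\tilde\theta^N\,\mathrm{var}(h)+C\|h\|_{L^1}$$ for all $\varepsilon\in(0,\varepsilon_0)$ and all real $h\in\mathrm{BV}$. -/

import Mathlib

open MeasureTheory ProbabilityTheory Filter Topology Set
open scoped ENNReal NNReal unitInterval

noncomputable section

/-- The space `L¹(X)` of `𝕜`-valued functions on `X = [0,1]` with Lebesgue measure. -/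
abbrev L1 (𝕜 : Type) [RCLike 𝕜] : Type := Lp 𝕜 1 (volume : Measure I)

/-- The variation `var(h) = sup |∫_X φ' h dx|` over all compactly supported `φ ∈ C¹(ℝ)` with
`|φ| ≤ 1`. The test functions are not required to vanish at `0` and `1`, so this is the variation
over `ℝ` of `h` extended by zero. For real `h` the absolute value changes nothing, since `-φ` is
a test function whenever `φ` is one. -/
def variation {𝕜 : Type} [RCLike 𝕜] (h : L1 𝕜) : ℝ≥0∞ :=
  ⨆ (φ : ℝ → 𝕜) (_ : ContDiff ℝ 1 φ ∧ HasCompactSupport φ ∧ ∀ t, ‖φ t‖ ≤ 1),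
    ‖∫ x : I, deriv φ (x : ℝ) * h x‖ₑ

/-- The functions of bounded variation, as elements of `L¹(X)`. -/
def BV (𝕜 : Type) [RCLike 𝕜] : Set (L1 𝕜) := {h | variation h < ∞}

open Classical in
/-- The density with respect to Lebesgue measure of the set function `ν`: the unique `g ∈ L¹(X)`
with `∫_A g dx = ν A` for all measurable `A` (and `0` if there is none). -/
def densityOf {𝕜 : Type} [RCLike 𝕜] (ν : Set I → 𝕜) : L1 𝕜 :=
  if H : ∃ g : L1 𝕜, ∀ A : Set I, MeasurableSet A → ∫ x in A, g x = ν A then H.choose else 0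

/-- The Perron-Frobenius operator of `f`: it sends the density `h` of a measure to the density of
the image of that measure under `f`. -/
def perronFrobenius {𝕜 : Type} [RCLike 𝕜] (f : I → I) (h : L1 𝕜) : L1 𝕜 :=
  densityOf fun A => ∫ x in f ⁻¹' A, h x

/-- The transition operator of a family of transition probabilities `Q(x, A)`: it sends the
density `h` of a measure to the density of `A ↦ ∫ Q(x, A) h(x) dx`. -/
def transitionOp {𝕜 : Type} [RCLike 𝕜] (Q : Kernel I I) (h : L1 𝕜) : L1 𝕜 :=
  densityOf fun A => ∫ x, (((Q x).real A : ℝ) : 𝕜) * h x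

/-- The transition operator `P = Q P_f` of the random perturbation of `f` by `Q`. -/
def perturbedOp {𝕜 : Type} [RCLike 𝕜] (f : I → I) (Q : Kernel I I) (h : L1 𝕜) : L1 𝕜 :=
  transitionOp Q (perronFrobenius f h)

/-! ### Piecewise expanding maps -/

/-- A map of `[0,1]`, viewed as a real function (of which only the restriction to `[0,1]` is
used). -/
def realMap (f : I → I) : ℝ → ℝ := Set.IccExtend (zero_le_one' ℝ) fun x => (f x : ℝ)

/-- `f` is piecewise `C²`: there are `0 = a 0 < a 1 < ⋯ < a n = 1` such that on each of the
intervals of the partition `f` is given by a `C²`-diffeomorphism `F j` of the closed interval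
`[a j, a (j+1)]` onto its image. Each partition point belongs to one of the two adjacent
intervals, so that `f` takes there the value of one of the two adjacent branches. -/
def IsPiecewiseC2 (f : I → I) : Prop :=
  ∃ (n : ℕ) (a : Fin (n + 1) → ℝ) (F : Fin n → ℝ → ℝ),
    StrictMono a ∧ a 0 = 0 ∧ a (Fin.last n) = 1 ∧
    (∀ j : Fin n, ContDiffOn ℝ 2 (F j) (Icc (a j.castSucc) (a j.succ)) ∧
      (∀ t ∈ Icc (a j.castSucc) (a j.succ),
        derivWithin (F j) (Icc (a j.castSucc) (a j.succ)) t ≠ 0) ∧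
      ∀ x : I, (x : ℝ) ∈ Ioo (a j.castSucc) (a j.succ) → (f x : ℝ) = F j x) ∧
    ∀ x : I, ∃ j : Fin n, (x : ℝ) ∈ Icc (a j.castSucc) (a j.succ) ∧ (f x : ℝ) = F j x

/-- The turning points of `f`: the points of `[0,1]` where the derivative of `f` (one-sided at
`0` and `1`) does not exist. -/
def turningPoints (f : I → I) : Set I :=
  {x | ¬ DifferentiableWithinAt ℝ (realMap f) (Icc 0 1) (x : ℝ)}

/-- The expanding constant of `f`: the infimum of `|f'|` over the points where it exists. -/
def expandingConstant (f : I → I) : ℝ≥0∞ :=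
  ⨅ (x : I) (_ : x ∉ turningPoints f), ‖derivWithin (realMap f) (Icc 0 1) (x : ℝ)‖ₑ

/-- A piecewise `C²` map is piecewise expanding if some iterate has expanding constant `> 1`. -/
def IsPiecewiseExpanding (f : I → I) : Prop :=
  IsPiecewiseC2 f ∧ ∃ k : ℕ, 1 ≤ k ∧ 1 < expandingConstant (f^[k])

/-- `y` is an image of `x` under `f`, where `f` is two-valued at its discontinuities: `y` is a
limit of `f` at `x` from the left or from the right. At a point of continuity, only `y = f x`. -/
def IsImage (f : I → I) (x y : I) : Prop := MapClusterPt y (𝓝[≠] x) f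

/-- The periodic turning points of `f`: those that return to themselves along images of `f`. -/
def periodicTurningPoints (f : I → I) : Set I :=
  {c | c ∈ turningPoints f ∧ Relation.TransGen (IsImage f) c c}

/-! ### The essential spectral radius -/

/-- The spectrum of an operator `T` on the space of complex functions of bounded variation: the
`z` for which `T - z` is not a bijection of that space. (For a bounded operator on a Banach space
the inverse of a bijection is automatically bounded.) -/
def spectrumBV (T : L1 ℂ → L1 ℂ) : Set ℂ :=
  {z | ¬ BijOn (fun h => T h - z • h) (BV ℂ) (BV ℂ)}

/-- `z` is an isolated eigenvalue of finite (algebraic) multiplicity of `T` on the space of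
complex functions of bounded variation: that space is the direct sum of two subspaces `E` and `W`
invariant under `T - z`, where `E` has finite dimension, `T - z` is nilpotent on `E`, and `T - z`
is a bijection of `W`. -/
def IsIsolatedEigenvalueBV (T : L1 ℂ → L1 ℂ) (z : ℂ) : Prop :=
  z ∈ spectrumBV T ∧
  (∃ δ > 0, ∀ w ∈ spectrumBV T, dist w z < δ → w = z) ∧
  (∃ h ∈ BV ℂ, h ≠ 0 ∧ T h = z • h) ∧
  ∃ E W : Submodule ℂ (L1 ℂ),
    FiniteDimensional ℂ E ∧ Disjoint E W ∧ ((E ⊔ W : Submodule ℂ (L1 ℂ)) : Set (L1 ℂ)) = BV ℂ ∧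
    MapsTo (fun h => T h - z • h) E E ∧
    (∃ k : ℕ, ∀ h ∈ E, (fun h => T h - z • h)^[k] h = 0) ∧
    BijOn (fun h => T h - z • h) W W

/-- The essential spectral radius of the Perron-Frobenius operator of `f` on the space of
functions of bounded variation: the smallest `θ` such that all elements of the spectrum outside
the disk of radius `θ` are isolated eigenvalues of finite multiplicity. -/
def essSpectralRadius (f : I → I) : ℝ≥0∞ :=
  sInf {θ | ∀ z ∈ spectrumBV (perronFrobenius f), θ < ‖z‖ₑ →
    IsIsolatedEigenvalueBV (perronFrobenius f) z}

/-! ### Random perturbations -/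

/-- A family of transition probabilities `Q ε`, `ε > 0`, that act on densities: the image of
Lebesgue measure under `Q ε` has a density. -/
def IsPerturbationFamily (Q : ℝ → Kernel I I) : Prop :=
  ∀ ε > 0, IsMarkovKernel (Q ε) ∧ (volume : Measure I).bind (Q ε) ≪ volume

/-- Locality: `Q ε (x, A) = 0` if `dist(x, A) > ε`. -/
def IsLocalFamily (Q : ℝ → Kernel I I) : Prop :=
  ∀ ε > 0, ∀ (x : I) (A : Set I), MeasurableSet A →
    ENNReal.ofReal ε < Metric.infEDist x A → Q ε x A = 0

/-- Smallness: `‖Q ε h - h‖₁ ≤ d ε * var(h)` with `d ε → 0` as `ε → 0`. -/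
def IsSmallFamily (Q : ℝ → Kernel I I) : Prop :=
  ∃ d : ℝ → ℝ≥0, Tendsto d (𝓝[>] 0) (𝓝 0) ∧
    ∀ ε > 0, ∀ h ∈ BV ℝ, ‖transitionOp (Q ε) h - h‖ₑ ≤ d ε * variation h

/-- Regularity: `var(Q ε h) ≤ var(h) + C ‖h‖₁` with `C` independent of `ε` and `h`. -/
def IsRegularFamily (Q : ℝ → Kernel I I) : Prop :=
  ∃ C : ℝ≥0, ∀ ε > 0, ∀ h ∈ BV ℝ, variation (transitionOp (Q ε) h) ≤ variation h + C * ‖h‖ₑ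

end

/-!
The variation is estimated in a weighted form: `weightedVariation w h` is the supremum of
`|∫ Φ' h|` over Lipschitz test functions with `|Φ| ≤ w`. Locality turns a weight `w` at the cost of
`O(‖h‖₁)` into its supremum over small balls when `Q ε` is applied
(`exists_weightedVariation_transitionOp_le`, by localizing `h` and truncating test functions). For
`P_f`, the test function `Φ` is replaced by `Φ ∘ F j / (F j)'` on each branch; the jumps at the
turning points are removed by subtracting narrow tents, at the cost of a factor `2` near the turning
points. So a step of the perturbed operator acts on weights by `weightStep ρ`: the maximum over
nearby branches of the old weight divided by the slope, times `2` near turning points. Starting from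
the constant weight `1`, the variation of the `N`-th iterate is bounded by `weightStep^[N] 1`, up to
`O(‖h‖₁)` (`exists_weightedVariation_iterate_le`).

As `ρ → 0`, these weights are bounded by those of the limit step `limitStep`, by compactness
(`exists_forall_iterate_weightStep_le`). The limit weight of order `N` at `x` is the maximum, over
the orbits of length `N` of the two-valued map, of the product of the reciprocal slopes and of a
factor `2` for each visit to a turning point. In the absence of periodic turning points an orbit
visits each turning point at most once, so there is a bounded number of such factors; and it is cut
by these visits into a bounded number of segments, each of which is a limit of genuine orbits. Hence
the limit weight is `O(r ^ N)` as soon as `1 / |(f^n)'| = O(r ^ n)`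
(`exists_iterate_limitStep_le`).

This last bound holds for every `r` above the essential spectral radius
(`exists_expansionBound`). The Perron-Frobenius operator `P` acts boundedly on the Banach space of
complex functions of bounded variation; above the essential spectral radius there are finitely many
points of the spectrum, and on the intersection of the complements of their generalized eigenspaces,
which has finite codimension, the powers of `P` are `O(r ^ n)` by the spectral radius formula
(`exists_cofg_norm_pow_le`). Among the combinations of the indicator functions of many tiny
intervals near a point there is one, nonzero, in that subspace. Its image under `P^n` has variation
`O(r ^ n)`, but its mean over the image of one of the intervals is at least of the order of
`1 / |(f^n)'|` in modulus, whence the bound.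
-/

noncomputable section

/-! ### Variation and Lipschitz test functions -/

lemma ae_unitInterval_of_ae {p : ℝ → Prop} (hp : ∀ᵐ t, p t) : ∀ᵐ x : I, p x :=
  unitInterval.measurePreserving_coe.quasiMeasurePreserving.ae (ae_restrict_of_ae hp)

lemma ae_mem_Ioo_unitInterval : ∀ᵐ x : I, (x : ℝ) ∈ Ioo (0 : ℝ) 1 := by
  have h0 : ∀ᵐ x : ℝ, x ≠ 0 := by simp [ae_iff]
  have h1 : ∀ᵐ x : ℝ, x ≠ 1 := by simp [ae_iff]
  filter_upwards [ae_unitInterval_of_ae h0, ae_unitInterval_of_ae h1] with x hx0 hx1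
  exact ⟨lt_of_le_of_ne x.2.1 (Ne.symm hx0), lt_of_le_of_ne x.2.2 hx1⟩

section Pairing

variable {𝕜 : Type} [RCLike 𝕜]

lemma integrable_deriv_mul {K : ℝ≥0} {Φ : ℝ → 𝕜} (hΦ : LipschitzWith K Φ) (h : L1 𝕜) :
    Integrable (fun x : I => deriv Φ x * h x) :=
  (L1.integrable_coeFn h).bdd_mul
    ((measurable_deriv Φ).comp measurable_subtype_coe).aestronglyMeasurable
    (ae_of_all _ fun x => norm_deriv_le_of_lipschitz (x₀ := (x : ℝ)) hΦ)

/-- Test functions in the definition of the variation may be taken merely Lipschitz, with a bound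
on `[0,1]` only: the Steklov averages `k ∫_t^{t+1/k} Φ` are `C¹` and their derivatives converge
boundedly almost everywhere to that of `Φ`. -/
lemma enorm_integral_deriv_mul_le_variation {K : ℝ≥0} {Φ : ℝ → ℝ} (hΦ : LipschitzWith K Φ)
    (hb : ∀ x : I, |Φ x| ≤ 1) (h : L1 𝕜) :
    ‖∫ x : I, ((deriv Φ x : ℝ) : 𝕜) * h x‖ₑ ≤ variation h := by
  set Ψ : ℝ → ℝ := fun t => Φ (projIcc (0 : ℝ) 1 zero_le_one t) with hΨdef
  have hΨ : LipschitzWith K Ψ := by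
    have := hΦ.comp ((LipschitzWith.subtype_val (Icc (0:ℝ) 1)).comp
      (LipschitzWith.projIcc (zero_le_one' ℝ)))
    rw [one_mul, mul_one] at this
    exact this
  have hΨb : ∀ t, |Ψ t| ≤ 1 := fun t => hb _
  have hΨc : Continuous Ψ := hΨ.continuous
  let δ : ℕ → ℝ := fun k => 1 / ((k : ℝ) + 1)
  have hδ : ∀ k, 0 < δ k := fun k => by positivity
  have hδ0 : Tendsto δ atTop (𝓝 0) := tendsto_one_div_add_atTop_nhds_zero_nat
  let S : ℕ → ℝ → ℝ := fun k t => (δ k)⁻¹ * ∫ u in t..(t + δ k), Ψ u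
  have hSd : ∀ k t, HasDerivAt (S k) ((δ k)⁻¹ * (Ψ (t + δ k) - Ψ t)) t := by
    intro k t
    have hG : ∀ t, HasDerivAt (fun s => ∫ u in (0:ℝ)..s, Ψ u) (Ψ t) t := fun t =>
      intervalIntegral.integral_hasDerivAt_right (hΨc.intervalIntegrable _ _)
        (hΨc.stronglyMeasurableAtFilter _ _) hΨc.continuousAt
    have h1 : HasDerivAt (fun s => ∫ u in (0:ℝ)..(s + δ k), Ψ u) (Ψ (t + δ k)) t :=
      (hG (t + δ k)).comp_add_const t (δ k)
    have h2 := ((h1.sub (hG t)).const_mul (δ k)⁻¹)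
    convert! h2 using 1
    ext s
    simp only [S, Pi.sub_apply]
    rw [intervalIntegral.integral_interval_sub_left (hΨc.intervalIntegrable _ _)
      (hΨc.intervalIntegrable _ _)]
  have hSb : ∀ k t, |S k t| ≤ 1 := by
    intro k t
    have := intervalIntegral.norm_integral_le_of_norm_le_const (a := t) (b := t + δ k) (f := Ψ)
      (C := 1) (fun u _ => hΨb u)
    simp only [S, abs_mul, abs_inv, abs_of_pos (hδ k)]
    rw [Real.norm_eq_abs, add_sub_cancel_left, abs_of_pos (hδ k), one_mul] at this
    rw [inv_mul_le_iff₀ (hδ k)]; simpa using this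
  have hSc : ∀ k, ContDiff ℝ 1 (S k) := by
    intro k
    rw [contDiff_one_iff_deriv]
    refine ⟨fun t => (hSd k t).differentiableAt, ?_⟩
    rw [show deriv (S k) = fun t => (δ k)⁻¹ * (Ψ (t + δ k) - Ψ t) from
      funext fun t => (hSd k t).deriv]
    fun_prop
  let β : ContDiffBump (1 / 2 : ℝ) := ⟨1, 2, one_pos, one_lt_two⟩
  have key : ∀ k, ‖∫ x : I, (((δ k)⁻¹ * (Ψ (x + δ k) - Ψ x) : ℝ) : 𝕜) * h x‖ₑ
      ≤ variation h := by
    intro k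
    let φ : ℝ → 𝕜 := fun t => ((β t * S k t : ℝ) : 𝕜)
    have hφd : ∀ x : I, deriv φ x = (((δ k)⁻¹ * (Ψ (x + δ k) - Ψ x) : ℝ) : 𝕜) := by
      intro x
      have hx : (x : ℝ) ∈ Metric.ball (1 / 2 : ℝ) 1 := by
        rw [Metric.mem_ball, Real.dist_eq, abs_lt]
        constructor <;> linarith [x.2.1, x.2.2]
      have hev : (fun t => (S k t : 𝕜)) =ᶠ[𝓝 (x : ℝ)] φ := by
        filter_upwards [Metric.isOpen_ball.mem_nhds hx] with t ht
        simp [φ, β.one_of_mem_closedBall (Metric.ball_subset_closedBall ht)]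
      exact (((RCLike.ofRealCLM (K := 𝕜)).hasFDerivAt.comp_hasDerivAt (x : ℝ)
        (hSd k x)).congr_of_eventuallyEq hev.symm).deriv
    have hφ : ContDiff ℝ 1 φ ∧ HasCompactSupport φ ∧ ∀ t, ‖φ t‖ ≤ 1 := by
      refine ⟨?_, ?_, ?_⟩
      · exact (RCLike.ofRealCLM (K := 𝕜)).contDiff.comp ((β.contDiff (n := 1)).mul (hSc k))
      · exact (β.hasCompactSupport.mul_right (f' := S k)).comp_left (g := ((↑) : ℝ → 𝕜))
          RCLike.ofReal_zero
      · intro t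
        simp only [φ]
        rw [RCLike.norm_ofReal, abs_mul, abs_of_nonneg β.nonneg]
        exact mul_le_one₀ β.le_one (abs_nonneg _) (hSb k t)
    refine le_trans (le_of_eq ?_) (le_iSup₂ (f := fun (φ : ℝ → 𝕜)
      (_ : ContDiff ℝ 1 φ ∧ HasCompactSupport φ ∧ ∀ t, ‖φ t‖ ≤ 1) =>
        ‖∫ x : I, deriv φ (x : ℝ) * h x‖ₑ) φ hφ)
    simp only [hφd]
  have hlim : Tendsto (fun k => ∫ x : I, (((δ k)⁻¹ * (Ψ (x + δ k) - Ψ x) : ℝ) : 𝕜) * h x) atTop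
      (𝓝 (∫ x : I, ((deriv Φ x : ℝ) : 𝕜) * h x)) := by
    refine tendsto_integral_of_dominated_convergence (fun x => K * ‖h x‖) ?_
      ((L1.integrable_coeFn h).norm.const_mul _) ?_ ?_
    · intro k
      refine AEStronglyMeasurable.mul (Continuous.aestronglyMeasurable ?_)
        (L1.integrable_coeFn h).aestronglyMeasurable
      fun_prop
    · intro k
      refine ae_of_all _ fun x => ?_
      rw [norm_mul, RCLike.norm_ofReal, abs_mul, abs_inv, abs_of_pos (hδ k)]
      gcongr
      rw [inv_mul_le_iff₀ (hδ k), mul_comm]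
      have := hΨ.dist_le_mul (x + δ k) x
      rwa [Real.dist_eq, Real.dist_eq, add_sub_cancel_left, abs_of_pos (hδ k)] at this
    · filter_upwards [ae_mem_Ioo_unitInterval, ae_unitInterval_of_ae hΦ.ae_differentiableAt_real]
        with x hx hdx
      have hev : Φ =ᶠ[𝓝 (x : ℝ)] Ψ := by
        filter_upwards [Ioo_mem_nhds hx.1 hx.2] with t ht
        simp [Ψ, projIcc_of_mem (zero_le_one' ℝ) (Ioo_subset_Icc_self ht)]
      have hd : HasDerivAt Ψ (deriv Φ x) x := hdx.hasDerivAt.congr_of_eventuallyEq hev.symm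
      refine Tendsto.mul_const _ ((RCLike.continuous_ofReal.tendsto _).comp ?_)
      have := (hasDerivAt_iff_tendsto_slope_zero.1 hd).comp
        (tendsto_nhdsWithin_iff.2 ⟨hδ0, Eventually.of_forall fun k => (hδ k).ne'⟩)
      exact this
  exact le_of_tendsto hlim.enorm (Eventually.of_forall key)

lemma variation_smul_le (c : 𝕜) (h : L1 𝕜) : variation (c • h) ≤ ‖c‖ₑ * variation h := by
  refine iSup₂_le fun φ hφ => ?_
  have : ∫ x : I, deriv φ x * (c • h) x = c * ∫ x : I, deriv φ x * h x := by
    rw [← integral_const_mul]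
    refine integral_congr_ae ?_
    filter_upwards [Lp.coeFn_smul c h] with x hx
    rw [hx]; simp only [Pi.smul_apply, smul_eq_mul]; ring
  rw [this, enorm_mul]
  gcongr
  exact le_iSup₂ (f := fun (φ : ℝ → 𝕜)
      (_ : ContDiff ℝ 1 φ ∧ HasCompactSupport φ ∧ ∀ t, ‖φ t‖ ≤ 1) =>
        ‖∫ x : I, deriv φ (x : ℝ) * h x‖ₑ) φ hφ

lemma variation_add_le (g h : L1 𝕜) : variation (g + h) ≤ variation g + variation h := by
  refine iSup₂_le fun φ hφ => ?_
  obtain ⟨K, hK⟩ := hφ.1.lipschitzWith_of_hasCompactSupport hφ.2.1 one_ne_zero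
  have : ∫ x : I, deriv φ x * (g + h) x
      = (∫ x : I, deriv φ x * g x) + ∫ x : I, deriv φ x * h x := by
    rw [← integral_add (integrable_deriv_mul hK g) (integrable_deriv_mul hK h)]
    refine integral_congr_ae ?_
    filter_upwards [Lp.coeFn_add g h] with x hx
    rw [hx]; simp only [Pi.add_apply]; ring
  rw [this]
  refine (enorm_add_le _ _).trans (add_le_add ?_ ?_)
  · exact le_iSup₂ (f := fun (φ : ℝ → 𝕜)
      (_ : ContDiff ℝ 1 φ ∧ HasCompactSupport φ ∧ ∀ t, ‖φ t‖ ≤ 1) =>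
        ‖∫ x : I, deriv φ (x : ℝ) * g x‖ₑ) φ hφ
  · exact le_iSup₂ (f := fun (φ : ℝ → 𝕜)
      (_ : ContDiff ℝ 1 φ ∧ HasCompactSupport φ ∧ ∀ t, ‖φ t‖ ≤ 1) =>
        ‖∫ x : I, deriv φ (x : ℝ) * h x‖ₑ) φ hφ

lemma variation_zero : variation (0 : L1 𝕜) = 0 := by
  have := variation_smul_le (0 : 𝕜) 0
  simpa using this

end Pairing

/-- The variation weighted by `w`: the supremum of `|∫ Φ' h|` over Lipschitz test functions with
`|Φ| ≤ w` on `[0,1]`. Lipschitz functions, unlike `C¹` functions, can be truncated and glued. -/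
def weightedVariation (w : I → ℝ≥0∞) (h : L1 ℝ) : ℝ≥0∞ :=
  ⨆ (Φ : ℝ → ℝ) (_ : (∃ K : ℝ≥0, LipschitzWith K Φ) ∧ ∀ x : I, ‖Φ x‖ₑ ≤ w x),
    ‖∫ x : I, deriv Φ x * h x‖ₑ

lemma enorm_integral_le_weightedVariation {w : I → ℝ≥0∞} {K : ℝ≥0} {Φ : ℝ → ℝ}
    (hΦ : LipschitzWith K Φ) (hw : ∀ x : I, ‖Φ x‖ₑ ≤ w x) (h : L1 ℝ) :
    ‖∫ x : I, deriv Φ x * h x‖ₑ ≤ weightedVariation w h :=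
  le_iSup₂ (f := fun (Φ : ℝ → ℝ)
    (_ : (∃ K : ℝ≥0, LipschitzWith K Φ) ∧ ∀ x : I, ‖Φ x‖ₑ ≤ w x) =>
      ‖∫ x : I, deriv Φ x * h x‖ₑ) Φ ⟨⟨K, hΦ⟩, hw⟩

/-- A bound for the weighted variation by the variation, from an upper bound of the weight. -/
lemma enorm_integral_deriv_mul_le {K M : ℝ≥0} {Φ : ℝ → ℝ} (hΦ : LipschitzWith K Φ)
    (hb : ∀ x : I, |Φ x| ≤ M) (h : L1 ℝ) :
    ‖∫ x : I, deriv Φ x * h x‖ₑ ≤ M * variation h := by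
  rcases eq_or_ne M 0 with rfl | hM
  · have h0 : ∀ᵐ x : I, deriv Φ x * h x = 0 := by
      filter_upwards [ae_mem_Ioo_unitInterval] with x hx
      have hev : Φ =ᶠ[𝓝 (x : ℝ)] fun _ => 0 := by
        filter_upwards [Ioo_mem_nhds hx.1 hx.2] with t ht
        simpa using hb ⟨t, Ioo_subset_Icc_self ht⟩
      rw [hev.deriv_eq]; simp
    rw [integral_congr_ae h0]; simp
  · have hM' : (0 : ℝ) < M := by positivity
    have hs : LipschitzWith (M⁻¹ * K) (fun t => (M : ℝ)⁻¹ * Φ t) := by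
      refine LipschitzWith.of_dist_le_mul fun s t => ?_
      rw [Real.dist_eq, ← mul_sub, abs_mul, abs_of_pos (inv_pos.2 hM'), NNReal.coe_mul,
        NNReal.coe_inv, mul_assoc]
      gcongr
      exact hΦ.dist_le_mul s t
    have h1 := enorm_integral_deriv_mul_le_variation (𝕜 := ℝ) hs (fun x => by
      rw [abs_mul, abs_of_pos (inv_pos.2 hM'), inv_mul_le_iff₀ hM', mul_one]; exact hb x) h
    have h2 : ∫ x : I, deriv Φ x * h x
        = M * ∫ x : I, deriv (fun t => (M : ℝ)⁻¹ * Φ t) x * h x := by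
      rw [← integral_const_mul]
      congr 1; ext x
      rw [deriv_const_mul_field, ← mul_assoc, ← mul_assoc, mul_inv_cancel₀ hM'.ne', one_mul]
    rw [h2, enorm_mul]
    have h3 : ‖(M : ℝ)‖ₑ = M := by simp [enorm_eq_nnnorm]
    rw [h3]
    gcongr
    simpa using h1

lemma weightedVariation_le {w : I → ℝ≥0∞} {M : ℝ≥0} (hw : ∀ x, w x ≤ M) (h : L1 ℝ) :
    weightedVariation w h ≤ M * variation h := by
  refine iSup₂_le fun Φ hΦ => ?_
  obtain ⟨⟨K, hK⟩, hb⟩ := hΦ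
  refine enorm_integral_deriv_mul_le hK (fun x => ?_) h
  have := (hb x).trans (hw x)
  rw [enorm_eq_nnnorm, ENNReal.coe_le_coe] at this
  exact_mod_cast this

lemma variation_le_weightedVariation_one (h : L1 ℝ) :
    variation h ≤ weightedVariation (fun _ => 1) h := by
  refine iSup₂_le fun φ hφ => ?_
  obtain ⟨K, hK⟩ := hφ.1.lipschitzWith_of_hasCompactSupport hφ.2.1 one_ne_zero
  refine enorm_integral_le_weightedVariation hK (fun x => ?_) h
  rw [enorm_eq_nnnorm]
  exact_mod_cast hφ.2.2 x

/-! ### Transition operators and the Perron-Frobenius operator on `L¹` -/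

section Density

variable {𝕜 : Type} [RCLike 𝕜]

lemma L1_eq_of_setIntegral_eq {g h : L1 𝕜}
    (H : ∀ A : Set I, MeasurableSet A → ∫ x in A, g x = ∫ x in A, h x) : g = h :=
  Lp.ext (Integrable.ae_eq_of_forall_setIntegral_eq _ _ (L1.integrable_coeFn g)
    (L1.integrable_coeFn h) fun A hA _ => H A hA)

lemma densityOf_eq {ν : Set I → 𝕜} {g : L1 𝕜}
    (hg : ∀ A : Set I, MeasurableSet A → ∫ x in A, g x = ν A) : densityOf ν = g := by
  have H : ∃ g : L1 𝕜, ∀ A : Set I, MeasurableSet A → ∫ x in A, g x = ν A := ⟨g, hg⟩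
  rw [densityOf, dif_pos H]
  exact L1_eq_of_setIntegral_eq fun A hA => (H.choose_spec A hA).trans (hg A hA).symm

lemma setIntegral_L1_add (g h : L1 𝕜) (A : Set I) :
    ∫ x in A, (g + h) x = (∫ x in A, g x) + ∫ x in A, h x := by
  rw [← integral_add (L1.integrable_coeFn g).integrableOn (L1.integrable_coeFn h).integrableOn]
  exact integral_congr_ae (ae_restrict_of_ae (Lp.coeFn_add g h))

lemma setIntegral_L1_smul (c : 𝕜) (h : L1 𝕜) (A : Set I) :
    ∫ x in A, (c • h) x = c * ∫ x in A, h x := by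
  rw [← integral_const_mul]
  exact integral_congr_ae (ae_restrict_of_ae (Lp.coeFn_smul c h))

lemma enorm_L1_eq_lintegral (h : L1 𝕜) : ‖h‖ₑ = ∫⁻ x, ‖h x‖ₑ := by
  rw [Lp.enorm_def, eLpNorm_one_eq_lintegral_enorm]

end Density

section Transition

lemma measurable_kernel_real {Q : Kernel I I} {A : Set I} (hA : MeasurableSet A) :
    Measurable fun x => (Q x).real A :=
  (Q.measurable_coe hA).ennreal_toReal

variable {Q : Kernel I I} [IsMarkovKernel Q]

lemma integrable_kernel_mul {A : Set I} (hA : MeasurableSet A) {h : I → ℝ} (hh : Integrable h) :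
    Integrable fun x => (Q x).real A * h x :=
  hh.bdd_mul (c := 1) (measurable_kernel_real hA).aestronglyMeasurable
    (ae_of_all _ fun x => by rw [Real.norm_of_nonneg measureReal_nonneg]; exact measureReal_le_one)

lemma exists_density_of_integrable (hac : (volume : Measure I).bind Q ≪ volume) {h : I → ℝ}
    (hh : Integrable h) :
    ∃ g : I → ℝ, Integrable g ∧
      ∀ A : Set I, MeasurableSet A → ∫ x in A, g x = ∫ x, (Q x).real A * max (h x) 0 := by
  let μ : Measure I := volume.withDensity fun x => ENNReal.ofReal (h x)
  have hμfin : IsFiniteMeasure μ := isFiniteMeasure_withDensity_ofReal hh.2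
  have hμ : μ ≪ volume := withDensity_absolutelyContinuous _ _
  have hν : μ.bind Q ≪ volume := (hμ.comp_right Q).trans hac
  refine ⟨fun x => ((μ.bind Q).rnDeriv volume x).toReal, Measure.integrable_toReal_rnDeriv,
    fun A hA => ?_⟩
  rw [Measure.setIntegral_toReal_rnDeriv hν, measureReal_def,
    Measure.bind_apply hA Q.aemeasurable]
  have h1 : (∫⁻ x, Q x A ∂μ).toReal = ∫ x, (Q x).real A ∂μ :=
    (integral_toReal (Q.measurable_coe hA).aemeasurable
      (ae_of_all _ fun x => measure_lt_top _ _)).symm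
  rw [h1]
  obtain ⟨h', hh'm, hh'⟩ := hh.1
  have h2 : μ = volume.withDensity fun x => ENNReal.ofReal (h' x) :=
    withDensity_congr_ae (by filter_upwards [hh'] with x hx; rw [hx])
  rw [h2, integral_withDensity_eq_integral_toReal_smul hh'm.measurable.ennreal_ofReal
    (ae_of_all _ fun x => ENNReal.ofReal_lt_top)]
  refine integral_congr_ae ?_
  filter_upwards [hh'] with x hx
  rw [hx, ENNReal.toReal_ofReal', smul_eq_mul, mul_comm]

lemma setIntegral_transitionOp (hac : (volume : Measure I).bind Q ≪ volume) (h : L1 ℝ)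
    {A : Set I} (hA : MeasurableSet A) :
    ∫ x in A, transitionOp Q h x = ∫ x, (Q x).real A * h x := by
  have hh := L1.integrable_coeFn h
  obtain ⟨g₁, hg₁, H₁⟩ := exists_density_of_integrable hac hh
  obtain ⟨g₂, hg₂, H₂⟩ := exists_density_of_integrable hac hh.neg
  have key : ∀ B : Set I, MeasurableSet B →
      ∫ x in B, ((hg₁.sub hg₂).toL1 (g₁ - g₂) : L1 ℝ) x
        = ∫ x, (((Q x).real B : ℝ) : ℝ) * h x := by
    intro B hB
    have h1 : ∫ x in B, ((hg₁.sub hg₂).toL1 (g₁ - g₂) : L1 ℝ) x = ∫ x in B, (g₁ x - g₂ x) :=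
      integral_congr_ae (ae_restrict_of_ae (hg₁.sub hg₂).coeFn_toL1)
    rw [h1, integral_sub hg₁.integrableOn hg₂.integrableOn, H₁ B hB, H₂ B hB,
      ← integral_sub (integrable_kernel_mul hB hh.pos_part)
        (integrable_kernel_mul hB hh.neg.pos_part)]
    refine integral_congr_ae (ae_of_all _ fun x => ?_)
    simp only [Pi.neg_apply]
    rw [← mul_sub]
    congr 1
    rcases le_total (h x) 0 with hx | hx
    · rw [max_eq_right hx, max_eq_left (by linarith)]; ring
    · rw [max_eq_left hx, max_eq_right (by linarith)]; ring
  have := densityOf_eq key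
  rw [show transitionOp Q h = densityOf (fun A => ∫ x, (((Q x).real A : ℝ) : ℝ) * h x) from rfl,
    this]
  exact key A hA

lemma transitionOp_eq_of_forall (hac : (volume : Measure I).bind Q ≪ volume) {g h : L1 ℝ}
    (H : ∀ A : Set I, MeasurableSet A → ∫ x in A, g x = ∫ x, (Q x).real A * h x) :
    transitionOp Q h = g :=
  L1_eq_of_setIntegral_eq fun A hA => (setIntegral_transitionOp hac h hA).trans (H A hA).symm

lemma transitionOp_add (hac : (volume : Measure I).bind Q ≪ volume) (g h : L1 ℝ) :
    transitionOp Q (g + h) = transitionOp Q g + transitionOp Q h := by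
  refine transitionOp_eq_of_forall hac fun A hA => ?_
  rw [setIntegral_L1_add, setIntegral_transitionOp hac g hA, setIntegral_transitionOp hac h hA,
    ← integral_add (integrable_kernel_mul hA (L1.integrable_coeFn g))
      (integrable_kernel_mul hA (L1.integrable_coeFn h))]
  refine integral_congr_ae ?_
  filter_upwards [Lp.coeFn_add g h] with x hx
  rw [hx]; simp only [Pi.add_apply]; ring

lemma transitionOp_smul (hac : (volume : Measure I).bind Q ≪ volume) (c : ℝ) (h : L1 ℝ) :
    transitionOp Q (c • h) = c • transitionOp Q h := by
  refine transitionOp_eq_of_forall hac fun A hA => ?_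
  rw [setIntegral_L1_smul, setIntegral_transitionOp hac h hA, ← integral_const_mul]
  refine integral_congr_ae ?_
  filter_upwards [Lp.coeFn_smul c h] with x hx
  rw [hx]; simp only [Pi.smul_apply, smul_eq_mul]; ring

lemma transitionOp_sum (hac : (volume : Measure I).bind Q ≪ volume) {ι : Type*} (s : Finset ι)
    (h : ι → L1 ℝ) : transitionOp Q (∑ i ∈ s, h i) = ∑ i ∈ s, transitionOp Q (h i) := by
  classical
  induction s using Finset.induction_on with
  | empty => simpa using transitionOp_smul hac (0 : ℝ) 0
  | insert i s hi ih => rw [Finset.sum_insert hi, Finset.sum_insert hi, transitionOp_add hac, ih]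

lemma norm_transitionOp_le (hac : (volume : Measure I).bind Q ≪ volume) (h : L1 ℝ) :
    ‖transitionOp Q h‖ ≤ ‖h‖ := by
  set g := transitionOp Q h with hg
  have hgi := L1.integrable_coeFn g
  have hhi := L1.integrable_coeFn h
  obtain ⟨g', hg'm, hg'⟩ := hgi.1
  have hA : MeasurableSet {x | 0 ≤ g' x} := measurableSet_le measurable_const hg'm.measurable
  set A := {x | 0 ≤ g' x}
  rw [L1.norm_eq_integral_norm, L1.norm_eq_integral_norm, ← integral_add_compl hA hgi.norm]
  have h1 : ∫ x in A, ‖g x‖ = ∫ x in A, g x := by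
    refine integral_congr_ae ?_
    filter_upwards [ae_restrict_of_ae hg', ae_restrict_mem hA] with x hx hxA
    rw [hx, Real.norm_of_nonneg hxA]
  have h2 : ∫ x in Aᶜ, ‖g x‖ = - ∫ x in Aᶜ, g x := by
    rw [← integral_neg]
    refine integral_congr_ae ?_
    filter_upwards [ae_restrict_of_ae hg', ae_restrict_mem hA.compl] with x hx hxA
    rw [hx, Real.norm_of_nonpos (le_of_not_ge hxA)]
  rw [h1, h2, hg, setIntegral_transitionOp hac h hA, setIntegral_transitionOp hac h hA.compl,
    ← sub_eq_add_neg, ← integral_sub (integrable_kernel_mul hA hhi)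
      (integrable_kernel_mul hA.compl hhi)]
  refine integral_mono ((integrable_kernel_mul hA hhi).sub (integrable_kernel_mul hA.compl hhi))
    hhi.norm fun x => ?_
  simp only
  rw [← sub_mul]
  refine (le_abs_self _).trans ?_
  rw [abs_mul]
  refine mul_le_of_le_one_left (abs_nonneg _) ?_
  rw [probReal_compl_eq_one_sub hA, abs_le]
  have := measureReal_le_one (μ := Q x) (s := A)
  have := measureReal_nonneg (μ := Q x) (s := A)
  constructor <;> linarith

end Transition

section PerronFrobenius

variable {f : I → I}

lemma bind_deterministic_absolutelyContinuous
    (hf : Measure.QuasiMeasurePreserving f volume volume) :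
    (volume : Measure I).bind (Kernel.deterministic f hf.measurable) ≪ volume := by
  rw [Measure.deterministic_comp_eq_map]
  exact hf.absolutelyContinuous

lemma integral_deterministic_mul (hf : Measurable f) {A : Set I} (hA : MeasurableSet A)
    (h : L1 ℝ) :
    ∫ x, (Kernel.deterministic f hf x).real A * h x = ∫ x in f ⁻¹' A, h x := by
  rw [← integral_indicator (hf hA)]
  congr 1; ext x
  rw [measureReal_def, Kernel.deterministic_apply' hf _ hA]
  by_cases hx : f x ∈ A <;> simp [hx]

lemma perronFrobenius_eq_transitionOp (hf : Measure.QuasiMeasurePreserving f volume volume)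
    (h : L1 ℝ) :
    perronFrobenius f h = transitionOp (Kernel.deterministic f hf.measurable) h :=
  densityOf_eq fun A hA => by
    rw [setIntegral_transitionOp (bind_deterministic_absolutelyContinuous hf) h hA,
      integral_deterministic_mul hf.measurable hA]

lemma setIntegral_perronFrobenius_real (hf : Measure.QuasiMeasurePreserving f volume volume)
    (h : L1 ℝ) {A : Set I} (hA : MeasurableSet A) :
    ∫ x in A, perronFrobenius f h x = ∫ x in f ⁻¹' A, h x := by
  rw [perronFrobenius_eq_transitionOp hf, setIntegral_transitionOp
    (bind_deterministic_absolutelyContinuous hf) h hA, integral_deterministic_mul hf.measurable hA]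

lemma norm_perronFrobenius_real_le (hf : Measure.QuasiMeasurePreserving f volume volume)
    (h : L1 ℝ) : ‖perronFrobenius f h‖ ≤ ‖h‖ := by
  rw [perronFrobenius_eq_transitionOp hf]
  exact norm_transitionOp_le (bind_deterministic_absolutelyContinuous hf) h

/-- The Perron-Frobenius operator is dual to composition with `f`. -/
lemma integral_mul_perronFrobenius (hf : Measure.QuasiMeasurePreserving f volume volume)
    (h : L1 ℝ) {g : I → ℝ} (hg : Measurable g) {c : ℝ} (hc : ∀ x, |g x| ≤ c) :
    ∫ x, g x * perronFrobenius f h x = ∫ x, g (f x) * h x := by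
  have hP := L1.integrable_coeFn (perronFrobenius f h)
  have hh := L1.integrable_coeFn h
  have hsimple : ∀ s : SimpleFunc I ℝ,
      ∫ x, s x * perronFrobenius f h x = ∫ x, s (f x) * h x := by
    intro s
    induction s using SimpleFunc.induction with
    | const c hs =>
      rename_i s
      have h1 : ∀ u : I → ℝ, (fun x => (SimpleFunc.piecewise s hs (SimpleFunc.const I c)
          (SimpleFunc.const I 0)) x * u x) = s.indicator fun x => c * u x := by
        intro u; ext x; by_cases hx : x ∈ s <;> simp [hx]
      have h2 : (fun x => (SimpleFunc.piecewise s hs (SimpleFunc.const I c)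
          (SimpleFunc.const I 0)) (f x) * h x) = (f ⁻¹' s).indicator fun x => c * h x := by
        ext x; by_cases hx : f x ∈ s <;> simp [hx]
      rw [h1, h2, integral_indicator hs, integral_indicator (hf.measurable hs),
        integral_const_mul, integral_const_mul, setIntegral_perronFrobenius_real hf h hs]
    | add hst hs ht =>
      rename_i s t
      obtain ⟨cs, hcs⟩ := s.exists_forall_norm_le
      obtain ⟨ct, hct⟩ := t.exists_forall_norm_le
      have i1 := hP.bdd_mul s.aestronglyMeasurable (ae_of_all _ hcs)
      have i2 := hP.bdd_mul t.aestronglyMeasurable (ae_of_all _ hct)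
      have i3 := hh.bdd_mul (f := fun x => s (f x))
        (s.measurable.comp hf.measurable).aestronglyMeasurable (ae_of_all _ fun x => hcs (f x))
      have i4 := hh.bdd_mul (f := fun x => t (f x))
        (t.measurable.comp hf.measurable).aestronglyMeasurable (ae_of_all _ fun x => hct (f x))
      simp only [SimpleFunc.coe_add, Pi.add_apply, add_mul]
      rw [integral_add i1 i2, integral_add i3 i4, hs, ht]
  have hgs : StronglyMeasurable g := hg.stronglyMeasurable
  have hc0 : 0 ≤ c := (abs_nonneg _).trans (hc 0)
  have hlim : ∀ x, Tendsto (fun n => hgs.approxBounded c n x) atTop (𝓝 (g x)) := fun x =>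
    hgs.tendsto_approxBounded_of_norm_le (hc x)
  have hbd : ∀ n x, ‖hgs.approxBounded c n x‖ ≤ c := fun n x => hgs.norm_approxBounded_le hc0 n x
  have l1 : Tendsto (fun n => ∫ x, hgs.approxBounded c n x * perronFrobenius f h x) atTop
      (𝓝 (∫ x, g x * perronFrobenius f h x)) := by
    refine tendsto_integral_of_dominated_convergence (fun x => c * ‖perronFrobenius f h x‖)
      (fun n => (hgs.approxBounded c n).aestronglyMeasurable.mul hP.1) (hP.norm.const_mul _)
      (fun n => ae_of_all _ fun x => ?_) (ae_of_all _ fun x => (hlim x).mul_const _)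
    rw [norm_mul]
    gcongr
    exact hbd n x
  have l2 : Tendsto (fun n => ∫ x, hgs.approxBounded c n (f x) * h x) atTop
      (𝓝 (∫ x, g (f x) * h x)) := by
    refine tendsto_integral_of_dominated_convergence (fun x => c * ‖h x‖)
      (fun n => ((hgs.approxBounded c n).measurable.comp hf.measurable).aestronglyMeasurable.mul
        hh.1) (hh.norm.const_mul _)
      (fun n => ae_of_all _ fun x => ?_) (ae_of_all _ fun x => (hlim (f x)).mul_const _)
    rw [norm_mul]
    gcongr
    exact hbd n (f x)
  simp only [hsimple] at l1
  exact tendsto_nhds_unique l1 l2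

end PerronFrobenius

section RealImag

variable {𝕜 : Type} [RCLike 𝕜]

/-- The real part of an integrable function. -/
def rePart (h : L1 𝕜) : L1 ℝ := (RCLike.reCLM (K := 𝕜)).compLp h

/-- The imaginary part of an integrable function. -/
def imPart (h : L1 𝕜) : L1 ℝ := (RCLike.imCLM (K := 𝕜)).compLp h

/-- A real integrable function, viewed as a `𝕜`-valued one. -/
def ofRealL1 (h : L1 ℝ) : L1 𝕜 := (RCLike.ofRealCLM (K := 𝕜)).compLp h

lemma coeFn_rePart (h : L1 𝕜) : ∀ᵐ x, rePart h x = RCLike.re (h x) :=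
  ContinuousLinearMap.coeFn_compLp _ h

lemma coeFn_imPart (h : L1 𝕜) : ∀ᵐ x, imPart h x = RCLike.im (h x) :=
  ContinuousLinearMap.coeFn_compLp _ h

lemma coeFn_ofRealL1 (h : L1 ℝ) : ∀ᵐ x, (ofRealL1 h : L1 𝕜) x = (h x : 𝕜) :=
  ContinuousLinearMap.coeFn_compLp _ h

lemma norm_rePart_le (h : L1 𝕜) : ‖rePart h‖ ≤ ‖h‖ := by
  refine (ContinuousLinearMap.norm_compLp_le _ h).trans ?_
  exact mul_le_of_le_one_left (norm_nonneg _)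
    (ContinuousLinearMap.opNorm_le_bound _ zero_le_one fun z => by
      simpa using RCLike.abs_re_le_norm z)

lemma norm_imPart_le (h : L1 𝕜) : ‖imPart h‖ ≤ ‖h‖ := by
  refine (ContinuousLinearMap.norm_compLp_le _ h).trans ?_
  exact mul_le_of_le_one_left (norm_nonneg _)
    (ContinuousLinearMap.opNorm_le_bound _ zero_le_one fun z => by
      simpa using RCLike.abs_im_le_norm z)

lemma norm_ofRealL1_le (h : L1 ℝ) : ‖(ofRealL1 h : L1 𝕜)‖ ≤ ‖h‖ := by
  refine (ContinuousLinearMap.norm_compLp_le _ h).trans ?_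
  exact mul_le_of_le_one_left (norm_nonneg _)
    (ContinuousLinearMap.opNorm_le_bound _ zero_le_one fun z => by simp)

lemma ofRealL1_rePart_add (h : L1 𝕜) :
    (ofRealL1 (rePart h) + (RCLike.I : 𝕜) • ofRealL1 (imPart h) : L1 𝕜) = h := by
  refine Lp.ext ?_
  filter_upwards [Lp.coeFn_add (ofRealL1 (rePart h) : L1 𝕜) ((RCLike.I : 𝕜) • ofRealL1 (imPart h)),
    Lp.coeFn_smul (RCLike.I : 𝕜) (ofRealL1 (imPart h) : L1 𝕜), coeFn_ofRealL1 (𝕜 := 𝕜) (rePart h),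
    coeFn_ofRealL1 (𝕜 := 𝕜) (imPart h), coeFn_rePart h, coeFn_imPart h] with x h1 h2 h3 h4 h5 h6
  rw [h1, Pi.add_apply, h2, Pi.smul_apply, h3, h4, h5, h6, smul_eq_mul, mul_comm]
  exact RCLike.re_add_im (h x)

lemma setIntegral_ofRealL1 (h : L1 ℝ) (A : Set I) :
    ∫ x in A, (ofRealL1 h : L1 𝕜) x = ((∫ x in A, h x : ℝ) : 𝕜) := by
  rw [← integral_ofReal]
  exact integral_congr_ae (ae_restrict_of_ae (coeFn_ofRealL1 h))

lemma variation_ofRealL1_le (h : L1 ℝ) :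
    variation (ofRealL1 h : L1 𝕜) ≤ 2 * variation h := by
  refine iSup₂_le fun φ hφ => ?_
  have key : ∀ L : 𝕜 →L[ℝ] ℝ, ‖L‖ ≤ 1 →
      ‖∫ x : I, L (deriv φ x) * h x‖ₑ ≤ variation h := by
    intro L hL
    have hφL : ContDiff ℝ 1 (fun t => L (φ t)) ∧ HasCompactSupport (fun t => L (φ t)) ∧
        ∀ t, ‖L (φ t)‖ ≤ 1 :=
      ⟨L.contDiff.comp hφ.1, hφ.2.1.comp_left (map_zero L), fun t =>
        (L.le_opNorm _).trans (mul_le_one₀ hL (norm_nonneg _) (hφ.2.2 t))⟩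
    refine le_trans (le_of_eq ?_) (le_iSup₂ (f := fun (φ : ℝ → ℝ)
      (_ : ContDiff ℝ 1 φ ∧ HasCompactSupport φ ∧ ∀ t, ‖φ t‖ ≤ 1) =>
        ‖∫ x : I, deriv φ (x : ℝ) * h x‖ₑ) _ hφL)
    congr 2; ext x
    have : HasDerivAt φ (deriv φ x) (x : ℝ) :=
      (hφ.1.differentiable one_ne_zero).differentiableAt.hasDerivAt
    exact congrArg (· * h x) (L.hasFDerivAt.comp_hasDerivAt (x : ℝ) this).deriv.symm
  obtain ⟨K, hK⟩ := hφ.1.lipschitzWith_of_hasCompactSupport hφ.2.1 one_ne_zero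
  have hint : Integrable fun x : I => deriv φ x * (h x : 𝕜) :=
    ((L1.integrable_coeFn h).ofReal (𝕜 := 𝕜)).bdd_mul
      ((measurable_deriv φ).comp measurable_subtype_coe).aestronglyMeasurable
      (ae_of_all _ fun x => norm_deriv_le_of_lipschitz (x₀ := (x : ℝ)) hK)
  have h1 : ∫ x : I, deriv φ x * (ofRealL1 h : L1 𝕜) x
      = ∫ x : I, deriv φ x * (h x : 𝕜) :=
    integral_congr_ae (by filter_upwards [coeFn_ofRealL1 (𝕜 := 𝕜) h] with x hx; rw [hx])
  rw [h1, ← integral_re_add_im hint]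
  simp only [RCLike.re_mul_ofReal, RCLike.im_mul_ofReal]
  refine (enorm_add_le _ _).trans ?_
  rw [two_mul, enorm_mul]
  have e : ∀ r : ℝ, ‖(r : 𝕜)‖ₑ = ‖r‖ₑ := fun r => by
    rw [← ofReal_norm, ← ofReal_norm, RCLike.norm_ofReal, Real.norm_eq_abs]
  rw [e, e]
  have hI : ‖(RCLike.I : 𝕜)‖ₑ ≤ 1 := by
    rw [← ofReal_norm]
    rcases RCLike.I_eq_zero_or_im_I_eq_one (K := 𝕜) with h0 | h0
    · simp [h0]
    · simp [RCLike.norm_I_of_ne_zero (K := 𝕜) (by rintro h1; simp [h1] at h0)]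
  refine add_le_add ?_ ((mul_le_of_le_one_right' hI).trans ?_)
  · exact key RCLike.reCLM (ContinuousLinearMap.opNorm_le_bound _ zero_le_one fun z => by
      simpa using RCLike.abs_re_le_norm z)
  · exact key RCLike.imCLM (ContinuousLinearMap.opNorm_le_bound _ zero_le_one fun z => by
      simpa using RCLike.abs_im_le_norm z)

lemma variation_compLp_le {L : 𝕜 →L[ℝ] ℝ} (hL : ‖L‖ ≤ 1)
    (hmul : ∀ (r : ℝ) (z : 𝕜), L ((r : 𝕜) * z) = r * L z) (h : L1 𝕜) :
    variation (L.compLp h) ≤ variation h := by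
  refine iSup₂_le fun φ hφ => ?_
  obtain ⟨K, hK⟩ := hφ.1.lipschitzWith_of_hasCompactSupport hφ.2.1 one_ne_zero
  have hint : Integrable fun x : I => ((deriv φ x : ℝ) : 𝕜) * h x :=
    (L1.integrable_coeFn h).bdd_mul (c := K) (RCLike.continuous_ofReal.measurable.comp
      ((measurable_deriv φ).comp measurable_subtype_coe)).aestronglyMeasurable
      (ae_of_all _ fun x => by
        rw [RCLike.norm_ofReal]; exact norm_deriv_le_of_lipschitz (x₀ := (x : ℝ)) hK)
  have h1 : ∫ x : I, deriv φ x * (L.compLp h) x = L (∫ x : I, ((deriv φ x : ℝ) : 𝕜) * h x) := by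
    rw [← L.integral_comp_comm hint]
    refine integral_congr_ae ?_
    filter_upwards [L.coeFn_compLp h] with x hx
    rw [hx, hmul]
  rw [h1]
  refine le_trans ?_ (enorm_integral_deriv_mul_le_variation hK (fun x => hφ.2.2 x) h)
  rw [← ofReal_norm, ← ofReal_norm]
  exact ENNReal.ofReal_le_ofReal ((L.le_opNorm _).trans
    (mul_le_of_le_one_left (norm_nonneg _) hL))

lemma variation_rePart_le (h : L1 𝕜) : variation (rePart h) ≤ variation h :=
  variation_compLp_le (ContinuousLinearMap.opNorm_le_bound _ zero_le_one fun z => by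
    simpa using RCLike.abs_re_le_norm z) (fun r z => RCLike.re_ofReal_mul r z) h

lemma variation_imPart_le (h : L1 𝕜) : variation (imPart h) ≤ variation h :=
  variation_compLp_le (ContinuousLinearMap.opNorm_le_bound _ zero_le_one fun z => by
    simpa using RCLike.abs_im_le_norm z) (fun r z => RCLike.im_ofReal_mul r z) h

variable {f : I → I}

lemma perronFrobenius_eq (hf : Measure.QuasiMeasurePreserving f volume volume) (h : L1 𝕜) :
    perronFrobenius f h = ofRealL1 (perronFrobenius f (rePart h))
      + (RCLike.I : 𝕜) • ofRealL1 (perronFrobenius f (imPart h)) :=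
  densityOf_eq fun A hA => by
    conv_rhs => rw [← ofRealL1_rePart_add h]
    rw [setIntegral_L1_add, setIntegral_L1_add, setIntegral_L1_smul, setIntegral_L1_smul,
      setIntegral_ofRealL1, setIntegral_ofRealL1, setIntegral_ofRealL1, setIntegral_ofRealL1,
      setIntegral_perronFrobenius_real hf _ hA, setIntegral_perronFrobenius_real hf _ hA]

lemma setIntegral_perronFrobenius (hf : Measure.QuasiMeasurePreserving f volume volume)
    (h : L1 𝕜) {A : Set I} (hA : MeasurableSet A) :
    ∫ x in A, perronFrobenius f h x = ∫ x in f ⁻¹' A, h x := by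
  rw [perronFrobenius_eq hf]
  conv_rhs => rw [← ofRealL1_rePart_add h]
  rw [setIntegral_L1_add, setIntegral_L1_add, setIntegral_L1_smul, setIntegral_L1_smul,
    setIntegral_ofRealL1, setIntegral_ofRealL1, setIntegral_ofRealL1, setIntegral_ofRealL1,
    setIntegral_perronFrobenius_real hf _ hA, setIntegral_perronFrobenius_real hf _ hA]

lemma setIntegral_perronFrobenius_iterate
    (hf : Measure.QuasiMeasurePreserving f volume volume) (n : ℕ) (h : L1 𝕜) {A : Set I}
    (hA : MeasurableSet A) :
    ∫ x in A, ((perronFrobenius f)^[n] h) x = ∫ x in f^[n] ⁻¹' A, h x := by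
  induction n generalizing A with
  | zero => rfl
  | succ n ih =>
    rw [Function.iterate_succ_apply', setIntegral_perronFrobenius hf _ hA, ih (hf.measurable hA),
      Function.iterate_succ', preimage_comp]

lemma perronFrobenius_add (hf : Measure.QuasiMeasurePreserving f volume volume) (g h : L1 𝕜) :
    perronFrobenius f (g + h) = perronFrobenius f g + perronFrobenius f h :=
  densityOf_eq fun A hA => by
    rw [setIntegral_L1_add, setIntegral_L1_add, setIntegral_perronFrobenius hf _ hA,
      setIntegral_perronFrobenius hf _ hA]

lemma perronFrobenius_smul (hf : Measure.QuasiMeasurePreserving f volume volume) (c : 𝕜)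
    (h : L1 𝕜) : perronFrobenius f (c • h) = c • perronFrobenius f h :=
  densityOf_eq fun A hA => by
    rw [setIntegral_L1_smul, setIntegral_L1_smul, setIntegral_perronFrobenius hf _ hA]

end RealImag

/-! ### Localization of the variation -/

/-- A function that is Lipschitz on `[0,1]` is a test function for the weighted variation: only
its restriction to `[0,1]` matters. -/
lemma enorm_integral_le_weightedVariation_of_lipschitzOnWith {w : I → ℝ≥0∞} {K : ℝ≥0}
    {Φ : ℝ → ℝ} (hΦ : LipschitzOnWith K Φ (Icc 0 1)) (hw : ∀ x : I, ‖Φ x‖ₑ ≤ w x) (h : L1 ℝ) :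
    ‖∫ x : I, deriv Φ x * h x‖ₑ ≤ weightedVariation w h := by
  let Ψ : ℝ → ℝ := IccExtend (zero_le_one' ℝ) fun x => Φ x
  have hΨ : LipschitzWith K Ψ := by
    have := (hΦ.to_restrict).comp (LipschitzWith.projIcc (zero_le_one' ℝ))
    rw [mul_one] at this
    exact this
  have h1 : ∫ x : I, deriv Φ x * h x = ∫ x : I, deriv Ψ x * h x := by
    refine integral_congr_ae ?_
    filter_upwards [ae_mem_Ioo_unitInterval] with x hx
    have hev : Φ =ᶠ[𝓝 (x : ℝ)] Ψ := by
      filter_upwards [Ioo_mem_nhds hx.1 hx.2] with t ht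
      exact (IccExtend_of_mem (zero_le_one' ℝ) (fun x : I => Φ x) (Ioo_subset_Icc_self ht)).symm
    rw [hev.deriv_eq]
  rw [h1]
  refine enorm_integral_le_weightedVariation hΨ (fun x => ?_) h
  have : Ψ x = Φ x := IccExtend_of_mem (zero_le_one' ℝ) (fun x : I => Φ x) x.2
  rw [this]; exact hw x

lemma exists_L1_eq_mul {K : ℝ≥0} {χ : ℝ → ℝ} (hχ : LipschitzWith K χ) (hχ1 : ∀ t, |χ t| ≤ 1)
    (h : L1 ℝ) : ∃ u : L1 ℝ, ∀ᵐ x : I, u x = χ x * h x := by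
  have : Integrable fun x : I => χ x * h x :=
    (L1.integrable_coeFn h).bdd_mul (c := 1)
      (hχ.continuous.comp continuous_subtype_val).aestronglyMeasurable
      (ae_of_all _ fun x => hχ1 x)
  exact ⟨this.toL1 _, this.coeFn_toL1⟩

lemma norm_L1_le_of_eq_mul {χ : ℝ → ℝ} (hχ1 : ∀ t, |χ t| ≤ 1) {h u : L1 ℝ}
    (hu : ∀ᵐ x : I, u x = χ x * h x) : ‖u‖ ≤ ‖h‖ := by
  rw [L1.norm_eq_integral_norm, L1.norm_eq_integral_norm]
  refine integral_mono_ae (L1.integrable_coeFn u).norm (L1.integrable_coeFn h).norm ?_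
  filter_upwards [hu] with x hx
  rw [hx, norm_mul]
  exact mul_le_of_le_one_left (norm_nonneg _) (hχ1 x)

lemma lipschitzOnWith_mul {K L : ℝ≥0} {Φ χ : ℝ → ℝ} (hΦ : LipschitzWith K Φ)
    (hΦ1 : ∀ x : I, |Φ x| ≤ 1) (hχ : LipschitzWith L χ) (hχ1 : ∀ t, |χ t| ≤ 1) :
    LipschitzOnWith (K + L) (fun t => Φ t * χ t) (Icc 0 1) := by
  refine LipschitzOnWith.of_dist_le_mul fun s hs t _ => ?_
  have h1 := hΦ.dist_le_mul s t
  have h2 := hχ.dist_le_mul s t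
  rw [Real.dist_eq, Real.dist_eq] at *
  calc |Φ s * χ s - Φ t * χ t| = |Φ s * (χ s - χ t) + (Φ s - Φ t) * χ t| := by ring_nf
    _ ≤ |Φ s| * |χ s - χ t| + |Φ s - Φ t| * |χ t| := by
      rw [← abs_mul, ← abs_mul]; exact abs_add_le _ _
    _ ≤ 1 * (L * |s - t|) + (K * |s - t|) * 1 := by
      gcongr
      · exact hΦ1 ⟨s, hs⟩
      · exact hχ1 t
    _ = (K + L : ℝ≥0) * |s - t| := by push_cast; ring

/-- Leibniz rule: `χ` may be moved from the function to the test function. -/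
lemma integral_deriv_mul_cutoff {K L : ℝ≥0} {Φ χ : ℝ → ℝ} (hΦ : LipschitzWith K Φ)
    (hΦ1 : ∀ x : I, |Φ x| ≤ 1) (hχ : LipschitzWith L χ) {h u : L1 ℝ}
    (hu : ∀ᵐ x : I, u x = χ x * h x) :
    Integrable (fun x : I => deriv (fun t => Φ t * χ t) x * h x) ∧
    ∫ x : I, deriv Φ x * u x
      ≤ (∫ x : I, deriv (fun t => Φ t * χ t) x * h x) + L * ‖h‖ := by
  have hh := L1.integrable_coeFn h
  have hd : ∀ᵐ x : I, deriv (fun t => Φ t * χ t) x * h x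
      = deriv Φ x * u x + (Φ x * deriv χ x) * h x := by
    filter_upwards [hu, ae_unitInterval_of_ae hΦ.ae_differentiableAt_real,
      ae_unitInterval_of_ae hχ.ae_differentiableAt_real] with x hx h1 h2
    rw [deriv_fun_mul h1 h2, hx]; ring
  have hb : ∀ x : I, ‖Φ x * deriv χ x‖ ≤ L := fun x => by
    rw [norm_mul]
    exact (mul_le_mul (hΦ1 x) (norm_deriv_le_of_lipschitz hχ) (norm_nonneg _) zero_le_one).trans
      (by simp)
  have i1 : Integrable fun x : I => deriv Φ x * u x := integrable_deriv_mul hΦ u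
  have i2 : Integrable fun x : I => (Φ x * deriv χ x) * h x :=
    hh.bdd_mul ((hΦ.continuous.measurable.comp measurable_subtype_coe).mul
      ((measurable_deriv χ).comp measurable_subtype_coe)).aestronglyMeasurable (ae_of_all _ hb)
  refine ⟨(i1.add i2).congr (hd.mono fun x hx => hx.symm), ?_⟩
  rw [integral_congr_ae hd, integral_add i1 i2, add_assoc]
  refine le_add_of_nonneg_right ?_
  have h3 : |∫ x : I, (Φ x * deriv χ x) * h x| ≤ L * ‖h‖ := by
    rw [L1.norm_eq_integral_norm, ← integral_const_mul]
    refine (norm_integral_le_integral_norm _).trans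
      (integral_mono i2.norm (hh.norm.const_mul _) fun x => ?_)
    simp only [norm_mul (_ * _)]
    gcongr
    exact hb x
  linarith [neg_abs_le (∫ x : I, (Φ x * deriv χ x) * h x)]

lemma variation_le_of_forall_integral_le {h : L1 ℝ} {R : ℝ}
    (H : ∀ (Φ : ℝ → ℝ) (K : ℝ≥0), LipschitzWith K Φ → (∀ x : I, |Φ x| ≤ 1) →
      ∫ x : I, deriv Φ x * h x ≤ R) : variation h ≤ ENNReal.ofReal R := by
  refine (variation_le_weightedVariation_one h).trans (iSup₂_le fun Φ hΦ => ?_)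
  obtain ⟨⟨K, hK⟩, hb⟩ := hΦ
  have hb' : ∀ x : I, |Φ x| ≤ 1 := fun x => by
    have := hb x
    rw [← ofReal_norm, ← ENNReal.ofReal_one,
      ENNReal.ofReal_le_ofReal_iff zero_le_one] at this
    exact this
  rw [← ofReal_norm]
  refine ENNReal.ofReal_le_ofReal (abs_le'.2 ⟨H Φ K hK hb', ?_⟩)
  have := H (fun t => -Φ t) K hK.neg (fun x => by rw [abs_neg]; exact hb' x)
  rw [← integral_neg]
  refine le_trans (le_of_eq ?_) this
  congr 1; ext x; rw [deriv.fun_neg]; ring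

lemma exists_test (h : L1 ℝ) {δ : ℝ} (hδ : 0 < δ) :
    ∃ (Φ : ℝ → ℝ) (K : ℝ≥0), LipschitzWith K Φ ∧ (∀ x : I, |Φ x| ≤ 1) ∧
      (variation h).toReal - δ ≤ ∫ x : I, deriv Φ x * h x := by
  by_contra! H
  have h0 := H (fun _ => 0) 0 (LipschitzWith.const 0) (by simp)
  simp only [deriv_const, zero_mul, integral_zero] at h0
  have := variation_le_of_forall_integral_le fun Φ K hK hb => (H Φ K hK hb).le
  have h2 := ENNReal.toReal_mono ENNReal.ofReal_ne_top this
  rw [ENNReal.toReal_ofReal h0.le] at h2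
  linarith

lemma ofReal_norm_L1 (h : L1 ℝ) : ENNReal.ofReal ‖h‖ = ‖h‖ₑ := ofReal_norm h

lemma integral_deriv_mul_le_toReal {K : ℝ≥0} {Φ : ℝ → ℝ} (hΦ : LipschitzOnWith K Φ (Icc 0 1))
    {w : I → ℝ≥0∞} (hb : ∀ x : I, ‖Φ x‖ₑ ≤ w x) {h : L1 ℝ} (hw : weightedVariation w h ≠ ∞) :
    ∫ x : I, deriv Φ x * h x ≤ (weightedVariation w h).toReal := by
  have := ENNReal.toReal_mono hw
    (enorm_integral_le_weightedVariation_of_lipschitzOnWith hΦ hb h)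
  rw [toReal_enorm] at this
  exact (le_abs_self _).trans this

lemma weightedVariation_one_le (h : L1 ℝ) : weightedVariation (fun _ => 1) h ≤ variation h := by
  simpa using weightedVariation_le (w := fun _ => 1) (M := 1) (by simp) h

/-- Multiplication by a Lipschitz function preserves bounded variation. -/
lemma variation_mul_le {L : ℝ≥0} {χ : ℝ → ℝ} (hχ : LipschitzWith L χ) (hχ1 : ∀ t, |χ t| ≤ 1)
    {h u : L1 ℝ} (hh : h ∈ BV ℝ) (hu : ∀ᵐ x : I, u x = χ x * h x) :
    variation u ≤ variation h + L * ‖h‖ₑ := by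
  have hfin : weightedVariation (fun _ => 1) h ≠ ∞ :=
    ((weightedVariation_one_le h).trans_lt hh).ne
  have := variation_le_of_forall_integral_le (h := u)
    (R := (weightedVariation (fun _ => 1) h).toReal + L * ‖h‖)
    fun Φ K hK hb => by
      refine (integral_deriv_mul_cutoff hK hb hχ hu).2.trans ?_
      gcongr
      refine integral_deriv_mul_le_toReal (lipschitzOnWith_mul hK hb hχ hχ1) (fun x => ?_) hfin
      rw [← ofReal_norm, ← ENNReal.ofReal_one]
      refine ENNReal.ofReal_le_ofReal ?_
      rw [norm_mul]
      exact mul_le_one₀ (hb x) (norm_nonneg _) (hχ1 x)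
  refine this.trans ?_
  rw [ENNReal.ofReal_add (by positivity) (by positivity), ENNReal.ofReal_mul (by positivity),
    ofReal_norm_L1, ENNReal.ofReal_toReal hfin, ENNReal.ofReal_coe_nnreal]
  gcongr
  exact weightedVariation_one_le h

lemma lipschitzOnWith_sum {ι : Type*} {s : Set ℝ} (t : Finset ι) {Φ : ι → ℝ → ℝ} {K : ι → ℝ≥0}
    (H : ∀ i ∈ t, LipschitzOnWith (K i) (Φ i) s) :
    LipschitzOnWith (∑ i ∈ t, K i) (fun x => ∑ i ∈ t, Φ i x) s := by
  refine LipschitzOnWith.of_dist_le_mul fun x hx y hy => ?_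
  rw [Real.dist_eq, ← Finset.sum_sub_distrib]
  refine (Finset.abs_sum_le_sum_abs _ _).trans ?_
  rw [NNReal.coe_sum, Finset.sum_mul]
  exact Finset.sum_le_sum fun i hi => (H i hi).dist_le_mul x hx y hy

/-- The variations of the pieces of a function, cut by a family of Lipschitz functions `χ i`, add
up to a weighted variation: near-optimal test functions for the pieces are glued by the `χ i`. -/
lemma sum_mul_variation_le {ι : Type*} (s : Finset ι) {L M : ℝ≥0} {χ : ι → ℝ → ℝ}
    (hχ : ∀ i ∈ s, LipschitzWith L (χ i)) (hχ1 : ∀ i ∈ s, ∀ t, |χ i t| ≤ 1) {W : ι → ℝ≥0}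
    (hW : ∀ i ∈ s, W i ≤ M) {h : L1 ℝ} (hh : h ∈ BV ℝ) {u : ι → L1 ℝ}
    (hu : ∀ i ∈ s, ∀ᵐ x : I, u i x = χ i x * h x) {w : I → ℝ≥0∞}
    (hw : ∀ x : I, ∑ i ∈ s, W i * ‖χ i x‖ₑ ≤ w x) (hwM : ∀ x, w x ≤ M) :
    ∑ i ∈ s, W i * variation (u i) ≤ weightedVariation w h + (s.card * (M * L) : ℝ≥0) * ‖h‖ₑ := by
  have hfin : weightedVariation w h ≠ ∞ :=
    ((weightedVariation_le hwM h).trans_lt (ENNReal.mul_lt_top ENNReal.coe_lt_top hh)).ne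
  have hui : ∀ i ∈ s, u i ∈ BV ℝ := fun i hi =>
    (variation_mul_le (hχ i hi) (hχ1 i hi) hh (hu i hi)).trans_lt
      (ENNReal.add_lt_top.2 ⟨hh, ENNReal.mul_lt_top ENNReal.coe_lt_top (by simp)⟩)
  have hreal : ∑ i ∈ s, (W i : ℝ) * (variation (u i)).toReal
      ≤ (weightedVariation w h).toReal + s.card * (M * L) * ‖h‖ := by
    refine le_of_forall_pos_le_add fun η hη => ?_
    set δ : ℝ := η / (∑ i ∈ s, (W i : ℝ) + 1) with hδdef
    have hδ : 0 < δ := by positivity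
    have hδη : ∑ i ∈ s, (W i : ℝ) * δ ≤ η := by
      rw [← Finset.sum_mul, hδdef, mul_div_assoc', div_le_iff₀ (by positivity)]
      nlinarith
    choose! Φ K hK hb hΦ using fun i (_ : i ∈ s) => exists_test (u i) hδ
    have hLip : LipschitzOnWith (∑ i ∈ s, W i * (K i + L))
        (fun x => ∑ i ∈ s, (W i : ℝ) * (Φ i x * χ i x)) (Icc 0 1) := by
      refine lipschitzOnWith_sum s fun i hi => ?_
      have := lipschitzOnWith_mul (hK i hi) (hb i hi) (hχ i hi) (hχ1 i hi)
      refine LipschitzOnWith.of_dist_le_mul fun x hx y hy => ?_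
      have h1 := this.dist_le_mul x hx y hy
      rw [Real.dist_eq] at h1 ⊢
      rw [← mul_sub, abs_mul, NNReal.abs_eq, NNReal.coe_mul, mul_assoc]
      gcongr
    have hbound : ∀ x : I, ‖∑ i ∈ s, (W i : ℝ) * (Φ i x * χ i x)‖ₑ ≤ w x := by
      intro x
      refine (enorm_sum_le _ _).trans (le_trans (Finset.sum_le_sum fun i hi => ?_) (hw x))
      rw [enorm_mul, enorm_mul, Real.enorm_eq_ofReal (W i).coe_nonneg,
        ENNReal.ofReal_coe_nnreal]
      gcongr
      refine mul_le_of_le_one_left' ?_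
      rw [← ofReal_norm, ← ENNReal.ofReal_one]
      exact ENNReal.ofReal_le_ofReal (hb i hi x)
    -- `∑ W i Φ i χ i` is a test function for the weight `w`; moving each `χ i` onto `h` costs a
    -- multiple of the `L¹` norm.
    have hmain := integral_deriv_mul_le_toReal hLip hbound hfin
    have hcut := fun i (hi : i ∈ s) =>
      integral_deriv_mul_cutoff (hK i hi) (hb i hi) (hχ i hi) (hu i hi)
    have hsum : ∫ x : I, deriv (fun x => ∑ i ∈ s, (W i : ℝ) * (Φ i x * χ i x)) x * h x
        = ∑ i ∈ s, (W i : ℝ) * ∫ x : I, deriv (fun t => Φ i t * χ i t) x * h x := by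
      rw [Finset.sum_congr rfl fun i _ => (integral_const_mul (W i : ℝ) _).symm,
        ← integral_finsetSum s fun i hi => (hcut i hi).1.const_mul _]
      refine integral_congr_ae ?_
      have hdiff : ∀ᵐ x : I, ∀ i ∈ s, DifferentiableAt ℝ (Φ i) x ∧
          DifferentiableAt ℝ (χ i) x := by
        refine (ae_ball_iff s.countable_toSet).2 fun i hi => ?_
        filter_upwards [ae_unitInterval_of_ae (hK i hi).ae_differentiableAt_real,
          ae_unitInterval_of_ae (hχ i hi).ae_differentiableAt_real] with x h1 h2
        exact ⟨h1, h2⟩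
      filter_upwards [hdiff] with x hx
      rw [deriv_fun_sum fun i hi => ((hx i hi).1.fun_mul (hx i hi).2).const_mul _, Finset.sum_mul]
      refine Finset.sum_congr rfl fun i hi => ?_
      rw [deriv_const_mul_field, mul_assoc]
    calc ∑ i ∈ s, (W i : ℝ) * (variation (u i)).toReal
        ≤ ∑ i ∈ s, ((W i : ℝ) * (∫ x : I, deriv (fun t => Φ i t * χ i t) x * h x)
            + (M * L) * ‖h‖ + W i * δ) := by
          refine Finset.sum_le_sum fun i hi => ?_
          have h1 := hΦ i hi
          have h2 := (hcut i hi).2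
          have h3 : (W i : ℝ) * (L * ‖h‖) ≤ M * (L * ‖h‖) := by
            gcongr; exact_mod_cast hW i hi
          have h4 : (W i : ℝ) * (variation (u i)).toReal ≤ W i *
              ((∫ x : I, deriv (fun t => Φ i t * χ i t) x * h x) + L * ‖h‖ + δ) := by
            gcongr; linarith
          linarith
      _ = (∫ x : I, deriv (fun x => ∑ i ∈ s, (W i : ℝ) * (Φ i x * χ i x)) x * h x)
            + s.card * (M * L) * ‖h‖ + ∑ i ∈ s, (W i : ℝ) * δ := by
          rw [hsum, Finset.sum_add_distrib, Finset.sum_add_distrib, Finset.sum_const,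
            nsmul_eq_mul, mul_assoc (s.card : ℝ)]
      _ ≤ _ := by gcongr
  have hconv : ∑ i ∈ s, W i * variation (u i)
      = ENNReal.ofReal (∑ i ∈ s, (W i : ℝ) * (variation (u i)).toReal) := by
    rw [ENNReal.ofReal_sum_of_nonneg fun i _ => by positivity]
    refine Finset.sum_congr rfl fun i hi => ?_
    rw [ENNReal.ofReal_mul (W i).coe_nonneg, ENNReal.ofReal_coe_nnreal,
      ENNReal.ofReal_toReal (hui i hi).ne]
  rw [hconv]
  refine (ENNReal.ofReal_le_ofReal hreal).trans ?_
  rw [ENNReal.ofReal_add (by positivity) (by positivity), ENNReal.ofReal_toReal hfin,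
    ENNReal.ofReal_mul (by positivity), ofReal_norm_L1]
  gcongr
  rw [← ENNReal.ofReal_coe_nnreal]
  push_cast; rfl

/-! ### Weighted variation under a local transition operator -/

/-- The piecewise linear function that vanishes on `(-∞, 0]` and equals `1` on `[1, ∞)`. -/
def ramp (t : ℝ) : ℝ := max 0 (min 1 t)

lemma lipschitzWith_ramp : LipschitzWith 1 ramp :=
  (LipschitzWith.id.const_min 1).const_max 0

lemma ramp_mono : Monotone ramp := fun _ _ h => max_le_max le_rfl (min_le_min le_rfl h)

lemma ramp_nonneg (t : ℝ) : 0 ≤ ramp t := le_max_left _ _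

lemma ramp_le_one (t : ℝ) : ramp t ≤ 1 := max_le zero_le_one (min_le_left _ _)

lemma ramp_of_nonpos {t : ℝ} (h : t ≤ 0) : ramp t = 0 := max_eq_left ((min_le_right _ _).trans h)

lemma ramp_of_one_le {t : ℝ} (h : 1 ≤ t) : ramp t = 1 := by
  rw [ramp, min_eq_left h, max_eq_right zero_le_one]

/-- The tent of height `1` and half-width `ρ` at `i ρ`; these tents form a partition of unity. -/
def tent (ρ : ℝ) (i : ℕ) (t : ℝ) : ℝ := ramp (t / ρ + 1 - i) - ramp (t / ρ - i)

lemma tent_nonneg (ρ : ℝ) (i : ℕ) (t : ℝ) : 0 ≤ tent ρ i t :=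
  sub_nonneg.2 (ramp_mono (by linarith))

lemma abs_tent_le_one (ρ : ℝ) (i : ℕ) (t : ℝ) : |tent ρ i t| ≤ 1 := by
  rw [abs_of_nonneg (tent_nonneg ρ i t), tent]
  linarith [ramp_nonneg (t / ρ - i), ramp_le_one (t / ρ + 1 - i)]

lemma lipschitzWith_tent {ρ : ℝ≥0} (hρ : 0 < ρ) (i : ℕ) : LipschitzWith (2 / ρ) (tent ρ i) := by
  refine LipschitzWith.of_dist_le_mul fun s t => ?_
  have hρ' : (0 : ℝ) < ρ := hρ
  have h : ∀ c : ℝ, |ramp (s / ρ + c) - ramp (t / ρ + c)| ≤ |s - t| / ρ := fun c => by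
    have := lipschitzWith_ramp.dist_le_mul (s / ρ + c) (t / ρ + c)
    rw [Real.dist_eq, Real.dist_eq, NNReal.coe_one, one_mul, add_sub_add_right_eq_sub, ← sub_div,
      abs_div, abs_of_pos hρ'] at this
    exact this
  rw [Real.dist_eq, Real.dist_eq]
  have h1 := h (1 - i)
  have h2 := h (-i)
  have e : tent ρ i s - tent ρ i t = (ramp (s / ρ + (1 - i)) - ramp (t / ρ + (1 - i)))
      - (ramp (s / ρ + -i) - ramp (t / ρ + -i)) := by
    simp only [tent, add_sub_assoc, ← sub_eq_add_neg]; ring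
  rw [e]
  refine (abs_sub _ _).trans ((add_le_add h1 h2).trans (le_of_eq ?_))
  push_cast; ring

lemma abs_sub_lt_of_tent_ne_zero {ρ : ℝ} (hρ : 0 < ρ) {i : ℕ} {t : ℝ} (h : tent ρ i t ≠ 0) :
    |t - i * ρ| < ρ := by
  have e : t = t / ρ * ρ := by field_simp
  have h1 : 0 < t / ρ + 1 - i := by
    by_contra! h1
    exact h (by rw [tent, ramp_of_nonpos h1, ramp_of_nonpos (by linarith), sub_zero])
  have h2 : t / ρ - i < 1 := by
    by_contra! h2
    exact h (by rw [tent, ramp_of_one_le h2, ramp_of_one_le (by linarith), sub_self])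
  rw [e, ← sub_mul, abs_mul, abs_of_pos hρ]
  refine mul_lt_of_lt_one_left hρ (abs_lt.2 ⟨by linarith, h2⟩)

lemma sum_tent {ρ : ℝ} (hρ : 0 < ρ) {m : ℕ} (hm : 1 / ρ ≤ m) (x : I) :
    ∑ i ∈ Finset.range (m + 1), tent ρ i x = 1 := by
  have h : ∀ i : ℕ, tent ρ i x = (fun i : ℕ => ramp (x / ρ + 1 - i)) i
      - (fun i : ℕ => ramp (x / ρ + 1 - i)) (i + 1) := fun i => by
    simp only [tent]; congr 2; push_cast; ring
  rw [Finset.sum_congr rfl fun i _ => h i, Finset.sum_range_sub']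
  have h1 : (x : ℝ) / ρ ≤ 1 / ρ := by gcongr; exact x.2.2
  have h2 : 0 ≤ (x : ℝ) / ρ := div_nonneg x.2.1 hρ.le
  rw [ramp_of_one_le (by simpa using h2), ramp_of_nonpos (by push_cast; linarith), sub_zero]

variable {Q : Kernel I I} [IsMarkovKernel Q]

/-- A local transition operator moves the support of a density by at most `ρ`. -/
lemma transitionOp_ae_eq_zero (hac : (volume : Measure I).bind Q ≪ volume) {ρ : ℝ} (hρ : 0 ≤ ρ)
    (hloc : ∀ (x : I) (A : Set I), MeasurableSet A →
      ENNReal.ofReal ρ < Metric.infEDist x A → Q x A = 0) {h : L1 ℝ} {c r : ℝ}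
    (hh : ∀ᵐ x : I, ¬ |(x : ℝ) - c| < r → h x = 0) :
    ∀ᵐ y : I, |(y : ℝ) - c| > r + ρ → transitionOp Q h y = 0 := by
  set B : Set I := {y | |(y : ℝ) - c| > r + ρ} with hB
  have hBm : MeasurableSet B := by
    refine (isOpen_lt continuous_const ?_).measurableSet
    fun_prop
  have hzero : ∀ A ⊆ B, MeasurableSet A → ∫ y in A, transitionOp Q h y = 0 := by
    intro A hAB hA
    rw [setIntegral_transitionOp hac h hA]
    refine integral_eq_zero_of_ae ?_
    filter_upwards [hh] with x hx
    by_cases hxr : |(x : ℝ) - c| < r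
    · have hQ : Q x A = 0 := by
        refine hloc x A hA (lt_of_lt_of_le (b := ENNReal.ofReal (r + ρ - |(x : ℝ) - c|)) ?_
          (Metric.le_infEDist.2 fun y hy => ?_))
        · exact (ENNReal.ofReal_lt_ofReal_iff (by linarith)).2 (by linarith)
        · rw [edist_dist, Subtype.dist_eq, Real.dist_eq]
          refine ENNReal.ofReal_le_ofReal ?_
          have h1 : r + ρ < |(y : ℝ) - c| := hAB hy
          have h2 := abs_sub_le (y : ℝ) x c
          rw [abs_sub_comm (y : ℝ) x] at h2
          linarith
      simp [measureReal_def, hQ]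
    · simp [hx hxr]
  have hae := ae_eq_zero_of_forall_setIntegral_eq_of_sigmaFinite (μ := volume.restrict B)
    (f := transitionOp Q h) (fun s _ _ => (L1.integrable_coeFn _).restrict.integrableOn)
    (fun s hs _ => by
      rw [Measure.restrict_restrict hs]
      exact hzero _ inter_subset_right (hs.inter hBm))
  exact (ae_restrict_iff' hBm).1 hae

/-- The regularity of a local transition operator, localized: the weight changes only by passing
to its supremum over a `4ρ`-neighbourhood. -/
lemma exists_weightedVariation_transitionOp_le (C₀ M : ℝ≥0) {ρ : ℝ≥0} (hρ : 0 < ρ) :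
    ∃ C : ℝ≥0, ∀ (Q : Kernel I I) [IsMarkovKernel Q], (volume : Measure I).bind Q ≪ volume →
      (∀ (x : I) (A : Set I), MeasurableSet A →
        ENNReal.ofReal ρ < Metric.infEDist x A → Q x A = 0) →
      (∀ h ∈ BV ℝ, variation (transitionOp Q h) ≤ variation h + C₀ * ‖h‖ₑ) →
      ∀ w w' : I → ℝ≥0∞, (∀ x, w x ≤ M) → (∀ x, w' x ≤ M) →
        (∀ x y : I, |(x : ℝ) - y| ≤ 4 * ρ → w y ≤ w' x) →
        ∀ h ∈ BV ℝ, weightedVariation w (transitionOp Q h)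
          ≤ weightedVariation w' h + C * ‖h‖ₑ := by
  have hρ' : (0 : ℝ) < ρ := hρ
  set m : ℕ := ⌈1 / (ρ : ℝ)⌉₊
  have hm : 1 / (ρ : ℝ) ≤ m := Nat.le_ceil _
  refine ⟨(m + 1 : ℕ) * (M * (2 / ρ)) + (m + 1 : ℕ) * (M * C₀),
    fun Q _ hac hloc hreg w w' hw hw' hww h hh => ?_⟩
  set s := Finset.range (m + 1) with hs
  have hχ := fun i => lipschitzWith_tent hρ i
  have hχ1 := fun i => abs_tent_le_one ρ i
  choose u hu using fun i => exists_L1_eq_mul (hχ i) (hχ1 i) h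
  have hsum : h = ∑ i ∈ s, u i := by
    refine Lp.ext ?_
    filter_upwards [Lp.coeFn_finsetSum s u, ae_all_iff.2 hu] with x h1 h2
    rw [h1, Finset.sum_apply, Finset.sum_congr rfl fun i _ => h2 i, ← Finset.sum_mul,
      sum_tent hρ' hm, one_mul]
  have huBV : ∀ i, u i ∈ BV ℝ := fun i =>
    (variation_mul_le (hχ i) (hχ1 i) hh (hu i)).trans_lt
      (ENNReal.add_lt_top.2 ⟨hh, ENNReal.mul_lt_top ENNReal.coe_lt_top (by simp)⟩)
  let W' : ℕ → ℝ≥0∞ := fun i => ⨆ (y : I) (_ : |(y : ℝ) - i * ρ| ≤ 2 * ρ), w y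
  have hW'M : ∀ i, W' i ≤ M := fun i => iSup₂_le fun y _ => hw y
  have hW'ne : ∀ i, W' i ≠ ∞ := fun i => ((hW'M i).trans_lt ENNReal.coe_lt_top).ne
  let W : ℕ → ℝ≥0 := fun i => (W' i).toNNReal
  have hWW' : ∀ i, (W i : ℝ≥0∞) = W' i := fun i => ENNReal.coe_toNNReal (hW'ne i)
  have hWM : ∀ i, W i ≤ M := fun i => by rw [← ENNReal.coe_le_coe, hWW']; exact hW'M i
  have hpiece : ∀ i, ∀ (Φ : ℝ → ℝ) (K : ℝ≥0), LipschitzWith K Φ → (∀ x : I, ‖Φ x‖ₑ ≤ w x) →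
      ‖∫ x : I, deriv Φ x * transitionOp Q (u i) x‖ₑ
        ≤ W i * variation (transitionOp Q (u i)) := by
    intro i Φ K hK hb
    -- The density of the piece `i` is supported where `|Φ| ≤ W i`, so truncating `Φ` at `W i`
    -- does not change the integral.
    let Ψ : ℝ → ℝ := fun t => max (-(W i : ℝ)) (min (W i) (Φ t))
    have hΨ : LipschitzWith K Ψ := (hK.const_min _).const_max _
    have hΨb : ∀ x : I, |Ψ x| ≤ W i := fun x =>
      abs_le.2 ⟨le_max_left _ _, max_le (by simp) (min_le_left _ _)⟩
    have hne : ∀ c : ℝ, ∀ᵐ t : ℝ, t ≠ c := fun c => by simp [ae_iff]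
    have heq : ∫ x : I, deriv Φ x * transitionOp Q (u i) x
        = ∫ x : I, deriv Ψ x * transitionOp Q (u i) x := by
      refine integral_congr_ae ?_
      have hzero := transitionOp_ae_eq_zero hac hρ'.le hloc (h := u i) (c := i * ρ) (r := ρ) (by
        filter_upwards [hu i] with x hx hxr
        rw [hx]
        by_cases h0 : tent ρ i x = 0
        · rw [h0, zero_mul]
        · exact absurd (abs_sub_lt_of_tent_ne_zero hρ' h0) hxr)
      filter_upwards [hzero, ae_mem_Ioo_unitInterval, ae_unitInterval_of_ae (hne (i * ρ + 2 * ρ)),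
        ae_unitInterval_of_ae (hne (i * ρ - 2 * ρ))] with x hx hxI hx1 hx2
      by_cases hxr : |(x : ℝ) - i * ρ| > ρ + ρ
      · rw [hx hxr, mul_zero, mul_zero]
      · rw [not_lt, abs_le] at hxr
        have hxl : (i * ρ - 2 * ρ : ℝ) < x := lt_of_le_of_ne (by linarith [hxr.1]) (Ne.symm hx2)
        have hxu : (x : ℝ) < i * ρ + 2 * ρ := lt_of_le_of_ne (by linarith [hxr.2]) hx1
        have hev : Φ =ᶠ[𝓝 (x : ℝ)] Ψ := by
          filter_upwards [Ioo_mem_nhds hxI.1 hxI.2, Ioo_mem_nhds hxl hxu] with t ht ht'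
          have h1 : ‖Φ t‖ₑ ≤ W i := by
            rw [hWW']
            refine (hb ⟨t, Ioo_subset_Icc_self ht⟩).trans ?_
            exact le_iSup₂ (f := fun (y : I) (_ : |(y : ℝ) - i * ρ| ≤ 2 * ρ) => w y)
              ⟨t, Ioo_subset_Icc_self ht⟩ (abs_le.2 ⟨by linarith [ht'.1], by linarith [ht'.2]⟩)
          have h2 : |Φ t| ≤ W i := by
            rw [enorm_eq_nnnorm, ENNReal.coe_le_coe] at h1
            exact_mod_cast h1
          rw [abs_le] at h2
          simp only [Ψ]
          rw [min_eq_right h2.2, max_eq_right h2.1]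
        rw [hev.deriv_eq]
    rw [heq]
    exact enorm_integral_deriv_mul_le hΨ hΨb _
  have hnorm : ∀ i, ‖u i‖ₑ ≤ ‖h‖ₑ := fun i => by
    rw [← ofReal_norm, ← ofReal_norm]
    exact ENNReal.ofReal_le_ofReal (norm_L1_le_of_eq_mul (hχ1 i) (hu i))
  have hlocal : weightedVariation w (transitionOp Q h)
      ≤ ∑ i ∈ s, W i * variation (transitionOp Q (u i)) := by
    refine iSup₂_le fun Φ hΦ => ?_
    obtain ⟨⟨K, hK⟩, hb⟩ := hΦ
    have : ∫ x : I, deriv Φ x * transitionOp Q h x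
        = ∑ i ∈ s, ∫ x : I, deriv Φ x * transitionOp Q (u i) x := by
      rw [← integral_finsetSum s fun i _ => integrable_deriv_mul hK _]
      conv_lhs => rw [hsum, transitionOp_sum hac]
      refine integral_congr_ae ?_
      filter_upwards [Lp.coeFn_finsetSum s fun i => transitionOp Q (u i)] with x hx
      rw [hx, Finset.sum_apply, Finset.mul_sum]
    rw [this]
    exact (enorm_sum_le _ _).trans (Finset.sum_le_sum fun i _ => hpiece i Φ K hK hb)
  -- The regularity of `Q` applies to each piece; then the pieces are glued again.
  refine hlocal.trans ((Finset.sum_le_sum fun i _ =>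
    mul_le_mul_right (hreg (u i) (huBV i)) _).trans ?_)
  simp only [mul_add, Finset.sum_add_distrib]
  have hmain := sum_mul_variation_le s (L := 2 / ρ) (fun i _ => hχ i) (fun i _ => hχ1 i)
    (fun i _ => hWM i) hh (fun i _ => hu i) (w := w') (fun x => by
      have hle : ∀ i, (W i : ℝ≥0∞) * ‖tent ρ i x‖ₑ ≤ w' x * ENNReal.ofReal (tent ρ i x) := by
        intro i
        rw [Real.enorm_eq_ofReal (tent_nonneg _ _ _)]
        by_cases h0 : tent ρ i x = 0
        · simp [h0]
        · gcongr
          rw [hWW']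
          have hx := abs_sub_lt_of_tent_ne_zero hρ' h0
          refine iSup₂_le fun y hy => hww x y ?_
          have := abs_sub_le (x : ℝ) (i * ρ) y
          rw [abs_sub_comm (i * ρ : ℝ) y] at this
          linarith
      refine (Finset.sum_le_sum fun i _ => hle i).trans (le_of_eq ?_)
      rw [← Finset.mul_sum, ← ENNReal.ofReal_sum_of_nonneg fun i _ => tent_nonneg _ _ _,
        sum_tent hρ' hm, ENNReal.ofReal_one, mul_one]) hw'
  have hsecond : ∑ i ∈ s, (W i : ℝ≥0∞) * (C₀ * ‖u i‖ₑ)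
      ≤ ((m + 1 : ℕ) * (M * C₀) : ℝ≥0) * ‖h‖ₑ := by
    calc ∑ i ∈ s, (W i : ℝ≥0∞) * (C₀ * ‖u i‖ₑ) ≤ ∑ i ∈ s, (M : ℝ≥0∞) * (C₀ * ‖h‖ₑ) := by
          gcongr with i
          · exact hWM i
          · exact hnorm i
      _ = _ := by
          rw [Finset.sum_const, hs, Finset.card_range, nsmul_eq_mul]; push_cast; ring
  refine (add_le_add hmain hsecond).trans (le_of_eq ?_)
  rw [hs, Finset.card_range]
  push_cast; ring

/-! ### The branches of a piecewise `C²` map -/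

/-- The partition points `a` and branches `F` that witness that `f` is piecewise `C²`. -/
structure Branches (f : I → I) where
  n : ℕ
  a : Fin (n + 1) → ℝ
  F : Fin n → ℝ → ℝ
  strictMono : StrictMono a
  a_zero : a 0 = 0
  a_last : a (Fin.last n) = 1
  contDiffOn : ∀ j, ContDiffOn ℝ 2 (F j) (Icc (a j.castSucc) (a j.succ))
  derivWithin_ne_zero : ∀ j, ∀ t ∈ Icc (a j.castSucc) (a j.succ),
    derivWithin (F j) (Icc (a j.castSucc) (a j.succ)) t ≠ 0
  eq_on_Ioo : ∀ j, ∀ x : I, (x : ℝ) ∈ Ioo (a j.castSucc) (a j.succ) → (f x : ℝ) = F j x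
  exists_branch : ∀ x : I, ∃ j, (x : ℝ) ∈ Icc (a j.castSucc) (a j.succ) ∧ (f x : ℝ) = F j x

lemma IsPiecewiseC2.nonempty_branches {f : I → I} (hf : IsPiecewiseC2 f) :
    Nonempty (Branches f) := by
  obtain ⟨n, a, F, h1, h2, h3, h4, h5⟩ := hf
  exact ⟨⟨n, a, F, h1, h2, h3, fun j => (h4 j).1, fun j => (h4 j).2.1, fun j => (h4 j).2.2, h5⟩⟩

namespace Branches

variable {f : I → I} (B : Branches f)

/-- The closed interval on which the branch `j` is defined. -/
def dom (j : Fin B.n) : Set ℝ := Icc (B.a j.castSucc) (B.a j.succ)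

/-- The interior of the domain of the branch `j`. -/
def inner (j : Fin B.n) : Set ℝ := Ioo (B.a j.castSucc) (B.a j.succ)

/-- The derivative of the branch `j`, one-sided at the end points of its domain. -/
def slope (j : Fin B.n) : ℝ → ℝ := derivWithin (B.F j) (B.dom j)

lemma lt_succ (j : Fin B.n) : B.a j.castSucc < B.a j.succ :=
  B.strictMono Fin.castSucc_lt_succ

lemma inner_subset_dom (j : Fin B.n) : B.inner j ⊆ B.dom j := Ioo_subset_Icc_self

lemma a_nonneg (i : Fin (B.n + 1)) : 0 ≤ B.a i :=
  B.a_zero ▸ B.strictMono.monotone (Fin.zero_le i)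

lemma a_le_one (i : Fin (B.n + 1)) : B.a i ≤ 1 :=
  B.a_last ▸ B.strictMono.monotone (Fin.le_last i)

lemma dom_subset (j : Fin B.n) : B.dom j ⊆ Icc 0 1 :=
  Icc_subset_Icc (B.a_nonneg _) (B.a_le_one _)

lemma isOpen_inner (j : Fin B.n) : IsOpen (B.inner j) := isOpen_Ioo

lemma isCompact_dom (j : Fin B.n) : IsCompact (B.dom j) := isCompact_Icc

lemma dom_nonempty (j : Fin B.n) : (B.dom j).Nonempty := nonempty_Icc.2 (B.lt_succ j).le

lemma dom_mem_nhds {j : Fin B.n} {t : ℝ} (ht : t ∈ B.inner j) : B.dom j ∈ 𝓝 t :=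
  Icc_mem_nhds ht.1 ht.2

lemma closure_inner (j : Fin B.n) : closure (B.inner j) = B.dom j :=
  closure_Ioo (B.lt_succ j).ne

lemma uniqueDiffOn_dom (j : Fin B.n) : UniqueDiffOn ℝ (B.dom j) := uniqueDiffOn_Icc (B.lt_succ j)

lemma continuousOn_F (j : Fin B.n) : ContinuousOn (B.F j) (B.dom j) :=
  (B.contDiffOn j).continuousOn

lemma differentiableOn_F (j : Fin B.n) : DifferentiableOn ℝ (B.F j) (B.dom j) :=
  (B.contDiffOn j).differentiableOn two_ne_zero

lemma contDiffOn_slope (j : Fin B.n) : ContDiffOn ℝ 1 (B.slope j) (B.dom j) :=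
  (B.contDiffOn j).derivWithin (B.uniqueDiffOn_dom j) (by norm_num)

lemma continuousOn_slope (j : Fin B.n) : ContinuousOn (B.slope j) (B.dom j) :=
  (B.contDiffOn_slope j).continuousOn

lemma slope_ne_zero {j : Fin B.n} {t : ℝ} (ht : t ∈ B.dom j) : B.slope j t ≠ 0 :=
  B.derivWithin_ne_zero j t ht

lemma hasDerivWithinAt_F {j : Fin B.n} {t : ℝ} (ht : t ∈ B.dom j) :
    HasDerivWithinAt (B.F j) (B.slope j t) (B.dom j) t :=
  (B.differentiableOn_F j t ht).hasDerivWithinAt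

lemma hasDerivAt_F {j : Fin B.n} {t : ℝ} (ht : t ∈ B.inner j) :
    HasDerivAt (B.F j) (B.slope j t) t :=
  (B.hasDerivWithinAt_F (B.inner_subset_dom j ht)).hasDerivAt (B.dom_mem_nhds ht)

lemma hasStrictDerivAt_F {j : Fin B.n} {t : ℝ} (ht : t ∈ B.inner j) :
    HasStrictDerivAt (B.F j) (B.slope j t) t := by
  have := (((B.contDiffOn j).contDiffAt (B.dom_mem_nhds ht)).hasStrictDerivAt two_ne_zero)
  rwa [(B.hasDerivAt_F ht).deriv] at this

lemma injOn_F (j : Fin B.n) : InjOn (B.F j) (B.dom j) := by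
  have key : ∀ s ∈ B.dom j, ∀ t ∈ B.dom j, s < t → B.F j s ≠ B.F j t := by
    intro s hs t ht hst heq
    have hsub : Icc s t ⊆ B.dom j := Icc_subset_Icc hs.1 ht.2
    obtain ⟨c, hc, hc0⟩ := exists_deriv_eq_zero hst ((B.continuousOn_F j).mono hsub) heq
    have hc' : c ∈ B.inner j := ⟨hs.1.trans_lt hc.1, hc.2.trans_le ht.2⟩
    rw [(B.hasDerivAt_F hc').deriv] at hc0
    exact B.slope_ne_zero (B.inner_subset_dom j hc') hc0
  intro s hs t ht heq
  rcases lt_trichotomy s t with h | h | h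
  · exact absurd heq (key s hs t ht h)
  · exact h
  · exact absurd heq.symm (key t ht s hs h)

lemma mapsTo_F (j : Fin B.n) : MapsTo (B.F j) (B.dom j) (Icc 0 1) := by
  have h1 : MapsTo (B.F j) (B.inner j) (Icc 0 1) := fun t ht => by
    have := B.eq_on_Ioo j ⟨t, B.dom_subset j (B.inner_subset_dom j ht)⟩ ht
    rw [← this]; exact (f _).2
  intro t ht
  rw [← B.closure_inner] at ht
  have h2 : ContinuousWithinAt (B.F j) (B.inner j) t :=
    (B.continuousOn_F j t (by rwa [← B.closure_inner])).mono (B.inner_subset_dom j)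
  have h3 := h2.mem_closure ht h1
  rwa [isClosed_Icc.closure_eq] at h3

lemma exists_bounds : ∃ κ S L : ℝ≥0, 0 < κ ∧ ∀ j, (∀ t ∈ B.dom j, κ ≤ |B.slope j t|) ∧
    LipschitzOnWith S (B.slope j) (B.dom j) ∧ LipschitzOnWith L (B.F j) (B.dom j) := by
  have hlip : ∀ (j : Fin B.n) (g : ℝ → ℝ), ContDiffOn ℝ 1 g (B.dom j) →
      ∃ K : ℝ≥0, LipschitzOnWith K g (B.dom j) := by
    intro j g hg
    obtain ⟨C, hC⟩ := (B.isCompact_dom j).exists_bound_of_continuousOn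
      (hg.continuousOn_derivWithin (B.uniqueDiffOn_dom j) le_rfl)
    refine ⟨C.toNNReal, (convex_Icc _ _).lipschitzOnWith_of_nnnorm_derivWithin_le
      (hg.differentiableOn one_ne_zero) fun x hx => ?_⟩
    rw [← NNReal.coe_le_coe, coe_nnnorm]
    exact (hC x hx).trans (Real.le_coe_toNNReal C)
  have hκ : ∀ j : Fin B.n, ∃ κ : ℝ≥0, 0 < κ ∧ ∀ t ∈ B.dom j, κ ≤ |B.slope j t| := by
    intro j
    obtain ⟨t, ht, hmin⟩ := (B.isCompact_dom j).exists_isMinOn (B.dom_nonempty j)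
      (B.continuousOn_slope j).abs
    exact ⟨⟨|B.slope j t|, abs_nonneg _⟩, abs_pos.2 (B.slope_ne_zero ht), fun s hs => hmin hs⟩
  choose S hS using fun j => hlip j _ (B.contDiffOn_slope j)
  choose L hL using fun j => hlip j _ ((B.contDiffOn j).of_le (by norm_num))
  choose κ hκ0 hκ using hκ
  obtain ⟨S', hS'⟩ := Finite.exists_le S
  obtain ⟨L', hL'⟩ := Finite.exists_le L
  obtain ⟨κ', hκ'⟩ := Finite.exists_le fun j => (κ j)⁻¹
  refine ⟨(κ' + 1)⁻¹, S', L', by positivity, fun j =>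
    ⟨fun t ht => le_trans ?_ (hκ j t ht), (hS j).weaken (hS' j), (hL j).weaken (hL' j)⟩⟩
  rw [NNReal.coe_le_coe]
  exact inv_le_of_inv_le₀ (hκ0 j) ((hκ' j).trans (by simp))

lemma eventually_eq_F {j : Fin B.n} {t : ℝ} (ht : t ∈ B.inner j) :
    realMap f =ᶠ[𝓝 t] B.F j := by
  filter_upwards [(B.isOpen_inner j).mem_nhds ht] with s hs
  have hs' := B.dom_subset j (B.inner_subset_dom j hs)
  rw [realMap, IccExtend_of_mem _ _ hs']
  exact B.eq_on_Ioo j ⟨s, hs'⟩ hs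

lemma realMap_coe (f : I → I) (x : I) : realMap f x = f x :=
  IccExtend_of_mem (zero_le_one' ℝ) (fun x => (f x : ℝ)) x.2

lemma mem_inner_of_notMem_range {j : Fin B.n} {t : ℝ} (ht : t ∈ B.dom j) (h : t ∉ range B.a) :
    t ∈ B.inner j :=
  ⟨lt_of_le_of_ne ht.1 fun e => h ⟨_, e⟩, lt_of_le_of_ne ht.2 fun e => h ⟨_, e.symm⟩⟩

lemma exists_mem_dom (x : I) : ∃ j, (x : ℝ) ∈ B.dom j :=
  (B.exists_branch x).imp fun _ h => h.1

lemma exists_mem_inner {x : I} (h : (x : ℝ) ∉ range B.a) : ∃ j, (x : ℝ) ∈ B.inner j :=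
  (B.exists_mem_dom x).imp fun _ hj => B.mem_inner_of_notMem_range hj h

/-- At a point that is not a turning point all branches defined there agree with `f`, together
with their derivatives. -/
lemma eq_of_notMem_turningPoints {x : I} (hx : x ∉ turningPoints f) {j : Fin B.n}
    (hj : (x : ℝ) ∈ B.dom j) :
    B.F j x = f x ∧ B.slope j x = derivWithin (realMap f) (Icc 0 1) x := by
  have hd : DifferentiableWithinAt ℝ (realMap f) (Icc 0 1) (x : ℝ) := not_not.1 hx
  have hsub : B.inner j ⊆ Icc 0 1 := (B.inner_subset_dom j).trans (B.dom_subset j)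
  have hcl : (x : ℝ) ∈ closure (B.inner j) := by rwa [B.closure_inner]
  have hne : (𝓝[B.inner j] (x : ℝ)).NeBot := mem_closure_iff_nhdsWithin_neBot.1 hcl
  have heq : ∀ t ∈ B.inner j, realMap f t = B.F j t := fun t ht => (B.eventually_eq_F ht).self_of_nhds
  have hval : B.F j x = realMap f x :=
    tendsto_nhds_unique_of_eventuallyEq
      ((B.continuousOn_F j _ hj).mono (B.inner_subset_dom j)).tendsto
      (hd.continuousWithinAt.mono hsub).tendsto
      (eventually_mem_nhdsWithin.mono fun t ht => (heq t ht).symm)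
  refine ⟨hval.trans (realMap_coe f x), ?_⟩
  have hu : UniqueDiffWithinAt ℝ (B.inner j) (x : ℝ) :=
    uniqueDiffWithinAt_convex (convex_Ioo _ _)
      (by rw [interior_Ioo]; exact nonempty_Ioo.2 (B.lt_succ j)) hcl
  exact hu.eq_deriv _ ((B.hasDerivWithinAt_F hj).mono (B.inner_subset_dom j))
    ((hd.hasDerivWithinAt.mono hsub).congr (fun t ht => (heq t ht).symm) hval)

lemma notMem_turningPoints_of_mem_inner {x : I} {j : Fin B.n} (hj : (x : ℝ) ∈ B.inner j) :
    x ∉ turningPoints f :=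
  not_not.2 ((B.hasDerivAt_F hj).congr_of_eventuallyEq
    (B.eventually_eq_F hj)).differentiableAt.differentiableWithinAt

lemma mem_range_of_mem_turningPoints {x : I} (hx : x ∈ turningPoints f) : (x : ℝ) ∈ range B.a := by
  by_contra h
  obtain ⟨j, hj⟩ := B.exists_mem_inner h
  exact B.notMem_turningPoints_of_mem_inner hj hx

lemma finite_turningPoints {f : I → I} (B : Branches f) : (turningPoints f).Finite :=
  Finite.of_finite_image ((finite_range B.a).subset (by
    rintro _ ⟨x, hx, rfl⟩; exact B.mem_range_of_mem_turningPoints hx)) Subtype.val_injective.injOn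

lemma measurable {f : I → I} (B : Branches f) : Measurable f := by
  classical
  let U : Set I := {x | (x : ℝ) ∉ range B.a}
  have hUc : (Uᶜ : Set I).Finite := by
    refine Finite.of_finite_image ((finite_range B.a).subset ?_) Subtype.val_injective.injOn
    rintro _ ⟨x, hx, rfl⟩
    exact not_not.1 hx
  have hU : IsOpen U := by
    have := hUc.isClosed.isOpen_compl
    rwa [compl_compl] at this
  have hcont : ContinuousOn f U := by
    intro x hx
    obtain ⟨j, hj⟩ := B.exists_mem_inner hx
    refine ContinuousAt.continuousWithinAt ?_
    refine IsInducing.subtypeVal.continuousAt_iff.2 ?_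
    have h1 : ContinuousAt (fun y : I => B.F j y) x :=
      ((B.hasDerivAt_F hj).continuousAt).comp continuousAt_subtype_val
    refine h1.congr ?_
    filter_upwards [continuousAt_subtype_val.preimage_mem_nhds ((B.isOpen_inner j).mem_nhds hj)]
      with y hy
    exact (B.eq_on_Ioo j y hy).symm
  have hm : Measurable (U.piecewise f fun _ => 0) :=
    hcont.measurable_piecewise continuousOn_const hU.measurableSet
  refine hm.measurable_of_countable_ne (hUc.countable.mono ?_)
  intro x hx hxU
  exact hx (piecewise_eq_of_mem _ _ _ hxU)

lemma quasiMeasurePreserving {f : I → I} (B : Branches f) :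
    Measure.QuasiMeasurePreserving f volume volume := by
  refine ⟨B.measurable, Measure.AbsolutelyContinuous.mk fun A hA hA0 => ?_⟩
  rw [Measure.map_apply B.measurable hA]
  have hA'0 : volume (Subtype.val '' A) = 0 := by rwa [unitInterval.volume_apply] at hA0
  set A' := toMeasurable volume (Subtype.val '' A) with hA'
  have hA'm : MeasurableSet A' := measurableSet_toMeasurable _ _
  have hA'z : volume A' = 0 := (measure_toMeasurable _).trans hA'0
  have hj : ∀ j, ∀ᵐ t : ℝ, t ∈ B.inner j → B.F j t ∉ A' := by
    intro j
    rw [← ae_restrict_iff' (B.isOpen_inner j).measurableSet]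
    have h1 := lintegral_image_eq_lintegral_abs_deriv_mul (B.isOpen_inner j).measurableSet
      (fun t ht => (B.hasDerivAt_F ht).hasDerivWithinAt)
      ((B.injOn_F j).mono (B.inner_subset_dom j)) (A'.indicator 1)
    have h2 : ∫⁻ x in B.F j '' B.inner j, A'.indicator 1 x = 0 := by
      refine le_antisymm ((setLIntegral_le_lintegral _ _).trans ?_) bot_le
      rw [lintegral_indicator_one hA'm, hA'z]
    rw [h2] at h1
    have hmeas : AEMeasurable
        (fun t => ENNReal.ofReal |B.slope j t| * A'.indicator 1 (B.F j t))
        (volume.restrict (B.inner j)) := by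
      refine AEMeasurable.mul ?_ ?_
      · exact (((B.continuousOn_slope j).mono (B.inner_subset_dom j)).aemeasurable
          (B.isOpen_inner j).measurableSet).abs.ennreal_ofReal
      · exact ((measurable_one.indicator hA'm).comp_aemeasurable
          (((B.continuousOn_F j).mono (B.inner_subset_dom j)).aemeasurable
            (B.isOpen_inner j).measurableSet))
    have h3 := (lintegral_eq_zero_iff' hmeas).1 h1.symm
    filter_upwards [h3, ae_restrict_mem (B.isOpen_inner j).measurableSet] with t ht htj htA
    have hs := abs_pos.2 (B.slope_ne_zero (B.inner_subset_dom j htj))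
    simp [htA] at ht
    exact absurd ht (abs_pos.1 hs)
  have hr : ∀ᵐ t : ℝ, t ∉ range B.a := by
    have := (finite_range B.a).measure_zero volume
    exact measure_eq_zero_iff_ae_notMem.1 this
  rw [measure_eq_zero_iff_ae_notMem]
  filter_upwards [ae_unitInterval_of_ae hr, ae_unitInterval_of_ae (ae_all_iff.2 hj)]
    with x hx hxj hxA
  obtain ⟨j, hxin⟩ := B.exists_mem_inner hx
  refine hxj j hxin (subset_toMeasurable _ _ ⟨f x, hxA, B.eq_on_Ioo j x hxin⟩)

end Branches

/-! ### Weighted variation under the Perron-Frobenius operator -/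

lemma lipschitzOnWith_Icc_trans {g : ℝ → ℝ} {K : ℝ≥0} {p q r : ℝ}
    (h1 : LipschitzOnWith K g (Icc p q)) (h2 : LipschitzOnWith K g (Icc q r)) :
    LipschitzOnWith K g (Icc p r) := by
  have key : ∀ s ∈ Icc p r, ∀ t ∈ Icc p r, s ≤ t → dist (g s) (g t) ≤ K * dist s t := by
    intro s hs t ht hst
    rcases le_total t q with htq | htq
    · exact h1.dist_le_mul s ⟨hs.1, hst.trans htq⟩ t ⟨ht.1, htq⟩
    rcases le_total q s with hsq | hsq
    · exact h2.dist_le_mul s ⟨hsq, hs.2⟩ t ⟨htq, ht.2⟩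
    · have a1 := h1.dist_le_mul s ⟨hs.1, hsq⟩ q ⟨hs.1.trans hsq, le_rfl⟩
      have a2 := h2.dist_le_mul q ⟨le_rfl, htq.trans ht.2⟩ t ⟨htq, ht.2⟩
      have e : dist s t = dist s q + dist q t := by
        rw [Real.dist_eq, Real.dist_eq, Real.dist_eq, abs_of_nonpos (by linarith),
          abs_of_nonpos (by linarith), abs_of_nonpos (by linarith)]
        ring
      rw [e, mul_add]
      exact (dist_triangle _ _ _).trans (add_le_add a1 a2)
  refine LipschitzOnWith.of_dist_le_mul fun s hs t ht => ?_
  rcases le_total s t with h | h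
  · exact key s hs t ht h
  · rw [dist_comm, dist_comm s t]; exact key t ht s hs h

/-- A function that is Lipschitz on each interval of a partition is Lipschitz. -/
lemma lipschitzOnWith_Icc_of_partition {n : ℕ} {a : Fin (n + 1) → ℝ} {g : ℝ → ℝ} {K : ℝ≥0}
    (H : ∀ j : Fin n, LipschitzOnWith K g (Icc (a j.castSucc) (a j.succ))) :
    LipschitzOnWith K g (Icc (a 0) (a (Fin.last n))) := by
  have : ∀ i, LipschitzOnWith K g (Icc (a 0) (a i)) := fun i => by
    induction i using Fin.induction with
    | zero => rw [Icc_self]; exact LipschitzOnWith.of_dist_le_mul (by simp)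
    | succ i ih => exact lipschitzOnWith_Icc_trans ih (H i)
  exact this _

lemma tent_zero_zero (ρ : ℝ) : tent ρ 0 0 = 1 := by
  simp [tent, ramp]

lemma tent_zero_eq_zero {ρ : ℝ} (hρ : 0 < ρ) {t : ℝ} (ht : ρ ≤ |t|) : tent ρ 0 t = 0 := by
  by_contra h
  have := abs_sub_lt_of_tent_ne_zero hρ h
  simp at this
  linarith

open Classical in
/-- The factor by which a test function may grow near `x` when it is pulled back by `f`: the
branches of `f` are cut apart at turning points, which costs a factor `2` there. -/
def cutFactor (f : I → I) (ρ : ℝ) (x : I) : ℝ≥0∞ :=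
  if ∃ c ∈ turningPoints f, |(x : ℝ) - c| ≤ ρ then 2 else 1

lemma one_le_cutFactor (f : I → I) (ρ : ℝ) (x : I) : 1 ≤ cutFactor f ρ x := by
  unfold cutFactor; split_ifs <;> norm_num

lemma cutFactor_le_two (f : I → I) (ρ : ℝ) (x : I) : cutFactor f ρ x ≤ 2 := by
  unfold cutFactor; split_ifs <;> norm_num

namespace Branches

variable {f : I → I} (B : Branches f)

/-- The branch `j` as a map of `[0,1]`, meaningful on its domain. -/
def branch (j : Fin B.n) (x : I) : I := projIcc 0 1 zero_le_one (B.F j x)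

lemma coe_branch {j : Fin B.n} {x : I} (hx : (x : ℝ) ∈ B.dom j) : (B.branch j x : ℝ) = B.F j x := by
  rw [branch, projIcc_of_mem _ (B.mapsTo_F j hx)]

/-- The test function `Φ ∘ f / f'`, on the domain of the branch `j`. -/
def pull (Φ : ℝ → ℝ) (j : Fin B.n) (t : ℝ) : ℝ := Φ (B.F j t) * (B.slope j t)⁻¹

open Classical in
/-- The value of `Φ ∘ f / f'` at an end point `e` of the branch `j`, if that is a turning point. -/
def cutValue (Φ : ℝ → ℝ) (j : Fin B.n) (e : ℝ) : ℝ :=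
  if e ∈ Subtype.val '' turningPoints f then B.pull Φ j e else 0

/-- The correction, supported near the turning points, that makes `Φ ∘ f / f'` vanish there. -/
def correction (Φ : ℝ → ℝ) (ρ : ℝ) (j : Fin B.n) (t : ℝ) : ℝ :=
  B.cutValue Φ j (B.a j.castSucc) * tent ρ 0 (t - B.a j.castSucc) +
    B.cutValue Φ j (B.a j.succ) * tent ρ 0 (t - B.a j.succ)

open Classical in
/-- The continuous test function that is `Φ ∘ f / f'` up to the corrections at turning points. -/
def pullTest (Φ : ℝ → ℝ) (ρ : ℝ) (t : ℝ) : ℝ :=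
  if h : ∃ j, t ∈ B.dom j then B.pull Φ h.choose t - B.correction Φ ρ h.choose t else 0

lemma exists_gap : ∃ δ : ℝ≥0, 0 < δ ∧ ∀ j : Fin B.n, δ ≤ B.a j.succ - B.a j.castSucc := by
  have hpos : ∀ j : Fin B.n, 0 < B.a j.succ - B.a j.castSucc := fun j => sub_pos.2 (B.lt_succ j)
  obtain ⟨M, hM⟩ := Finite.exists_le fun j : Fin B.n => (B.a j.succ - B.a j.castSucc)⁻¹
  refine ⟨⟨(max M 1)⁻¹, by positivity⟩, ?_, fun j => ?_⟩
  · have : (0 : ℝ) < (max M 1)⁻¹ := by positivity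
    exact this
  · exact inv_le_of_inv_le₀ (hpos j) ((hM j).trans (le_max_left _ _))

variable {ρ : ℝ} (hρ : 0 < ρ) (hgap : ∀ j : Fin B.n, 2 * ρ ≤ B.a j.succ - B.a j.castSucc)
include hρ hgap

lemma correction_left (Φ : ℝ → ℝ) (j : Fin B.n) :
    B.correction Φ ρ j (B.a j.castSucc) = B.cutValue Φ j (B.a j.castSucc) := by
  have h := hgap j
  rw [correction, sub_self, tent_zero_zero,
    tent_zero_eq_zero hρ (by rw [abs_of_nonpos] <;> linarith)]
  ring

lemma correction_right (Φ : ℝ → ℝ) (j : Fin B.n) :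
    B.correction Φ ρ j (B.a j.succ) = B.cutValue Φ j (B.a j.succ) := by
  have h := hgap j
  rw [correction, sub_self, tent_zero_zero,
    tent_zero_eq_zero hρ (by rw [abs_of_nonneg] <;> linarith)]
  ring

lemma pull_sub_correction_eq (Φ : ℝ → ℝ) {j k : Fin B.n} {t : ℝ} (hj : t ∈ B.dom j)
    (hk : t ∈ B.dom k) :
    B.pull Φ j t - B.correction Φ ρ j t = B.pull Φ k t - B.correction Φ ρ k t := by
  wlog hjk : j < k generalizing j k
  · rcases (not_lt.1 hjk).eq_or_lt with rfl | h
    · rfl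
    · exact (this hk hj h).symm
  have h1 : B.a j.succ ≤ B.a k.castSucc := B.strictMono.monotone (by
    rw [Fin.le_def]; simpa using hjk)
  have ej : t = B.a j.succ := le_antisymm hj.2 (h1.trans hk.1)
  have ek : t = B.a k.castSucc := le_antisymm (hj.2.trans h1) hk.1
  have cj : B.correction Φ ρ j t = B.cutValue Φ j t := by
    rw [ej]; exact B.correction_right hρ hgap Φ j
  have ck : B.correction Φ ρ k t = B.cutValue Φ k t := by
    rw [ek]; exact B.correction_left hρ hgap Φ k
  rw [cj, ck, cutValue, cutValue]
  by_cases ht : t ∈ Subtype.val '' turningPoints f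
  · rw [if_pos ht, if_pos ht, sub_self, sub_self]
  · rw [if_neg ht, if_neg ht, pull, pull]
    have hx : (⟨t, B.dom_subset j hj⟩ : I) ∉ turningPoints f := fun h => ht ⟨_, h, rfl⟩
    obtain ⟨a1, a2⟩ := B.eq_of_notMem_turningPoints hx hj
    obtain ⟨b1, b2⟩ := B.eq_of_notMem_turningPoints hx hk
    simp only at a1 a2 b1 b2
    rw [a1, a2, b1, b2]

lemma pullTest_eq (Φ : ℝ → ℝ) {j : Fin B.n} {t : ℝ} (hj : t ∈ B.dom j) :
    B.pullTest Φ ρ t = B.pull Φ j t - B.correction Φ ρ j t := by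
  have h : ∃ j, t ∈ B.dom j := ⟨j, hj⟩
  rw [pullTest, dif_pos h]
  exact B.pull_sub_correction_eq hρ hgap Φ h.choose_spec hj

omit hρ hgap in
lemma enorm_pull_le {Φ : ℝ → ℝ} {w : I → ℝ≥0∞} (hΦ : ∀ x : I, ‖Φ x‖ₑ ≤ w x) {j : Fin B.n} {x : I}
    (hx : (x : ℝ) ∈ B.dom j) :
    ‖B.pull Φ j x‖ₑ ≤ w (B.branch j x) * ‖(B.slope j x)⁻¹‖ₑ := by
  rw [pull, enorm_mul, ← B.coe_branch hx]
  gcongr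
  exact hΦ _

omit hgap in
lemma enorm_correction_summand_le {Φ : ℝ → ℝ} (j : Fin B.n) (e t : ℝ) :
    ‖B.cutValue Φ j e * tent ρ 0 (t - e)‖ₑ ≤ ‖B.pull Φ j e‖ₑ ∧
    (B.cutValue Φ j e * tent ρ 0 (t - e) ≠ 0 →
      e ∈ Subtype.val '' turningPoints f ∧ |t - e| < ρ) := by
  constructor
  · rw [enorm_mul]
    refine (mul_le_of_le_one_right' ?_).trans ?_
    · rw [← ofReal_norm, ← ENNReal.ofReal_one]
      exact ENNReal.ofReal_le_ofReal (abs_tent_le_one _ _ _)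
    · rw [cutValue]; split_ifs <;> simp
  · intro h
    refine ⟨?_, ?_⟩
    · by_contra he
      exact h (by rw [cutValue, if_neg he, zero_mul])
    · have := abs_sub_lt_of_tent_ne_zero hρ (right_ne_zero_of_mul h)
      simpa using this

lemma enorm_pullTest_le {Φ : ℝ → ℝ} {w w' : I → ℝ≥0∞} (hΦ : ∀ x : I, ‖Φ x‖ₑ ≤ w x)
    (hw : ∀ (j : Fin B.n) (x y : I), (x : ℝ) ∈ B.dom j → (y : ℝ) ∈ B.dom j →
      |(x : ℝ) - y| ≤ ρ → cutFactor f ρ x * (w (B.branch j y) * ‖(B.slope j y)⁻¹‖ₑ) ≤ w' x)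
    (x : I) : ‖B.pullTest Φ ρ x‖ₑ ≤ w' x := by
  obtain ⟨j, hj⟩ := B.exists_mem_dom x
  rw [B.pullTest_eq hρ hgap Φ hj]
  have hp : ∀ y : I, (y : ℝ) ∈ B.dom j → |(x : ℝ) - y| ≤ ρ →
      cutFactor f ρ x * ‖B.pull Φ j y‖ₑ ≤ w' x := fun y hy hxy =>
    (mul_le_mul_right (B.enorm_pull_le hΦ hy) _).trans (hw j x y hj hy hxy)
  have hx : cutFactor f ρ x * ‖B.pull Φ j x‖ₑ ≤ w' x := hp x hj (by simpa using hρ.le)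
  -- Only one of the two corrections is active, and then the factor `2` is available.
  have hone : ∀ e : ℝ, e ∈ B.dom j → B.cutValue Φ j e * tent ρ 0 (x - e) ≠ 0 →
      ‖B.pull Φ j x - B.cutValue Φ j e * tent ρ 0 (x - e)‖ₑ ≤ w' x := by
    intro e he hne
    obtain ⟨h1, h2⟩ := B.enorm_correction_summand_le hρ (Φ := Φ) j e x
    obtain ⟨⟨c, hc, hce⟩, hlt⟩ := h2 hne
    have hcut : cutFactor f ρ x = 2 := if_pos ⟨c, hc, by rw [hce]; exact hlt.le⟩
    have he' := hp ⟨e, B.dom_subset j he⟩ he hlt.le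
    rw [hcut] at hx he'
    refine enorm_sub_le.trans ((add_le_add le_rfl h1).trans ?_)
    rcases le_total ‖B.pull Φ j x‖ₑ ‖B.pull Φ j e‖ₑ with h | h
    · refine le_trans ?_ he'
      rw [two_mul]; gcongr
    · refine le_trans ?_ hx
      rw [two_mul]; gcongr
  by_cases hl : B.cutValue Φ j (B.a j.castSucc) * tent ρ 0 (x - B.a j.castSucc) = 0
  · by_cases hr : B.cutValue Φ j (B.a j.succ) * tent ρ 0 (x - B.a j.succ) = 0
    · rw [correction, hl, hr, add_zero, sub_zero]
      exact (le_mul_of_one_le_left' (one_le_cutFactor f ρ x)).trans hx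
    · rw [correction, hl, zero_add]
      exact hone _ ⟨(B.lt_succ j).le, le_rfl⟩ hr
  · have h2 := ((B.enorm_correction_summand_le hρ (Φ := Φ) j _ x).2 hl).2
    rw [correction, tent_zero_eq_zero hρ (t := x - B.a j.succ) (by
      have := hgap j
      rw [abs_lt] at h2
      rw [abs_of_nonpos] <;> linarith [h2.1, h2.2]), mul_zero, add_zero]
    exact hone _ ⟨le_rfl, (B.lt_succ j).le⟩ hl

end Branches

namespace Branches

variable {f : I → I} (B : Branches f)

lemma abs_inv_slope_le {κ : ℝ≥0} (hκ0 : 0 < κ) {j : Fin B.n}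
    (hκ : ∀ t ∈ B.dom j, κ ≤ |B.slope j t|) {t : ℝ} (ht : t ∈ B.dom j) :
    |(B.slope j t)⁻¹| ≤ κ⁻¹ := by
  rw [abs_inv]
  exact inv_anti₀ (by exact_mod_cast hκ0) (hκ t ht)

lemma abs_cutValue_le {κ M : ℝ≥0} (hκ0 : 0 < κ) {j : Fin B.n}
    (hκ : ∀ t ∈ B.dom j, κ ≤ |B.slope j t|) {Φ : ℝ → ℝ} (hΦ : ∀ x : I, |Φ x| ≤ M) {e : ℝ}
    (he : e ∈ B.dom j) : |B.cutValue Φ j e| ≤ M * κ⁻¹ := by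
  rw [cutValue]
  split_ifs
  · rw [pull, abs_mul]
    exact mul_le_mul (hΦ ⟨_, B.mapsTo_F j he⟩) (B.abs_inv_slope_le hκ0 hκ he) (abs_nonneg _)
      M.coe_nonneg
  · rw [abs_zero]; positivity

lemma lipschitzWith_correction {κ M ρ : ℝ≥0} (hκ0 : 0 < κ) (hρ : 0 < ρ) {j : Fin B.n}
    (hκ : ∀ t ∈ B.dom j, κ ≤ |B.slope j t|) {Φ : ℝ → ℝ} (hΦ : ∀ x : I, |Φ x| ≤ M) :
    LipschitzWith (2 * (M * κ⁻¹ * (2 / ρ))) (B.correction Φ ρ j) := by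
  have h : ∀ e ∈ B.dom j, ∀ s t : ℝ,
      |B.cutValue Φ j e * tent ρ 0 (s - e) - B.cutValue Φ j e * tent ρ 0 (t - e)|
        ≤ M * κ⁻¹ * ((2 / ρ) * |s - t|) := by
    intro e he s t
    rw [← mul_sub, abs_mul]
    have := (lipschitzWith_tent hρ 0).dist_le_mul (s - e) (t - e)
    rw [Real.dist_eq, Real.dist_eq, sub_sub_sub_cancel_right] at this
    exact mul_le_mul (B.abs_cutValue_le hκ0 hκ hΦ he) this (abs_nonneg _) (by positivity)
  refine LipschitzWith.of_dist_le_mul fun s t => ?_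
  rw [Real.dist_eq, Real.dist_eq, correction, correction, add_sub_add_comm]
  refine (abs_add_le _ _).trans ((add_le_add (h _ ⟨le_rfl, (B.lt_succ j).le⟩ s t)
    (h _ ⟨(B.lt_succ j).le, le_rfl⟩ s t)).trans (le_of_eq ?_))
  push_cast; ring

lemma lipschitzOnWith_pull {κ M S L K : ℝ≥0} (hκ0 : 0 < κ) {j : Fin B.n}
    (hκ : ∀ t ∈ B.dom j, κ ≤ |B.slope j t|) (hS : LipschitzOnWith S (B.slope j) (B.dom j))
    (hL : LipschitzOnWith L (B.F j) (B.dom j)) {Φ : ℝ → ℝ} (hK : LipschitzWith K Φ)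
    (hΦ : ∀ x : I, |Φ x| ≤ M) :
    LipschitzOnWith (K * L * κ⁻¹ + M * (S * κ⁻¹ * κ⁻¹)) (B.pull Φ j) (B.dom j) := by
  refine LipschitzOnWith.of_dist_le_mul fun s hs t ht => ?_
  have h1 : |Φ (B.F j s) - Φ (B.F j t)| ≤ K * (L * |s - t|) :=
    (hK.dist_le_mul _ _).trans (by gcongr; exact hL.dist_le_mul s hs t ht)
  have h2 : |(B.slope j s)⁻¹ - (B.slope j t)⁻¹| ≤ S * |s - t| * κ⁻¹ * κ⁻¹ := by
    rw [inv_sub_inv (B.slope_ne_zero hs) (B.slope_ne_zero ht), div_eq_mul_inv, mul_inv, abs_mul,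
      abs_mul, ← mul_assoc]
    have h3 : |B.slope j t - B.slope j s| ≤ S * |s - t| := by
      rw [abs_sub_comm]; exact hS.dist_le_mul s hs t ht
    have h4 := B.abs_inv_slope_le hκ0 hκ hs
    have h5 := B.abs_inv_slope_le hκ0 hκ ht
    gcongr
  rw [Real.dist_eq, Real.dist_eq, pull, pull]
  calc |Φ (B.F j s) * (B.slope j s)⁻¹ - Φ (B.F j t) * (B.slope j t)⁻¹|
      = |(Φ (B.F j s) - Φ (B.F j t)) * (B.slope j s)⁻¹
          + Φ (B.F j t) * ((B.slope j s)⁻¹ - (B.slope j t)⁻¹)| := by ring_nf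
    _ ≤ K * (L * |s - t|) * κ⁻¹ + M * (S * |s - t| * κ⁻¹ * κ⁻¹) := by
      refine (abs_add_le _ _).trans ?_
      rw [abs_mul, abs_mul]
      have h4 := B.abs_inv_slope_le hκ0 hκ hs
      have h5 : |Φ (B.F j t)| ≤ M := hΦ ⟨_, B.mapsTo_F j ht⟩
      gcongr
    _ = _ := by push_cast; ring

/-- The change of the weight under the Perron-Frobenius operator. By duality a test function `Φ`
becomes `Φ ∘ f / f'`, up to a term that is bounded by the `L¹` norm. -/
lemma exists_weightedVariation_perronFrobenius_le (M : ℝ≥0) {ρ : ℝ≥0} (hρ : 0 < ρ)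
    (hgap : ∀ j : Fin B.n, 2 * ρ ≤ B.a j.succ - B.a j.castSucc) :
    ∃ C : ℝ≥0, ∀ w w' : I → ℝ≥0∞, (∀ x, w x ≤ M) →
      (∀ (j : Fin B.n) (x y : I), (x : ℝ) ∈ B.dom j → (y : ℝ) ∈ B.dom j → |(x : ℝ) - y| ≤ ρ →
        cutFactor f ρ x * (w (B.branch j y) * ‖(B.slope j y)⁻¹‖ₑ) ≤ w' x) →
      ∀ h : L1 ℝ, weightedVariation w (perronFrobenius f h)
        ≤ weightedVariation w' h + C * ‖h‖ₑ := by
  obtain ⟨κ, S, L, hκ0, hB⟩ := B.exists_bounds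
  have hρ' : (0 : ℝ) < ρ := hρ
  set C : ℝ≥0 := M * (S * κ⁻¹ * κ⁻¹) + 2 * (M * κ⁻¹ * (2 / ρ)) with hC
  refine ⟨C, fun w w' hw hww h => iSup₂_le fun Φ hΦ => ?_⟩
  obtain ⟨⟨K, hK⟩, hb⟩ := hΦ
  have hΦM : ∀ x : I, |Φ x| ≤ M := fun x => by
    have h1 := (hb x).trans (hw x)
    rw [enorm_eq_nnnorm, ENNReal.coe_le_coe] at h1
    exact_mod_cast h1
  set Ψ := B.pullTest Φ ρ with hΨ
  have hΨeq : ∀ j, ∀ t ∈ B.dom j, Ψ t = B.pull Φ j t - B.correction Φ ρ j t := fun j t ht =>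
    B.pullTest_eq hρ' hgap Φ ht
  have hcorr := fun j => B.lipschitzWith_correction hκ0 hρ (hB j).1 hΦM
  have hpull := fun j => B.lipschitzOnWith_pull hκ0 (hB j).1 (hB j).2.1 (hB j).2.2 hK hΦM
  obtain ⟨K', hΨL⟩ : ∃ K', LipschitzOnWith K' Ψ (Icc 0 1) := by
    refine ⟨K * L * κ⁻¹ + M * (S * κ⁻¹ * κ⁻¹) + 2 * (M * κ⁻¹ * (2 / ρ)), ?_⟩
    have := lipschitzOnWith_Icc_of_partition (a := B.a) (g := Ψ)
      (K := K * L * κ⁻¹ + M * (S * κ⁻¹ * κ⁻¹) + 2 * (M * κ⁻¹ * (2 / ρ))) fun j => by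
        refine LipschitzOnWith.of_dist_le_mul fun s hs t ht => ?_
        rw [hΨeq j s hs, hΨeq j t ht, NNReal.coe_add, add_mul, dist_eq_norm, sub_sub_sub_comm]
        exact (norm_sub_le _ _).trans
          (add_le_add ((hpull j).dist_le_mul s hs t ht) ((hcorr j).dist_le_mul s t))
    rwa [B.a_zero, B.a_last] at this
  have hΨw : ∀ x : I, ‖Ψ x‖ₑ ≤ w' x := B.enorm_pullTest_le hρ' hgap hb hww
  -- The derivatives of `Φ` cancel in the difference, so the bound does not depend on the
  -- Lipschitz constant of `Φ`; this is where the branches must be `C²`.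
  have hdiff : ∀ᵐ x : I, |deriv Φ (f x) - deriv Ψ x| ≤ C := by
    have hr : ∀ᵐ t : ℝ, t ∉ range B.a :=
      measure_eq_zero_iff_ae_notMem.1 ((finite_range B.a).measure_zero volume)
    filter_upwards [ae_unitInterval_of_ae hr, B.quasiMeasurePreserving.ae
      (ae_unitInterval_of_ae hK.ae_differentiableAt_real), ae_all_iff.2 fun j =>
        ae_unitInterval_of_ae (hcorr j).ae_differentiableAt_real] with x hxr hxΦ hxc
    obtain ⟨j, hj⟩ := B.exists_mem_inner hxr
    have hjd := B.inner_subset_dom j hj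
    have hfx : (f x : ℝ) = B.F j x := B.eq_on_Ioo j x hj
    rw [hfx] at hxΦ ⊢
    have hsd : DifferentiableAt ℝ (B.slope j) x :=
      ((B.contDiffOn_slope j).differentiableOn one_ne_zero).differentiableAt (B.dom_mem_nhds hj)
    have hsne := B.slope_ne_zero hjd
    have hpd : HasDerivAt (B.pull Φ j) (deriv Φ (B.F j x) * B.slope j x * (B.slope j x)⁻¹
        + Φ (B.F j x) * (-deriv (B.slope j) x / B.slope j x ^ 2)) x :=
      (hxΦ.hasDerivAt.comp (x : ℝ) (B.hasDerivAt_F hj)).mul (hsd.hasDerivAt.inv hsne)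
    have hev : Ψ =ᶠ[𝓝 (x : ℝ)] fun t => B.pull Φ j t - B.correction Φ ρ j t := by
      filter_upwards [B.dom_mem_nhds hj] with t ht using hΨeq j t ht
    have hΨd : deriv Ψ x = deriv Φ (B.F j x)
        + Φ (B.F j x) * (-deriv (B.slope j) x / B.slope j x ^ 2)
        - deriv (B.correction Φ ρ j) x := by
      rw [hev.deriv_eq, (hpd.fun_sub (hxc j).hasDerivAt).deriv, mul_inv_cancel_right₀ hsne]
    have e : deriv Φ (B.F j x) - deriv Ψ x
        = Φ (B.F j x) * (deriv (B.slope j) x * (B.slope j x)⁻¹ * (B.slope j x)⁻¹)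
          + deriv (B.correction Φ ρ j) x := by
      rw [hΨd]; field_simp; ring
    rw [e, hC, NNReal.coe_add]
    refine (abs_add_le _ _).trans (add_le_add ?_ (norm_deriv_le_of_lipschitz (hcorr j)))
    rw [abs_mul, abs_mul, abs_mul]
    have h1 : |Φ (B.F j x)| ≤ M := hΦM ⟨_, B.mapsTo_F j hjd⟩
    have h2 : |deriv (B.slope j) x| ≤ S :=
      norm_deriv_le_of_lipschitzOn (B.dom_mem_nhds hj) (hB j).2.1
    have h3 := B.abs_inv_slope_le hκ0 (hB j).1 hjd
    rw [NNReal.coe_inv] at h3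
    push_cast
    gcongr
  have hh := L1.integrable_coeFn h
  have hΦ'm : Measurable fun x : I => deriv Φ x := (measurable_deriv Φ).comp measurable_subtype_coe
  have hΨ'm : Measurable fun x : I => deriv Ψ x := (measurable_deriv Ψ).comp measurable_subtype_coe
  have hdual : ∫ x : I, deriv Φ x * perronFrobenius f h x = ∫ x : I, deriv Φ (f x) * h x :=
    integral_mul_perronFrobenius B.quasiMeasurePreserving h (g := fun x : I => deriv Φ x) hΦ'm
      (c := K) fun x => norm_deriv_le_of_lipschitz (x₀ := (x : ℝ)) hK
  have i1 : Integrable fun x : I => deriv Ψ x * h x := by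
    refine hh.bdd_mul (c := K') hΨ'm.aestronglyMeasurable ?_
    filter_upwards [ae_mem_Ioo_unitInterval] with x hx
    exact norm_deriv_le_of_lipschitzOn (Icc_mem_nhds hx.1 hx.2) hΨL
  have i2 : Integrable fun x : I => (deriv Φ (f x) - deriv Ψ x) * h x :=
    hh.bdd_mul (c := C) ((hΦ'm.comp B.measurable).sub hΨ'm).aestronglyMeasurable hdiff
  have hsplit : ∫ x : I, deriv Φ (f x) * h x
      = (∫ x : I, deriv Ψ x * h x) + ∫ x : I, (deriv Φ (f x) - deriv Ψ x) * h x := by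
    rw [← integral_add i1 i2]
    congr 1; ext x; ring
  rw [hdual, hsplit]
  refine (enorm_add_le _ _).trans (add_le_add
    (enorm_integral_le_weightedVariation_of_lipschitzOnWith hΨL hΨw h) ?_)
  refine (enorm_integral_le_lintegral_enorm _).trans ?_
  rw [enorm_L1_eq_lintegral, ← lintegral_const_mul' _ _ ENNReal.coe_ne_top]
  refine lintegral_mono_ae ?_
  filter_upwards [hdiff] with x hx
  rw [enorm_mul]
  gcongr
  rw [enorm_eq_nnnorm, ENNReal.coe_le_coe]
  exact_mod_cast hx

/-- A crude bound for one step, which shows that the operator acts on functions of bounded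
variation. -/
lemma exists_variation_perronFrobenius_le {f : I → I} (B : Branches f) :
    ∃ C : ℝ≥0, ∀ h : L1 ℝ, variation (perronFrobenius f h) ≤ C * (variation h + ‖h‖ₑ) := by
  obtain ⟨κ, S, L, hκ0, hB⟩ := B.exists_bounds
  obtain ⟨δ, hδ, hgap⟩ := B.exists_gap
  obtain ⟨C, hC⟩ := B.exists_weightedVariation_perronFrobenius_le 1 (ρ := δ / 2) (by positivity)
    (fun j => by have := hgap j; push_cast; linarith)
  refine ⟨2 * κ⁻¹ + C, fun h => ?_⟩
  have h1 := hC (fun _ => 1) (fun _ => (2 * κ⁻¹ : ℝ≥0)) (by simp) (by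
    intro j x y _ hy _
    push_cast
    refine mul_le_mul' (cutFactor_le_two _ _ _) ?_
    rw [one_mul, enorm_eq_nnnorm, ENNReal.coe_le_coe]
    exact_mod_cast B.abs_inv_slope_le hκ0 (hB j).1 hy) h
  have h2 := weightedVariation_le (w := fun _ => ((2 * κ⁻¹ : ℝ≥0) : ℝ≥0∞)) (fun _ => le_rfl) h
  calc variation (perronFrobenius f h) ≤ _ := variation_le_weightedVariation_one _
    _ ≤ _ := h1
    _ ≤ (2 * κ⁻¹ : ℝ≥0) * variation h + C * ‖h‖ₑ := by gcongr
    _ ≤ (2 * κ⁻¹ + C : ℝ≥0) * variation h + (2 * κ⁻¹ + C : ℝ≥0) * ‖h‖ₑ := by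
      gcongr
      · exact le_self_add
      · exact le_add_self
    _ = _ := by rw [mul_add]

end Branches

/-! ### Iterating the perturbed operator -/

/-- The supremum of the weight `w` over the `4ρ`-neighbourhood of a point. -/
def fatten (ρ : ℝ) (w : I → ℝ≥0∞) (x : I) : ℝ≥0∞ := ⨆ (y : I) (_ : |(x : ℝ) - y| ≤ 4 * ρ), w y

lemma fatten_le {ρ : ℝ} {w : I → ℝ≥0∞} {M : ℝ≥0∞} (hw : ∀ x, w x ≤ M) (x : I) :
    fatten ρ w x ≤ M :=
  iSup₂_le fun y _ => hw y

namespace Branches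

variable {f : I → I} (B : Branches f)

/-- The effect on a weight of one step of the perturbed operator at scale `ρ`: the new weight at
`x` bounds what a test function may become there when it is pulled back along the branches near
`x`, with an error `ρ` allowed at each stage. -/
def weightStep (ρ : ℝ) (w : I → ℝ≥0∞) (x : I) : ℝ≥0∞ :=
  ⨆ (j : Fin B.n) (y : I) (_ : (x : ℝ) ∈ B.dom j ∧ (y : ℝ) ∈ B.dom j ∧ |(x : ℝ) - y| ≤ ρ),
    cutFactor f ρ x * (fatten ρ w (B.branch j y) * ‖(B.slope j y)⁻¹‖ₑ)

lemma exists_weightStep_le {f : I → I} (B : Branches f) : ∃ D : ℝ≥0, ∀ (ρ : ℝ) (M : ℝ≥0)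
    (w : I → ℝ≥0∞), (∀ x, w x ≤ M) → ∀ x, B.weightStep ρ w x ≤ (D * M : ℝ≥0) := by
  obtain ⟨κ, S, L, hκ0, hB⟩ := B.exists_bounds
  refine ⟨2 * κ⁻¹, fun ρ M w hw x => iSup_le fun j => iSup₂_le fun y hy => ?_⟩
  have h1 : ‖(B.slope j y)⁻¹‖ₑ ≤ (κ⁻¹ : ℝ≥0) := by
    rw [enorm_eq_nnnorm, ENNReal.coe_le_coe]
    exact_mod_cast B.abs_inv_slope_le hκ0 (hB j).1 hy.2.1
  calc cutFactor f ρ x * (fatten ρ w (B.branch j y) * ‖(B.slope j y)⁻¹‖ₑ)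
      ≤ 2 * (M * (κ⁻¹ : ℝ≥0)) :=
        mul_le_mul' (cutFactor_le_two _ _ _) (mul_le_mul' (fatten_le hw _) h1)
    _ = _ := by push_cast; ring

variable {Q : ℝ → Kernel I I}

lemma perturbedOp_mem_BV {f : I → I} (B : Branches f) (hregular : IsRegularFamily Q) {ε : ℝ}
    (hε : 0 < ε) {h : L1 ℝ}
    (hh : h ∈ BV ℝ) : perronFrobenius f h ∈ BV ℝ ∧ perturbedOp f (Q ε) h ∈ BV ℝ := by
  obtain ⟨C, hC⟩ := B.exists_variation_perronFrobenius_le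
  obtain ⟨C₀, hC₀⟩ := hregular
  have h1 : perronFrobenius f h ∈ BV ℝ := (hC h).trans_lt
    (ENNReal.mul_lt_top ENNReal.coe_lt_top (ENNReal.add_lt_top.2 ⟨hh, by simp⟩))
  exact ⟨h1, (hC₀ ε hε _ h1).trans_lt
    (ENNReal.add_lt_top.2 ⟨h1, ENNReal.mul_lt_top ENNReal.coe_lt_top (by simp)⟩)⟩

lemma enorm_perronFrobenius_le {f : I → I} (B : Branches f) (h : L1 ℝ) : ‖perronFrobenius f h‖ₑ ≤ ‖h‖ₑ := by
  rw [← ofReal_norm, ← ofReal_norm]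
  exact ENNReal.ofReal_le_ofReal (norm_perronFrobenius_real_le B.quasiMeasurePreserving h)

lemma enorm_perturbedOp_le {f : I → I} (B : Branches f) (hQ : IsPerturbationFamily Q) {ε : ℝ}
    (hε : 0 < ε) (h : L1 ℝ) :
    ‖perturbedOp f (Q ε) h‖ₑ ≤ ‖h‖ₑ := by
  obtain ⟨hM, hac⟩ := hQ ε hε
  refine le_trans ?_ (B.enorm_perronFrobenius_le h)
  rw [← ofReal_norm, ← ofReal_norm]
  exact ENNReal.ofReal_le_ofReal (norm_transitionOp_le hac _)

lemma exists_weightedVariation_perturbedOp_le (hQ : IsPerturbationFamily Q)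
    (hlocal : IsLocalFamily Q) (hregular : IsRegularFamily Q) (M : ℝ≥0) {ρ : ℝ≥0} (hρ : 0 < ρ)
    (hgap : ∀ j : Fin B.n, 2 * ρ ≤ B.a j.succ - B.a j.castSucc) :
    ∃ C : ℝ≥0, ∀ w : I → ℝ≥0∞, (∀ x, w x ≤ M) → ∀ ε ∈ Ioo (0 : ℝ) ρ, ∀ h ∈ BV ℝ,
      weightedVariation w (perturbedOp f (Q ε) h)
        ≤ weightedVariation (B.weightStep ρ w) h + C * ‖h‖ₑ := by
  obtain ⟨C₀, hC₀⟩ := id hregular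
  obtain ⟨C₁, hC₁⟩ := exists_weightedVariation_transitionOp_le C₀ M hρ
  obtain ⟨C₂, hC₂⟩ := B.exists_weightedVariation_perronFrobenius_le M hρ hgap
  refine ⟨C₂ + C₁, fun w hw ε hε h hh => ?_⟩
  obtain ⟨hMk, hac⟩ := hQ ε hε.1
  have h1 := hC₁ (Q ε) hac (fun x A hA hx => hlocal ε hε.1 x A hA
      (lt_of_le_of_lt (ENNReal.ofReal_le_ofReal hε.2.le) hx))
    (hC₀ ε hε.1) w (fatten ρ w) hw (fatten_le hw)
    (fun x y hxy => le_iSup₂ (f := fun (y : I) (_ : |(x : ℝ) - y| ≤ 4 * ρ) => w y) y hxy)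
    (perronFrobenius f h) (B.perturbedOp_mem_BV hregular hε.1 hh).1
  have h2 := hC₂ (fatten ρ w) (B.weightStep ρ w) (fatten_le hw) (fun j x y hx hy hxy =>
    le_iSup_of_le j (le_iSup₂ (f := fun (y : I) (_ : (x : ℝ) ∈ B.dom j ∧ (y : ℝ) ∈ B.dom j ∧
      |(x : ℝ) - y| ≤ ρ) => cutFactor f ρ x * (fatten ρ w (B.branch j y) *
        ‖(B.slope j y)⁻¹‖ₑ)) y ⟨hx, hy, hxy⟩)) h
  calc weightedVariation w (perturbedOp f (Q ε) h)
      ≤ weightedVariation (fatten ρ w) (perronFrobenius f h)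
          + C₁ * ‖perronFrobenius f h‖ₑ := h1
    _ ≤ (weightedVariation (B.weightStep ρ w) h + C₂ * ‖h‖ₑ) + C₁ * ‖h‖ₑ := by
        gcongr
        exact B.enorm_perronFrobenius_le h
    _ = _ := by push_cast; ring

lemma exists_weightedVariation_iterate_le (hQ : IsPerturbationFamily Q)
    (hlocal : IsLocalFamily Q) (hregular : IsRegularFamily Q) {ρ : ℝ≥0} (hρ : 0 < ρ)
    (hgap : ∀ j : Fin B.n, 2 * ρ ≤ B.a j.succ - B.a j.castSucc) (N : ℕ) :
    ∃ C : ℝ≥0, ∀ ε ∈ Ioo (0 : ℝ) ρ, ∀ h ∈ BV ℝ,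
      variation ((perturbedOp f (Q ε))^[N] h)
        ≤ weightedVariation ((B.weightStep ρ)^[N] fun _ => 1) h + C * ‖h‖ₑ := by
  obtain ⟨D, hD⟩ := B.exists_weightStep_le
  have hbound : ∀ k : ℕ, ∀ x, (B.weightStep ρ)^[k] (fun _ => 1) x ≤ (D ^ k : ℝ≥0) := by
    intro k
    induction k with
    | zero => simp
    | succ k ih =>
      rw [Function.iterate_succ_apply', pow_succ']
      exact hD ρ _ _ ih
  induction N with
  | zero =>
    exact ⟨0, fun ε _ h _ => by simpa using variation_le_weightedVariation_one h⟩
  | succ N ih =>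
    obtain ⟨C₁, hC₁⟩ := ih
    obtain ⟨C₂, hC₂⟩ := B.exists_weightedVariation_perturbedOp_le hQ hlocal hregular (D ^ N) hρ hgap
    refine ⟨C₂ + C₁, fun ε hε h hh => ?_⟩
    rw [Function.iterate_succ_apply, Function.iterate_succ_apply' (B.weightStep ρ)]
    calc variation ((perturbedOp f (Q ε))^[N] (perturbedOp f (Q ε) h))
        ≤ weightedVariation ((B.weightStep ρ)^[N] fun _ => 1) (perturbedOp f (Q ε) h)
            + C₁ * ‖perturbedOp f (Q ε) h‖ₑ :=
          hC₁ ε hε _ (B.perturbedOp_mem_BV hregular hε.1 hh).2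
      _ ≤ (weightedVariation (B.weightStep ρ ((B.weightStep ρ)^[N] fun _ => 1)) h + C₂ * ‖h‖ₑ)
            + C₁ * ‖h‖ₑ := by
          gcongr
          · exact hC₂ _ (hbound N) ε hε h hh
          · exact B.enorm_perturbedOp_le hQ hε.1 h
      _ = _ := by push_cast; ring

end Branches

/-! ### The weights in the limit of small scales -/

open Classical in
/-- The factor `2` that is lost at turning points. -/
def turningFactor (f : I → I) (x : I) : ℝ≥0∞ := if x ∈ turningPoints f then 2 else 1

lemma one_le_turningFactor (f : I → I) (x : I) : 1 ≤ turningFactor f x := by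
  unfold turningFactor; split_ifs <;> norm_num

lemma turningFactor_ne_top (f : I → I) (x : I) : turningFactor f x ≠ ∞ := by
  unfold turningFactor; split_ifs <;> norm_num

lemma ENNReal.exists_lt_lt_mul_le {a b c M : ℝ≥0∞} (ha : a ≠ ∞) (hb : b ≠ ∞) (hc : c ≠ ∞)
    (h : c * (a * b) < M) : ∃ a' > a, ∃ b' > b, c * (a' * b') ≤ M := by
  have ht : Tendsto (fun p : ℝ≥0∞ × ℝ≥0∞ => c * (p.1 * p.2)) (𝓝 (a, b)) (𝓝 (c * (a * b))) :=
    ENNReal.Tendsto.const_mul (ENNReal.Tendsto.mul continuousAt_fst (Or.inr hb)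
      continuousAt_snd (Or.inr ha)) (Or.inr hc)
  have hle : 𝓝[>] a ×ˢ 𝓝[>] b ≤ 𝓝 (a, b) := by
    rw [nhds_prod_eq]; exact prod_mono nhdsWithin_le_nhds nhdsWithin_le_nhds
  have : (𝓝[>] a).NeBot := nhdsGT_neBot_of_exists_gt ⟨∞, ha.lt_top⟩
  have : (𝓝[>] b).NeBot := nhdsGT_neBot_of_exists_gt ⟨∞, hb.lt_top⟩
  have hev : ∀ᶠ p in 𝓝[>] a ×ˢ 𝓝[>] b, c * (p.1 * p.2) < M := hle (ht.eventually_lt_const h)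
  have hgt : ∀ᶠ p in 𝓝[>] a ×ˢ 𝓝[>] b, p ∈ Ioi a ×ˢ Ioi b :=
    prod_mem_prod self_mem_nhdsWithin self_mem_nhdsWithin
  obtain ⟨p, hp, hpa, hpb⟩ := (hev.and hgt).exists
  exact ⟨p.1, hpa, p.2, hpb, hp.le⟩

namespace Branches

variable {f : I → I} (B : Branches f)

/-- The limit of `weightStep ρ` as `ρ → 0`. -/
def limitStep (w : I → ℝ≥0∞) (x : I) : ℝ≥0∞ :=
  ⨆ (j : Fin B.n) (_ : (x : ℝ) ∈ B.dom j),
    turningFactor f x * (w (B.branch j x) * ‖(B.slope j x)⁻¹‖ₑ)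

lemma eventually_branch_close (x : I) {ε : ℝ} (hε : 0 < ε) :
    ∀ᶠ y : I in 𝓝 x, ∀ j, (y : ℝ) ∈ B.dom j → (x : ℝ) ∈ B.dom j ∧
      |B.F j y - B.F j x| < ε ∧ |B.slope j y - B.slope j x| < ε := by
  refine eventually_all.2 fun j => ?_
  by_cases hx : (x : ℝ) ∈ B.dom j
  · have h1 := Metric.tendsto_nhds.1 (B.continuousOn_F j x hx).tendsto ε hε
    have h2 := Metric.tendsto_nhds.1 (B.continuousOn_slope j x hx).tendsto ε hε
    have h3 := eventually_nhdsWithin_iff.1 (h1.and h2)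
    filter_upwards [continuous_subtype_val.continuousAt.eventually h3] with y hy hyj
    exact ⟨hx, hy hyj⟩
  · have : ∀ᶠ t : ℝ in 𝓝 (x : ℝ), t ∉ B.dom j :=
      (B.isCompact_dom j).isClosed.isOpen_compl.mem_nhds hx
    filter_upwards [continuous_subtype_val.continuousAt.eventually this] with y hy hyj
    exact absurd hyj hy

lemma eventually_cutFactor_le {f : I → I} (B : Branches f) (x : I) :
    ∀ᶠ r : ℝ in 𝓝[>] 0, ∀ ρ ∈ Ioo 0 r, ∀ y : I, |(y : ℝ) - x| < r →
      cutFactor f ρ y ≤ turningFactor f x := by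
  by_cases hx : x ∈ turningPoints f
  · refine Eventually.of_forall fun r ρ _ y _ => ?_
    rw [turningFactor, if_pos hx]; exact cutFactor_le_two _ _ _
  · have hopen : IsOpen (turningPoints f)ᶜ := B.finite_turningPoints.isClosed.isOpen_compl
    obtain ⟨d, hd, hball⟩ := Metric.isOpen_iff.1 hopen x hx
    filter_upwards [Ioo_mem_nhdsGT (half_pos hd)] with r hr ρ hρ y hy
    rw [turningFactor, if_neg hx, cutFactor, if_neg]
    rintro ⟨c, hc, hyc⟩
    refine hball (?_ : c ∈ Metric.ball x d) hc
    rw [Metric.mem_ball, Subtype.dist_eq, Real.dist_eq, abs_sub_comm]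
    have := abs_sub_le (x : ℝ) y c
    rw [abs_sub_comm (x : ℝ) y] at this
    linarith [hr.2, hρ.2]

lemma enorm_inv_slope_ne_zero {j : Fin B.n} {t : ℝ} (ht : t ∈ B.dom j) :
    ‖(B.slope j t)⁻¹‖ₑ ≠ 0 := by
  simpa using B.slope_ne_zero ht

/-- Upper semicontinuity: near `x` the iterated weights at small scales are at most slightly
larger than the limiting weight at `x`. -/
lemma eventually_iterate_weightStep_le (k : ℕ) : ∀ (x : I) (M : ℝ≥0∞),
    B.limitStep^[k] (fun _ => 1) x < M → ∀ᶠ r : ℝ in 𝓝[>] 0, ∀ ρ ∈ Ioo 0 r, ∀ y : I,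
      |(y : ℝ) - x| < r → (B.weightStep ρ)^[k] (fun _ => 1) y ≤ M := by
  induction k with
  | zero => exact fun x M hM => Eventually.of_forall fun r ρ _ y _ => hM.le
  | succ k ih =>
    intro x M hM
    rw [Function.iterate_succ_apply'] at hM
    have hj : ∀ j : Fin B.n, ∀ᶠ r : ℝ in 𝓝[>] 0, (x : ℝ) ∈ B.dom j → ∀ ρ ∈ Ioo 0 r, ∀ z : I,
        (z : ℝ) ∈ B.dom j → |(z : ℝ) - x| < 2 * r →
          turningFactor f x * (fatten ρ ((B.weightStep ρ)^[k] fun _ => 1) (B.branch j z) *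
            ‖(B.slope j z)⁻¹‖ₑ) ≤ M := by
      intro j
      by_cases hx : (x : ℝ) ∈ B.dom j
      swap
      · exact Eventually.of_forall fun r h => absurd h hx
      have hlt : turningFactor f x * (B.limitStep^[k] (fun _ => 1) (B.branch j x) *
          ‖(B.slope j x)⁻¹‖ₑ) < M :=
        lt_of_le_of_lt (le_iSup₂ (f := fun (j : Fin B.n) (_ : (x : ℝ) ∈ B.dom j) =>
          turningFactor f x * (B.limitStep^[k] (fun _ => 1) (B.branch j x) *
            ‖(B.slope j x)⁻¹‖ₑ)) j hx) hM
      have hne : B.limitStep^[k] (fun _ => 1) (B.branch j x) ≠ ∞ := by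
        intro htop
        rw [htop, ENNReal.top_mul (B.enorm_inv_slope_ne_zero hx), ENNReal.mul_top
          (one_pos.trans_le (one_le_turningFactor f x)).ne'] at hlt
        exact not_top_lt hlt
      -- The strict inequality leaves room to enlarge both the weight and the reciprocal slope.
      obtain ⟨a', ha', b', hb', hab⟩ := ENNReal.exists_lt_lt_mul_le hne enorm_ne_top
        (turningFactor_ne_top f x) hlt
      obtain ⟨r₁, hr₁, hr₁0⟩ := ((ih (B.branch j x) a' ha').and self_mem_nhdsWithin).exists
      have hr₁0' : (0 : ℝ) < r₁ := hr₁0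
      have hslope : ∀ᶠ t in 𝓝[B.dom j] (x : ℝ), ‖(B.slope j t)⁻¹‖ₑ < b' :=
        (((B.continuousOn_slope j x hx).inv₀ (B.slope_ne_zero hx)).tendsto.enorm).eventually_lt_const
          hb'
      have hF : ∀ᶠ t in 𝓝[B.dom j] (x : ℝ), |B.F j t - B.F j x| < r₁ / 2 :=
        Metric.tendsto_nhds.1 (B.continuousOn_F j x hx).tendsto _ (half_pos hr₁0')
      obtain ⟨d, hd, hdball⟩ := Metric.mem_nhdsWithin_iff.1 (hslope.and hF)
      have hd0 : 0 < min (d / 2) (r₁ / 8) := by positivity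
      filter_upwards [Ioo_mem_nhdsGT hd0] with r hr _ ρ hρ z hz hzx
      have hrd : r < d / 2 := hr.2.trans_le (min_le_left _ _)
      have hrr : r < r₁ / 8 := hr.2.trans_le (min_le_right _ _)
      obtain ⟨h1, h2⟩ := hdball (⟨by rw [Metric.mem_ball, Real.dist_eq]; linarith, hz⟩ :
        (z : ℝ) ∈ Metric.ball (x : ℝ) d ∩ B.dom j)
      refine le_trans (mul_le_mul_right (mul_le_mul' (iSup₂_le fun y hy => ?_) h1.le) _) hab
      refine hr₁ ρ ⟨hρ.1, by linarith [hρ.2]⟩ y ?_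
      rw [B.coe_branch hz] at hy
      rw [B.coe_branch hx]
      have := abs_sub_le (y : ℝ) (B.F j z) (B.F j x)
      rw [abs_sub_comm (y : ℝ) (B.F j z)] at this
      linarith [hρ.2]
    obtain ⟨d, hd, hdball⟩ := Metric.eventually_nhds_iff.1
      (B.eventually_branch_close x zero_lt_one)
    filter_upwards [eventually_all.2 hj, B.eventually_cutFactor_le x,
      Ioo_mem_nhdsGT (half_pos hd)] with r hr hcut hrd ρ hρ y hy
    rw [Function.iterate_succ_apply']
    refine iSup_le fun j => iSup₂_le fun z hz => ?_
    have hzx : |(z : ℝ) - x| < 2 * r := by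
      have := abs_sub_le (z : ℝ) y x
      rw [abs_sub_comm (z : ℝ) y] at this
      linarith [hz.2.2, hρ.2]
    have hxj : (x : ℝ) ∈ B.dom j := (hdball (y := z) (by
      rw [Subtype.dist_eq, Real.dist_eq]; linarith [hrd.2]) j hz.2.1).1
    exact (mul_le_mul_left (hcut ρ hρ y hy) _).trans (hr j hxj ρ hρ z hz.2.1 hzx)

lemma exists_forall_iterate_weightStep_le {N : ℕ} {M : ℝ≥0∞}
    (hM : ∀ x, B.limitStep^[N] (fun _ => 1) x < M) :
    ∀ᶠ r : ℝ in 𝓝[>] 0, ∀ ρ ∈ Ioo 0 r, ∀ x, (B.weightStep ρ)^[N] (fun _ => 1) x ≤ M := by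
  have := isCompact_univ.induction_on (X := I)
    (p := fun s => ∀ᶠ r : ℝ in 𝓝[>] 0, ∀ ρ ∈ Ioo 0 r, ∀ x ∈ s,
      (B.weightStep ρ)^[N] (fun _ => 1) x ≤ M) (by simp)
    (fun s t hst ht => ht.mono fun r hr ρ hρ x hx => hr ρ hρ x (hst hx))
    (fun s t hs ht => (hs.and ht).mono fun r hr ρ hρ x hx =>
      hx.elim (hr.1 ρ hρ x) (hr.2 ρ hρ x))
    (fun x _ => by
      obtain ⟨r₀, hr₀, hr₀0⟩ := ((B.eventually_iterate_weightStep_le N x M (hM x)).and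
        self_mem_nhdsWithin).exists
      refine ⟨Metric.ball x r₀, mem_nhdsWithin_of_mem_nhds (Metric.ball_mem_nhds x hr₀0), ?_⟩
      filter_upwards [Ioo_mem_nhdsGT hr₀0] with r hr ρ hρ y hy
      exact hr₀ ρ ⟨hρ.1, hρ.2.trans hr.2⟩ y hy)
  exact this.mono fun r hr ρ hρ x => hr ρ hρ x (mem_univ x)

/-! ### Paths of the two-valued map -/

/-- A path of length `N` of the two-valued map: at each step `x i` moves along the branch `j i`,
whose closed domain contains it. -/
def IsPath (x : ℕ → I) (j : ℕ → Fin B.n) (N : ℕ) : Prop :=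
  ∀ i < N, (x i : ℝ) ∈ B.dom (j i) ∧ x (i + 1) = B.branch (j i) (x i)

lemma iterate_limitStep_le (N : ℕ) : ∀ (x : I) (M : ℝ≥0∞),
    (∀ y j, y 0 = x → B.IsPath y j N →
      ∏ i ∈ Finset.range N, turningFactor f (y i) * ‖(B.slope (j i) (y i))⁻¹‖ₑ ≤ M) →
    B.limitStep^[N] (fun _ => 1) x ≤ M := by
  induction N with
  | zero =>
    intro x M h
    have hn : 0 < B.n := by
      obtain ⟨j, -⟩ := B.exists_mem_dom x
      exact j.pos
    simpa using h (fun _ => x) (fun _ => ⟨0, hn⟩) rfl (by intro i hi; omega)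
  | succ N ih =>
    intro x M h
    rw [Function.iterate_succ_apply']
    refine iSup₂_le fun k hk => ?_
    set c := turningFactor f x * ‖(B.slope k x)⁻¹‖ₑ with hc
    have hc0 : c ≠ 0 := mul_ne_zero (one_pos.trans_le (one_le_turningFactor f x)).ne'
      (B.enorm_inv_slope_ne_zero hk)
    have hct : c ≠ ∞ := ENNReal.mul_ne_top (turningFactor_ne_top f x) enorm_ne_top
    have h1 : B.limitStep^[N] (fun _ => 1) (B.branch k x) ≤ M / c := by
      refine ih _ _ fun y j hy hpath => ?_
      rw [ENNReal.le_div_iff_mul_le (Or.inl hc0) (Or.inl hct)]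
      have h2 := h (fun i => Nat.casesOn i x y) (fun i => Nat.casesOn i k j) rfl (by
        intro i hi
        cases i with
        | zero => exact ⟨hk, hy⟩
        | succ i => exact hpath i (by omega))
      rwa [Finset.prod_range_succ'] at h2
    calc turningFactor f x * (B.limitStep^[N] (fun _ => 1) (B.branch k x) * ‖(B.slope k x)⁻¹‖ₑ)
        = B.limitStep^[N] (fun _ => 1) (B.branch k x) * c := by rw [hc]; ring
      _ ≤ M / c * c := by gcongr
      _ ≤ M := by rw [ENNReal.div_mul_cancel hc0 hct]

end Branches

namespace Branches

variable {f : I → I} (B : Branches f)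

/-- Points of a branch that approach a given point of its closed domain without reaching it. -/
lemma exists_filter_inner {j : Fin B.n} {x : I} (hx : (x : ℝ) ∈ B.dom j) :
    ∃ l : Filter I, l.NeBot ∧ l ≤ 𝓝 x ∧ ∀ᶠ y : I in l, (y : ℝ) ∈ B.inner j ∧ y ≠ x := by
  set s : Set I := {y : I | (y : ℝ) ∈ B.inner j ∧ y ≠ x}
  refine ⟨𝓝[s] x, mem_closure_iff_nhdsWithin_neBot.1 ?_, nhdsWithin_le_nhds,
    eventually_mem_nhdsWithin⟩
  rw [Metric.mem_closure_iff]
  intro ε hε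
  have hlt := B.lt_succ j
  obtain ⟨t, ht, htx, hd⟩ : ∃ t ∈ B.inner j, t ≠ (x : ℝ) ∧ dist (x : ℝ) t < ε := by
    rcases lt_or_ge (x : ℝ) (B.a j.succ) with h | h
    · obtain ⟨t, ht1, ht2⟩ := exists_between (lt_min h (lt_add_of_pos_right (x : ℝ) hε))
      have := lt_min_iff.1 ht2
      refine ⟨t, ⟨hx.1.trans_lt ht1, this.1⟩, ht1.ne', ?_⟩
      rw [Real.dist_eq, abs_sub_comm, abs_of_pos (by linarith)]; linarith [this.2]
    · have hlt' : B.a j.castSucc < (x : ℝ) := hlt.trans_le h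
      obtain ⟨t, ht1, ht2⟩ := exists_between (max_lt hlt' (sub_lt_self (x : ℝ) hε))
      have := max_lt_iff.1 ht1
      refine ⟨t, ⟨this.1, ht2.trans_le hx.2⟩, ht2.ne, ?_⟩
      rw [Real.dist_eq, abs_of_pos (by linarith)]; linarith [this.2]
  exact ⟨⟨t, B.dom_subset j (B.inner_subset_dom j ht)⟩,
    ⟨ht, fun h => htx (congrArg Subtype.val h)⟩, by rwa [Subtype.dist_eq]⟩

lemma isImage_branch {j : Fin B.n} {x : I} (hx : (x : ℝ) ∈ B.dom j) :
    IsImage f x (B.branch j x) := by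
  obtain ⟨l, hl, hlx, hev⟩ := B.exists_filter_inner hx
  have hle : l ≤ 𝓝[≠] x := le_inf hlx (by
    rw [le_principal_iff]; exact hev.mono fun y hy => hy.2)
  refine MapClusterPt.mono (F := l) ?_ hle
  refine Tendsto.mapClusterPt ?_
  rw [tendsto_subtype_rng, B.coe_branch hx]
  have h1 : Tendsto (fun y : I => (y : ℝ)) l (𝓝[B.dom j] (x : ℝ)) :=
    tendsto_nhdsWithin_iff.2 ⟨(continuous_subtype_val.tendsto x).mono_left hlx,
      hev.mono fun y hy => B.inner_subset_dom j hy.1⟩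
  refine ((B.continuousOn_F j x hx).tendsto.comp h1).congr' ?_
  filter_upwards [hev] with y hy
  exact (B.eq_on_Ioo j y hy.1).symm

/-- The hypothesis that `1 / |(f^n)'| ≤ C r^n` at the points whose orbit up to time `n` avoids the
partition points. -/
def ExpansionBound (C r : ℝ) : Prop :=
  ∀ (n : ℕ) (x : I), (∀ i < n, (f^[i] x : ℝ) ∉ range B.a) →
    ∏ i ∈ Finset.range n, |deriv (realMap f) (f^[i] x : I)|⁻¹ ≤ C * r ^ n

/-- A path that meets turning points at most at its starting point is a limit of orbits of `f`
that avoid the partition points, together with its derivatives. -/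
lemma prod_inv_slope_le_of_notMem_turningPoints {C r : ℝ} (hC : B.ExpansionBound C r)
    {x : ℕ → I} {j : ℕ → Fin B.n} {N : ℕ} (hpath : B.IsPath x j N)
    (hx : ∀ i, 1 ≤ i → i < N → x i ∉ turningPoints f) :
    ∏ i ∈ Finset.range N, |B.slope (j i) (x i)|⁻¹ ≤ C * r ^ N := by
  rcases Nat.eq_zero_or_pos N with rfl | hN
  · have h := hC 0 (x 0) (by intro i hi; omega)
    simpa using h
  obtain ⟨l, hl, hlx, hev⟩ := B.exists_filter_inner (hpath 0 hN).1
  -- The orbit of `y` may run through branches `k` other than `j i`, but these agree at `x i`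
  -- up to first order, since `x i` is not a turning point.
  have key : ∀ i < N, Tendsto (fun y => f^[i] y) l (𝓝 (x i)) ∧ ∀ᶠ y in l, f^[i] y ≠ x i ∧
      ∃ k, (f^[i] y : ℝ) ∈ B.inner k ∧ (x i : ℝ) ∈ B.dom k ∧
        B.F k (x i) = B.F (j i) (x i) ∧ B.slope k (x i) = B.slope (j i) (x i) := by
    intro i
    induction i with
    | zero =>
      intro h0
      exact ⟨hlx, hev.mono fun y hy => ⟨hy.2, j 0, hy.1, (hpath 0 h0).1, rfl, rfl⟩⟩
    | succ i ih =>
      intro hi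
      obtain ⟨ih1, ih2⟩ := ih (by omega)
      obtain ⟨hxi, hxi1⟩ := hpath i (by omega)
      have hval : (x (i + 1) : ℝ) = B.F (j i) (x i) := by rw [hxi1, B.coe_branch hxi]
      have ht : Tendsto (fun y => f^[i + 1] y) l (𝓝 (x (i + 1))) := by
        rw [Metric.tendsto_nhds]
        intro ε hε
        filter_upwards [ih2, ih1.eventually (B.eventually_branch_close (x i) hε)]
          with y hy hclose
        obtain ⟨-, k, hk1, hk2, hk3, -⟩ := hy
        rw [Function.iterate_succ_apply', Subtype.dist_eq, Real.dist_eq, hval, ← hk3,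
          B.eq_on_Ioo k _ hk1]
        exact (hclose k (B.inner_subset_dom k hk1)).2.1
      have hne : ∀ᶠ y in l, f^[i + 1] y ≠ x (i + 1) := by
        filter_upwards [ih2] with y hy heq
        obtain ⟨hne, k, hk1, hk2, hk3, -⟩ := hy
        have h1 : B.F k (f^[i] y : I) = B.F k (x i) := by
          rw [hk3, ← hval, ← heq, Function.iterate_succ_apply', B.eq_on_Ioo k _ hk1]
        exact hne (Subtype.ext (B.injOn_F k (B.inner_subset_dom k hk1) hk2 h1))
      have hnt := hx (i + 1) (by omega) hi
      obtain ⟨hj1, hj2⟩ := B.eq_of_notMem_turningPoints hnt (hpath (i + 1) hi).1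
      have hcut : ∀ᶠ z : I in 𝓝 (x (i + 1)), z ≠ x (i + 1) → (z : ℝ) ∉ range B.a := by
        have hfin : (range B.a \ {(x (i + 1) : ℝ)}).Finite := (finite_range B.a).subset sdiff_subset
        have : ∀ᶠ t : ℝ in 𝓝 (x (i + 1) : ℝ), t ∉ range B.a \ {(x (i + 1) : ℝ)} :=
          hfin.isClosed.isOpen_compl.mem_nhds (by simp)
        filter_upwards [continuous_subtype_val.continuousAt.eventually this] with z hz hzx hza
        exact hz ⟨hza, fun h => hzx (Subtype.ext h)⟩
      refine ⟨ht, ?_⟩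
      filter_upwards [hne, ht.eventually hcut,
        ht.eventually (B.eventually_branch_close (x (i + 1)) one_pos)] with y hy1 hy2 hy3
      obtain ⟨k, hk⟩ := B.exists_mem_inner (hy2 hy1)
      have hk' := (hy3 k (B.inner_subset_dom k hk)).1
      obtain ⟨hk1, hk2⟩ := B.eq_of_notMem_turningPoints hnt hk'
      exact ⟨hy1, k, hk, hk', hk1.trans hj1.symm, hk2.trans hj2.symm⟩
  have hlim : Tendsto (fun y => ∏ i ∈ Finset.range N, |deriv (realMap f) (f^[i] y : I)|⁻¹) l
      (𝓝 (∏ i ∈ Finset.range N, |B.slope (j i) (x i)|⁻¹)) := by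
    refine tendsto_finsetProd _ fun i hi => ?_
    have hiN := Finset.mem_range.1 hi
    refine Tendsto.inv₀ (Tendsto.abs ?_)
      (abs_ne_zero.2 (B.slope_ne_zero (hpath i hiN).1))
    rw [Metric.tendsto_nhds]
    intro ε hε
    obtain ⟨h1, h2⟩ := key i hiN
    filter_upwards [h2, h1.eventually (B.eventually_branch_close (x i) hε)] with y hy hclose
    obtain ⟨-, k, hk1, hk2, -, hk4⟩ := hy
    rw [(B.eventually_eq_F hk1).deriv_eq, (B.hasDerivAt_F hk1).deriv, Real.dist_eq, ← hk4]
    exact (hclose k (B.inner_subset_dom k hk1)).2.2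
  refine le_of_tendsto hlim ?_
  have hall : ∀ᶠ y in l, ∀ i ∈ Finset.range N, (f^[i] y : ℝ) ∉ range B.a := by
    refine (Finset.eventually_all _).2 fun i hi => ?_
    filter_upwards [(key i (Finset.mem_range.1 hi)).2] with y hy hya
    obtain ⟨-, k, hk1, -⟩ := hy
    obtain ⟨m, hm⟩ := hya
    rw [← hm] at hk1
    have h1 := B.strictMono.lt_iff_lt.1 hk1.1
    have h2 := B.strictMono.lt_iff_lt.1 hk1.2
    rw [Fin.lt_def] at h1 h2
    simp at h1 h2
    omega
  filter_upwards [hall] with y hy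
  exact hC N y fun i hi => hy i (Finset.mem_range.2 hi)

lemma transGen_isImage {x : ℕ → I} {j : ℕ → Fin B.n} {N : ℕ} (hpath : B.IsPath x j N) {p q : ℕ}
    (hpq : p < q) (hq : q ≤ N) : Relation.TransGen (IsImage f) (x p) (x q) := by
  induction q, hpq using Nat.le_induction with
  | base =>
    obtain ⟨h1, h2⟩ := hpath p (by omega)
    rw [Nat.succ_eq_add_one, h2]
    exact Relation.TransGen.single (B.isImage_branch h1)
  | succ q hpq ih =>
    obtain ⟨h1, h2⟩ := hpath q (by omega)
    refine (ih (by omega)).tail ?_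
    rw [h2]
    exact B.isImage_branch h1

open Classical in
/-- Without periodic turning points a path meets each turning point at most once. -/
lemma card_turning_le (hPTP : periodicTurningPoints f = ∅) {x : ℕ → I} {j : ℕ → Fin B.n} {N : ℕ}
    (hpath : B.IsPath x j N) :
    ((Finset.range N).filter fun i => x i ∈ turningPoints f).card
      ≤ B.finite_turningPoints.toFinset.card := by
  refine Finset.card_le_card_of_injOn x (fun i hi => ?_) fun p hp q hq hpq => ?_
  · have := (Finset.mem_filter.1 hi).2
    simpa using this
  · have hp' := Finset.mem_filter.1 hp
    have hq' := Finset.mem_filter.1 hq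
    have key : ∀ p q, p < q → q < N → x p ∈ turningPoints f → x p ≠ x q := by
      intro p q hpq hq hp heq
      have h := B.transGen_isImage hpath hpq hq.le
      rw [← heq] at h
      have : x p ∈ periodicTurningPoints f := ⟨hp, h⟩
      rw [hPTP] at this
      exact this
    rcases lt_trichotomy p q with h | h | h
    · exact absurd hpq (key p q h (Finset.mem_range.1 hq'.1) hp'.2)
    · exact h
    · exact absurd hpq.symm (key q p h (Finset.mem_range.1 hp'.1) hq'.2)

open Classical in
/-- A path splits at its visits to turning points into segments that are limits of orbits. -/
lemma prod_inv_slope_le {C r : ℝ} (hC1 : 1 ≤ C) (hr : 0 ≤ r) (hC : B.ExpansionBound C r)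
    {x : ℕ → I} {j : ℕ → Fin B.n} (N : ℕ) (hpath : B.IsPath x j N) :
    ∏ i ∈ Finset.range N, |B.slope (j i) (x i)|⁻¹
      ≤ C ^ (((Finset.range N).filter fun i => x i ∈ turningPoints f).card + 1) * r ^ N := by
  have hC0 : 0 ≤ C := zero_le_one.trans hC1
  induction N using Nat.strong_induction_on with
  | _ N ih =>
    -- A visit at time `0` does no harm, so the path is cut at its last visit at a positive time.
    set S := (Finset.range N).filter fun i => 1 ≤ i ∧ x i ∈ turningPoints f with hS
    rcases S.eq_empty_or_nonempty with hSe | hSne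
    · refine (B.prod_inv_slope_le_of_notMem_turningPoints hC hpath fun i h1 hi hxi => ?_).trans ?_
      · have : i ∈ S := by simp [hS, h1, hi, hxi]
        rw [hSe] at this
        simp at this
      · gcongr
        exact le_self_pow₀ hC1 (by omega)
    · have hm := S.max'_mem hSne
      set m := S.max' hSne with hmdef
      obtain ⟨hmN, hm1, hmt⟩ := Finset.mem_filter.1 hm
      rw [Finset.mem_range] at hmN
      have h1 := ih m hmN fun i hi => hpath i (by omega)
      have h2 := B.prod_inv_slope_le_of_notMem_turningPoints hC (x := fun i => x (m + i))
        (j := fun i => j (m + i)) (N := N - m) (fun i hi => hpath (m + i) (by omega))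
        (fun i hi1 hi hxi => by
          have : m + i ∈ S := by
            simp only [hS, Finset.mem_filter, Finset.mem_range]
            exact ⟨by omega, by omega, hxi⟩
          have := S.le_max' _ this
          omega)
      have hcard : ((Finset.range m).filter fun i => x i ∈ turningPoints f).card + 1
          ≤ ((Finset.range N).filter fun i => x i ∈ turningPoints f).card := by
        rw [← Finset.card_insert_of_notMem (a := m) (by simp)]
        refine Finset.card_le_card fun i hi => ?_
        rcases Finset.mem_insert.1 hi with rfl | hi
        · exact Finset.mem_filter.2 ⟨Finset.mem_range.2 hmN, hmt⟩
        · obtain ⟨hi1, hi2⟩ := Finset.mem_filter.1 hi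
          exact Finset.mem_filter.2
            ⟨Finset.mem_range.2 ((Finset.mem_range.1 hi1).trans hmN), hi2⟩
      have hsplit : ∏ i ∈ Finset.range N, |B.slope (j i) (x i)|⁻¹
          = (∏ i ∈ Finset.range m, |B.slope (j i) (x i)|⁻¹)
            * ∏ i ∈ Finset.range (N - m), |B.slope (j (m + i)) (x (m + i))|⁻¹ := by
        rw [← Finset.prod_range_add (fun i => |B.slope (j i) (x i)|⁻¹), Nat.add_sub_of_le hmN.le]
      rw [hsplit]
      calc _ ≤ (C ^ (((Finset.range m).filter fun i => x i ∈ turningPoints f).card + 1) * r ^ m)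
            * (C * r ^ (N - m)) := by
            refine mul_le_mul h1 h2 (Finset.prod_nonneg fun i _ => by positivity) (by positivity)
        _ = C ^ (((Finset.range m).filter fun i => x i ∈ turningPoints f).card + 1 + 1)
            * (r ^ m * r ^ (N - m)) := by ring
        _ = C ^ (((Finset.range m).filter fun i => x i ∈ turningPoints f).card + 1 + 1) * r ^ N := by
            rw [← pow_add, Nat.add_sub_of_le hmN.le]
        _ ≤ _ := by
            gcongr

/-- Without periodic turning points the limiting weights decay at the rate `r`. -/
lemma exists_iterate_limitStep_le (hPTP : periodicTurningPoints f = ∅) {C r : ℝ} (hr : 0 ≤ r)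
    (hC : B.ExpansionBound C r) :
    ∃ K : ℝ, 0 ≤ K ∧ ∀ N x, B.limitStep^[N] (fun _ => 1) x ≤ ENNReal.ofReal (K * r ^ N) := by
  classical
  set C' := max C 1
  have hC' : B.ExpansionBound C' r := fun n x hx =>
    (hC n x hx).trans (by gcongr; exact le_max_left _ _)
  have hC1 : 1 ≤ C' := le_max_right _ _
  set T := B.finite_turningPoints.toFinset.card
  refine ⟨2 ^ T * C' ^ (T + 1), by positivity, fun N x =>
    B.iterate_limitStep_le N x _ fun y j _ hpath => ?_⟩
  have hcard := B.card_turning_le hPTP hpath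
  set V := (Finset.range N).filter fun i => y i ∈ turningPoints f with hV
  have h1 : ∏ i ∈ Finset.range N, turningFactor f (y i) = 2 ^ V.card := by
    simp only [turningFactor]
    rw [Finset.prod_ite, Finset.prod_const, Finset.prod_const_one, mul_one]
  have h2 : ∏ i ∈ Finset.range N, ‖(B.slope (j i) (y i))⁻¹‖ₑ
      = ENNReal.ofReal (∏ i ∈ Finset.range N, |B.slope (j i) (y i)|⁻¹) := by
    rw [ENNReal.ofReal_prod_of_nonneg fun i _ => by positivity]
    refine Finset.prod_congr rfl fun i _ => ?_
    rw [← ofReal_norm, norm_inv, Real.norm_eq_abs]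
  rw [Finset.prod_mul_distrib, h1, h2, mul_assoc, ENNReal.ofReal_mul (by positivity)]
  refine mul_le_mul' ?_ (ENNReal.ofReal_le_ofReal ?_)
  · rw [ENNReal.ofReal_pow zero_le_two, ENNReal.ofReal_ofNat]
    gcongr
    exact one_le_two
  · refine (B.prod_inv_slope_le hC1 hr hC' N hpath).trans ?_
    gcongr

end Branches

/-! ### Quasi-compact operators -/

/-- A bijection of `U` restricts to a bijection of each invariant subspace of finite codimension:
it acts on the finite-dimensional quotient as a surjection, hence as an injection. -/
lemma bijOn_of_cofg {X : Type*} [AddCommGroup X] [Module ℂ X] {A : X →ₗ[ℂ] X}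
    {U W : Submodule ℂ X} (hU : BijOn A U U) (hWU : W ≤ U) (hW : MapsTo A W W) (hfin : W.CoFG) :
    BijOn A W W := by
  refine ⟨hW, hU.injOn.mono hWU, fun w hw => ?_⟩
  obtain ⟨u, hu, rfl⟩ := hU.surjOn (hWU hw)
  refine ⟨u, ?_, rfl⟩
  have hWA : W ≤ W.comap A := fun x hx => hW hx
  let Ab : X ⧸ W →ₗ[ℂ] X ⧸ W := W.mapQ W A hWA
  have hAb : ∀ y ∈ U.map W.mkQ, Ab y ∈ U.map W.mkQ := by
    rintro _ ⟨x, hx, rfl⟩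
    exact ⟨A x, hU.mapsTo hx, rfl⟩
  have hfin' : FiniteDimensional ℂ (X ⧸ W) := hfin
  have hsurj : Function.Surjective (Ab.restrict hAb) := by
    rintro ⟨_, x, hx, rfl⟩
    obtain ⟨y, hy, rfl⟩ := hU.surjOn hx
    exact ⟨⟨W.mkQ y, y, hy, rfl⟩, rfl⟩
  have hinj := LinearMap.injective_iff_surjective.2 hsurj
  have h0 : (⟨W.mkQ u, u, hu, rfl⟩ : U.map W.mkQ) = 0 := by
    refine hinj ?_
    rw [map_zero]
    refine Subtype.ext ?_
    change W.mkQ (A u) = 0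
    simpa using hw
  have h1 : W.mkQ u = 0 := congrArg Subtype.val h0
  simpa using h1

/-- The complement of a generalized eigenspace of finite dimension is closed, being the range of
a power of the operator. -/
lemma isClosed_of_nilpotent_of_bijOn {X : Type*} [NormedAddCommGroup X] [NormedSpace ℂ X]
    [CompleteSpace X] {A : X →L[ℂ] X} {E W : Submodule ℂ X} [FiniteDimensional ℂ E]
    (hEW : IsCompl E W) {k : ℕ} (hE : ∀ h ∈ E, (A ^ k) h = 0) (hW : BijOn A W W) :
    IsClosed (W : Set X) := by
  have hWk : BijOn (A ^ k : X →L[ℂ] X) W W := by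
    have := hW.iterate k
    rwa [← FunLike.coe_pow_eq_iterate] at this
  have hEclosed : IsClosed (E : Set X) := E.closed_of_finiteDimensional
  have hle : E ≤ (A ^ k).ker := fun h hh => hE h hh
  have hdecomp : ∀ x, ∃ e ∈ E, ∃ w ∈ W, e + w = x := fun x => by
    have : x ∈ E ⊔ W := by rw [hEW.sup_eq_top]; trivial
    exact Submodule.mem_sup.1 this
  let g : X ⧸ E →L[ℂ] X := E.liftQL (A ^ k) hle
  have hgmk : ∀ x, g (E.mkQ x) = (A ^ k) x := fun x => rfl
  have hrange : g.range = W := by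
    ext y
    constructor
    · rintro ⟨q, rfl⟩
      obtain ⟨x, rfl⟩ := E.mkQ_surjective q
      obtain ⟨e, he, w, hw, rfl⟩ := hdecomp x
      have : g (E.mkQ (e + w)) = (A ^ k) w := by rw [hgmk, map_add, hE e he, zero_add]
      exact (congrArg (· ∈ W) this).mpr (hWk.mapsTo hw)
    · intro hy
      obtain ⟨w, hw, rfl⟩ := hWk.surjOn hy
      exact ⟨E.mkQ w, hgmk w⟩
  have hker : g.ker = ⊥ := by
    rw [LinearMap.ker_eq_bot']
    intro q hq
    obtain ⟨x, rfl⟩ := E.mkQ_surjective q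
    obtain ⟨e, he, w, hw, rfl⟩ := hdecomp x
    have h1 : (A ^ k) w = 0 := by
      have : g (E.mkQ (e + w)) = 0 := hq
      rwa [hgmk, map_add, hE e he, zero_add] at this
    have h2 : w = 0 := hWk.injOn hw W.zero_mem (by rw [h1, map_zero])
    rw [h2, add_zero]
    simpa using he
  have := g.closed_complemented_range_of_isCompl_of_ker_eq_bot E (by rw [hrange]; exact hEW.symm)
    hEclosed hker
  rwa [hrange] at this

/-- If the spectrum of `T` outside the disk of radius `r` consists of isolated eigenvalues of
finite multiplicity, then `T^n` is of order `r'^n`, for any `r' > r`, on a subspace of finite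
codimension. -/
theorem exists_cofg_norm_pow_le {X : Type*} [NormedAddCommGroup X] [NormedSpace ℂ X]
    [CompleteSpace X] (T : X →L[ℂ] X) {r : ℝ}
    (H : ∀ z ∈ spectrum ℂ T, r ≤ ‖z‖ →
      (∃ δ > 0, ∀ w ∈ spectrum ℂ T, dist w z < δ → w = z) ∧
      ∃ E W : Submodule ℂ X, FiniteDimensional ℂ E ∧ IsCompl E W ∧
        (∃ k : ℕ, ∀ h ∈ E, ((T - algebraMap ℂ (X →L[ℂ] X) z) ^ k) h = 0) ∧
        BijOn (T - algebraMap ℂ (X →L[ℂ] X) z : X →L[ℂ] X) (W : Set X) (W : Set X))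
    (hr : 0 < r) {r' : ℝ} (hr' : r < r') :
    ∃ W : Submodule ℂ X, W.CoFG ∧ ∃ C : ℝ, 0 ≤ C ∧ ∀ (n : ℕ), ∀ h ∈ W,
      ‖(T ^ n) h‖ ≤ C * r' ^ n * ‖h‖ := by
  set S : Set ℂ := spectrum ℂ T ∩ {z | r ≤ ‖z‖} with hS
  -- `S` is compact and discrete.
  have hSfin : S.Finite := by
    have hSc : IsCompact S := (spectrum.isCompact T).inter_right
      (isClosed_le continuous_const continuous_norm)
    have := hSc.induction_on (p := fun s => (s ∩ S).Finite) (by simp)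
      (fun s t hst ht => ht.subset (inter_subset_inter_left _ hst))
      (fun s t hs ht => by rw [union_inter_distrib_right]; exact hs.union ht)
      (fun z hz => by
        obtain ⟨⟨δ, hδ, hiso⟩, -⟩ := H z hz.1 hz.2
        refine ⟨Metric.ball z δ, mem_nhdsWithin_of_mem_nhds (Metric.ball_mem_nhds z hδ), ?_⟩
        exact (finite_singleton z).subset fun w hw => hiso w hw.2.1 hw.1)
    rwa [inter_self] at this
  choose! E Wz hEfin hcompl hnil hbij using fun z (hz : z ∈ S) => (H z hz.1 hz.2).2
  set W : Submodule ℂ X := sInf (Wz '' S) with hW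
  have hWle : ∀ z ∈ S, W ≤ Wz z := fun z hz => sInf_le (mem_image_of_mem _ hz)
  have hcofg : W.CoFG := by
    refine Submodule.CoFG.sInf_of_finite (hSfin.image _) ?_
    rintro _ ⟨z, hz, rfl⟩
    have := hEfin z hz
    exact Submodule.FG.cofg_of_isCompl (hcompl z hz) (Module.Finite.iff_fg.1 this)
  have hclosed : IsClosed (W : Set X) := by
    rw [hW, Submodule.coe_sInf]
    refine isClosed_biInter ?_
    rintro _ ⟨z, hz, rfl⟩
    have := hEfin z hz
    obtain ⟨k, hk⟩ := hnil z hz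
    exact isClosed_of_nilpotent_of_bijOn (hcompl z hz) hk (hbij z hz)
  have hTW : ∀ h ∈ W, T h ∈ W := by
    intro h hh
    rw [hW, Submodule.mem_sInf]
    rintro _ ⟨z, hz, rfl⟩
    have h1 := (hbij z hz).mapsTo (hWle z hz hh)
    have h2 : T h = (T - algebraMap ℂ (X →L[ℂ] X) z) h + z • h := by
      simp [Algebra.algebraMap_eq_smul_one]
    rw [h2]
    exact add_mem h1 ((Wz z).smul_mem z (hWle z hz hh))
  have hmaps : ∀ z : ℂ, MapsTo (T - algebraMap ℂ (X →L[ℂ] X) z : X →L[ℂ] X) (W : Set X) (W : Set X) := fun z h hh => by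
    have : (T - algebraMap ℂ (X →L[ℂ] X) z) h = T h - z • h := by
      simp [Algebra.algebraMap_eq_smul_one]
    rw [SetLike.mem_coe, this]
    exact sub_mem (hTW h hh) (W.smul_mem z hh)
  -- No point outside the disk of radius `r` belongs to the spectrum of the restriction to `W`.
  have hbijW : ∀ z : ℂ, r ≤ ‖z‖ → BijOn (T - algebraMap ℂ (X →L[ℂ] X) z : X →L[ℂ] X) (W : Set X) (W : Set X) := by
    intro z hz
    by_cases hzS : z ∈ spectrum ℂ T
    · exact bijOn_of_cofg (A := ((T - algebraMap ℂ (X →L[ℂ] X) z : X →L[ℂ] X) : X →ₗ[ℂ] X))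
        (hbij z ⟨hzS, hz⟩) (hWle z ⟨hzS, hz⟩) (hmaps z) hcofg
    · have hu := spectrum.notMem_iff.1 hzS
      have hu' : IsUnit (T - algebraMap ℂ (X →L[ℂ] X) z) := by
        rw [← neg_sub]; exact hu.neg
      have hb := ContinuousLinearMap.isUnit_iff_bijective.1 hu'
      refine bijOn_of_cofg (A := ((T - algebraMap ℂ (X →L[ℂ] X) z : X →L[ℂ] X) : X →ₗ[ℂ] X))
        (U := ⊤) ?_ le_top (hmaps z) hcofg
      rw [Submodule.top_coe]
      exact bijOn_univ.2 hb
  have : CompleteSpace W := hclosed.completeSpace_coe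
  let TW : W →L[ℂ] W := (T.comp W.subtypeL).codRestrict W fun h => hTW h h.2
  have hTWpow : ∀ (n : ℕ) (h : W), (((TW ^ n) h : W) : X) = (T ^ n) h := by
    intro n
    induction n with
    | zero => intro h; rfl
    | succ n ih =>
      intro h
      rw [pow_succ, pow_succ, mul_apply_eq_comp, mul_apply_eq_comp, ih]
      rfl
  have hspec : spectralRadius ℂ TW ≤ ENNReal.ofReal r := by
    refine iSup₂_le fun z hz => ?_
    by_contra! hlt
    refine hz ?_
    have hrz : r ≤ ‖z‖ := by
      rw [← enorm_eq_nnnorm, ← ofReal_norm] at hlt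
      exact (ENNReal.ofReal_lt_ofReal_iff_of_nonneg hr.le).1 hlt |>.le
    have hb := hbijW z hrz
    have hval : ∀ h : W, (((TW - algebraMap ℂ (W →L[ℂ] W) z) h : W) : X)
        = (T - algebraMap ℂ (X →L[ℂ] X) z) h := by
      intro h
      simp [Algebra.algebraMap_eq_smul_one, TW]
      rfl
    have hu : IsUnit (TW - algebraMap ℂ (W →L[ℂ] W) z) := by
      refine ContinuousLinearMap.isUnit_iff_bijective.2 ⟨fun g h hgh => ?_, fun y => ?_⟩
      · refine Subtype.ext (hb.injOn g.2 h.2 ?_)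
        rw [← hval, ← hval, hgh]
      · obtain ⟨x, hx, hxy⟩ := hb.surjOn y.2
        exact ⟨⟨x, hx⟩, Subtype.ext ((hval _).trans hxy)⟩
    have := hu.neg
    rwa [neg_sub] at this
  have hr'0 : 0 < r' := hr.trans hr'
  -- The spectral radius formula for the restriction to the Banach space `W`.
  have hgelfand := (spectrum.pow_nnnorm_pow_one_div_tendsto_nhds_spectralRadius
    TW).eventually_lt_const (hspec.trans_lt ((ENNReal.ofReal_lt_ofReal_iff hr'0).2 hr'))
  obtain ⟨N, hN⟩ := eventually_atTop.1 (hgelfand.and (eventually_ge_atTop 1))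
  have hlarge : ∀ n, N ≤ n → ‖TW ^ n‖ ≤ r' ^ n := by
    intro n hn
    obtain ⟨h1, h2⟩ := hN n hn
    have h3 := ENNReal.pow_le_pow_left (n := n) h1.le
    rw [← ENNReal.rpow_natCast, ← ENNReal.rpow_mul, one_div, inv_mul_cancel₀
      (by exact_mod_cast (by omega : n ≠ 0)), ENNReal.rpow_one, ← ENNReal.ofReal_pow hr'0.le,
      ← enorm_eq_nnnorm, ← ofReal_norm] at h3
    exact (ENNReal.ofReal_le_ofReal_iff (by positivity)).1 h3
  set C : ℝ := 1 + ∑ n ∈ Finset.range N, ‖TW ^ n‖ / r' ^ n with hC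
  have hC0 : 0 ≤ ∑ n ∈ Finset.range N, ‖TW ^ n‖ / r' ^ n :=
    Finset.sum_nonneg fun i _ => by positivity
  refine ⟨W, hcofg, C, by positivity, fun n h hh => ?_⟩
  have hn : ‖TW ^ n‖ ≤ C * r' ^ n := by
    rcases lt_or_ge n N with hlt | hge
    · have := Finset.single_le_sum (f := fun n => ‖TW ^ n‖ / r' ^ n) (s := Finset.range N)
        (fun i _ => by positivity) (Finset.mem_range.2 hlt)
      rw [← div_le_iff₀ (by positivity)]
      linarith
    · refine (hlarge n hge).trans (le_mul_of_one_le_left (by positivity) (by linarith))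
  rw [← hTWpow n ⟨h, hh⟩]
  calc ‖(((TW ^ n) ⟨h, hh⟩ : W) : X)‖ ≤ ‖TW ^ n‖ * ‖(⟨h, hh⟩ : W)‖ := (TW ^ n).le_opNorm _
    _ ≤ C * r' ^ n * ‖h‖ := by gcongr; exact le_rfl

/-! ### The Banach space of complex functions of bounded variation -/

/-- The test functions in the definition of the variation of a complex function. -/
def VariationTest : Type :=
  {φ : ℝ → ℂ // ContDiff ℝ 1 φ ∧ HasCompactSupport φ ∧ ∀ t, ‖φ t‖ ≤ 1}

/-- The pairing `h ↦ ∫ φ' h` of integrable functions with the derivative of a test function. -/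
def VariationTest.pairing (φ : VariationTest) : L1 ℂ →L[ℂ] ℂ :=
  have hK : ∃ K : ℝ≥0, LipschitzWith K φ.1 :=
    ⟨_, (φ.2.1.lipschitzWith_of_hasCompactSupport φ.2.2.1 one_ne_zero).choose_spec⟩
  LinearMap.mkContinuous
    { toFun := fun h => ∫ x : I, deriv φ.1 (x : ℝ) * h x
      map_add' := fun g h => by
        obtain ⟨K, hK⟩ := hK
        rw [← integral_add (integrable_deriv_mul hK g) (integrable_deriv_mul hK h)]
        refine integral_congr_ae ?_
        filter_upwards [Lp.coeFn_add g h] with x hx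
        rw [hx, Pi.add_apply, mul_add]
      map_smul' := fun c h => by
        rw [RingHom.id_apply, smul_eq_mul, ← integral_const_mul]
        refine integral_congr_ae ?_
        filter_upwards [Lp.coeFn_smul c h] with x hx
        rw [hx, Pi.smul_apply, smul_eq_mul]
        ring }
    hK.choose fun h => by
      rw [L1.norm_eq_integral_norm, ← integral_const_mul]
      refine norm_integral_le_of_norm_le ((L1.integrable_coeFn h).norm.const_mul _)
        (ae_of_all _ fun x => ?_)
      rw [norm_mul]
      gcongr
      exact norm_deriv_le_of_lipschitz hK.choose_spec

lemma variation_eq_iSup_pairing (h : L1 ℂ) : variation h = ⨆ φ : VariationTest, ‖φ.pairing h‖ₑ := by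
  rw [variation, iSup_subtype']
  rfl

/-- The graph of the map that sends a function `h` of bounded variation to the bounded family of
its pairings with test functions. -/
def bvGraph : Submodule ℂ (L1 ℂ × lp (fun _ : VariationTest => ℂ) ∞) where
  carrier := {p | ∀ φ : VariationTest, p.2 φ = φ.pairing p.1}
  add_mem' := fun {p q} hp hq φ => by
    rw [Prod.snd_add, lp.coeFn_add, Pi.add_apply, hp φ, hq φ, Prod.fst_add, map_add]
  zero_mem' := fun φ => by simp
  smul_mem' := fun c p hp φ => by
    rw [Prod.smul_snd, lp.coeFn_smul, Pi.smul_apply, hp φ, Prod.smul_fst, map_smul]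

/-- The functions of bounded variation as a Banach space, whose norm is the maximum of the `L¹`
norm and the variation. It is encoded as the closed subspace `bvGraph`. -/
def BVSpace : Type := bvGraph

namespace BVSpace

instance : NormedAddCommGroup BVSpace := inferInstanceAs (NormedAddCommGroup bvGraph)

instance : NormedSpace ℂ BVSpace := inferInstanceAs (NormedSpace ℂ bvGraph)

instance : CompleteSpace BVSpace := by
  have h1 : (bvGraph : Set (L1 ℂ × lp (fun _ : VariationTest => ℂ) ∞))
      = ⋂ φ : VariationTest, {p | p.2 φ = φ.pairing p.1} := by
    ext p; simp only [mem_iInter]; rfl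
  have h2 : IsClosed (bvGraph : Set (L1 ℂ × lp (fun _ : VariationTest => ℂ) ∞)) := by
    rw [h1]
    refine isClosed_iInter fun φ => isClosed_eq ?_ (φ.pairing.continuous.comp continuous_fst)
    exact (lp.evalCLM ℂ _ ∞ φ).continuous.comp continuous_snd
  exact h2.completeSpace_coe

/-- The underlying integrable function. -/
def toL1 : BVSpace →L[ℂ] L1 ℂ := (ContinuousLinearMap.fst ℂ _ _).comp bvGraph.subtypeL

lemma pairing_toL1 (p : BVSpace) (φ : VariationTest) : φ.pairing (toL1 p) = p.1.2 φ := (p.2 φ).symm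

lemma toL1_injective : Function.Injective toL1 := fun p q hpq => by
  refine Subtype.ext (Prod.ext hpq (lp.ext (funext fun φ => ?_)))
  rw [← pairing_toL1, ← pairing_toL1, hpq]

lemma variation_toL1_le (p : BVSpace) : variation (toL1 p) ≤ ‖p‖ₑ := by
  rw [variation_eq_iSup_pairing]
  refine iSup_le fun φ => ?_
  rw [pairing_toL1, enorm_le_iff_norm_le]
  exact (lp.norm_apply_le_norm ENNReal.top_ne_zero p.1.2 φ).trans (le_max_right _ _)

lemma toL1_mem_BV (p : BVSpace) : toL1 p ∈ BV ℂ := (variation_toL1_le p).trans_lt enorm_lt_top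

lemma norm_le {p : BVSpace} {M : ℝ≥0} (h1 : ‖toL1 p‖ ≤ M) (h2 : variation (toL1 p) ≤ M) :
    ‖p‖ ≤ M := by
  refine max_le h1 (lp.norm_le_of_forall_le M.2 fun φ => ?_)
  rw [variation_eq_iSup_pairing] at h2
  have := (le_iSup (fun φ : VariationTest => ‖φ.pairing (toL1 p)‖ₑ) φ).trans h2
  rw [pairing_toL1, enorm_eq_nnnorm, ENNReal.coe_le_coe] at this
  exact this

lemma exists_toL1_eq {h : L1 ℂ} (hh : h ∈ BV ℂ) : ∃ p : BVSpace, toL1 p = h := by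
  have hb : ∀ φ : VariationTest, ‖φ.pairing h‖ ≤ (variation h).toReal := fun φ => by
    have := le_iSup (fun φ : VariationTest => ‖φ.pairing h‖ₑ) φ
    rw [← variation_eq_iSup_pairing] at this
    have := ENNReal.toReal_mono (ne_of_lt hh) this
    simpa using this
  have hmem : Memℓp (fun φ : VariationTest => φ.pairing h) ∞ :=
    memℓp_infty ⟨_, by rintro _ ⟨φ, rfl⟩; exact hb φ⟩
  exact ⟨⟨(h, ⟨_, hmem⟩), fun φ => rfl⟩, rfl⟩

/-- A bounded operator on `L¹` that preserves bounded variation is automatically bounded for the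
variation norm, by the closed graph theorem. -/
lemma exists_restrict (T : L1 ℂ →L[ℂ] L1 ℂ) (hT : MapsTo T (BV ℂ) (BV ℂ)) :
    ∃ S : BVSpace →L[ℂ] BVSpace, ∀ p, toL1 (S p) = T (toL1 p) := by
  choose g hg using fun p : BVSpace => exists_toL1_eq (hT (toL1_mem_BV p))
  let S : BVSpace →ₗ[ℂ] BVSpace :=
    { toFun := g
      map_add' := fun p q => toL1_injective (by rw [map_add, hg, hg, hg, map_add, map_add])
      map_smul' := fun c p => toL1_injective (by
        rw [RingHom.id_apply, map_smul, hg, hg, map_smul, map_smul]) }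
  have hS : ∀ p, toL1 (S p) = T (toL1 p) := hg
  refine ⟨⟨S, S.continuous_of_seq_closed_graph fun u x y hu hSu => toL1_injective ?_⟩, hS⟩
  have h1 : Tendsto (fun n => toL1 (S (u n))) atTop (𝓝 (toL1 y)) :=
    (toL1.continuous.tendsto y).comp hSu
  have h2 : Tendsto (fun n => toL1 (S (u n))) atTop (𝓝 (toL1 (S x))) := by
    simp only [hS]
    exact ((T.continuous.comp toL1.continuous).tendsto x).comp hu
  exact tendsto_nhds_unique h1 h2

section Spectrum

variable {T : L1 ℂ → L1 ℂ} {S : BVSpace →L[ℂ] BVSpace}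

lemma toL1_sub_algebraMap (hS : ∀ p, toL1 (S p) = T (toL1 p)) (z : ℂ) (p : BVSpace) :
    toL1 ((S - algebraMap ℂ (BVSpace →L[ℂ] BVSpace) z) p) = T (toL1 p) - z • toL1 p := by
  simp [Algebra.algebraMap_eq_smul_one, hS]

lemma bijOn_comap_iff (hS : ∀ p, toL1 (S p) = T (toL1 p)) (z : ℂ) {V : Set (L1 ℂ)}
    (hV : V ⊆ BV ℂ) :
    BijOn (S - algebraMap ℂ (BVSpace →L[ℂ] BVSpace) z : BVSpace →L[ℂ] BVSpace)
      (toL1 ⁻¹' V) (toL1 ⁻¹' V) ↔ BijOn (fun h => T h - z • h) V V := by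
  have hA := toL1_sub_algebraMap hS z
  have him : toL1 '' (toL1 ⁻¹' V) = V :=
    image_preimage_eq_of_subset fun h hh => exists_toL1_eq (hV hh)
  have hbij : BijOn toL1 (toL1 ⁻¹' V) V := by
    have := (toL1_injective.injOn (s := toL1 ⁻¹' V)).bijOn_image
    rwa [him] at this
  constructor
  · intro h
    refine ⟨fun g hg => ?_, fun g hg g' hg' hgg => ?_, fun g hg => ?_⟩
    · obtain ⟨p, hp, rfl⟩ := hbij.surjOn hg
      have := h.mapsTo hp
      rwa [mem_preimage, hA] at this
    · obtain ⟨p, hp, rfl⟩ := hbij.surjOn hg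
      obtain ⟨q, hq, rfl⟩ := hbij.surjOn hg'
      exact congrArg toL1 (h.injOn hp hq (toL1_injective (by rw [hA, hA]; exact hgg)))
    · obtain ⟨p, hp, rfl⟩ := hbij.surjOn hg
      obtain ⟨q, hq, rfl⟩ := h.surjOn hp
      exact ⟨toL1 q, hq, (hA q).symm⟩
  · intro h
    refine ⟨fun p hp => ?_, fun p hp q hq hpq => ?_, fun p hp => ?_⟩
    · rw [mem_preimage, hA]; exact h.mapsTo hp
    · refine toL1_injective (h.injOn hp hq ?_)
      have := congrArg toL1 hpq
      rwa [hA, hA] at this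
    · obtain ⟨g, hg, hgp⟩ := h.surjOn hp
      obtain ⟨q, hq, rfl⟩ := hbij.surjOn hg
      exact ⟨q, hq, toL1_injective ((hA q).trans hgp)⟩

lemma mem_spectrum_iff (hS : ∀ p, toL1 (S p) = T (toL1 p)) (z : ℂ) :
    z ∈ spectrum ℂ S ↔ z ∈ spectrumBV T := by
  have h1 : toL1 ⁻¹' (BV ℂ) = univ := eq_univ_of_forall toL1_mem_BV
  rw [spectrumBV, mem_ofPred_eq, ← bijOn_comap_iff hS z subset_rfl, h1, bijOn_univ,
    spectrum.mem_iff, not_iff_not, ← ContinuousLinearMap.isUnit_iff_bijective, ← neg_sub,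
    IsUnit.neg_iff]

lemma toL1_iterate (hS : ∀ p, toL1 (S p) = T (toL1 p)) (n : ℕ) (p : BVSpace) :
    toL1 ((S ^ n) p) = T^[n] (toL1 p) := by
  induction n generalizing p with
  | zero => rfl
  | succ n ih => rw [pow_succ, mul_apply_eq_comp, ih, hS]; rfl

/-- An isolated eigenvalue of finite multiplicity in the sense of functions of bounded variation
splits the Banach space. -/
lemma exists_isCompl_of_isIsolatedEigenvalueBV (hS : ∀ p, toL1 (S p) = T (toL1 p)) {z : ℂ}
    (hz : IsIsolatedEigenvalueBV T z) :
    ∃ E W : Submodule ℂ BVSpace, FiniteDimensional ℂ E ∧ IsCompl E W ∧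
      (∃ k : ℕ, ∀ p ∈ E, ((S - algebraMap ℂ (BVSpace →L[ℂ] BVSpace) z) ^ k) p = 0) ∧
      BijOn (S - algebraMap ℂ (BVSpace →L[ℂ] BVSpace) z : BVSpace →L[ℂ] BVSpace)
        (W : Set BVSpace) (W : Set BVSpace) := by
  obtain ⟨-, -, -, E, W, hfin, hdisj, hsup, -, ⟨k, hk⟩, hbij⟩ := hz
  have hWBV : (W : Set (L1 ℂ)) ⊆ BV ℂ := by
    rw [← hsup]; exact SetLike.coe_subset_coe.2 le_sup_right
  have hEBV : (E : Set (L1 ℂ)) ⊆ BV ℂ := by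
    rw [← hsup]; exact SetLike.coe_subset_coe.2 le_sup_left
  let ι : BVSpace →ₗ[ℂ] L1 ℂ := (toL1 : BVSpace →ₗ[ℂ] L1 ℂ)
  refine ⟨E.comap ι, W.comap ι, ?_, ⟨?_, ?_⟩, ⟨k, fun p hp => ?_⟩, ?_⟩
  · let e : E.comap ι →ₗ[ℂ] E := ι.restrict fun p hp => hp
    refine FiniteDimensional.of_injective e fun p q hpq => Subtype.ext (toL1_injective ?_)
    exact congrArg Subtype.val hpq
  · rw [Submodule.disjoint_def] at hdisj ⊢
    intro p hpE hpW
    exact toL1_injective ((hdisj _ hpE hpW).trans (map_zero toL1).symm)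
  · rw [codisjoint_iff, eq_top_iff]
    intro p _
    have hp : toL1 p ∈ E ⊔ W := by
      rw [← SetLike.mem_coe, hsup]; exact toL1_mem_BV p
    obtain ⟨e, he, w, hw, hew⟩ := Submodule.mem_sup.1 hp
    obtain ⟨p₁, rfl⟩ := exists_toL1_eq (hEBV he)
    obtain ⟨p₂, rfl⟩ := exists_toL1_eq (hWBV hw)
    exact Submodule.mem_sup.2 ⟨p₁, he, p₂, hw, toL1_injective ((map_add toL1 _ _).trans hew)⟩
  · refine toL1_injective ?_
    rw [toL1_iterate (T := fun h => T h - z • h) (toL1_sub_algebraMap hS z), map_zero]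
    exact hk _ hp
  · exact (bijOn_comap_iff hS z hWBV).2 hbij

end Spectrum

end BVSpace

/-- The Perron-Frobenius operator as a bounded operator on `L¹`. -/
def perronFrobeniusL1 (f : I → I) (hf : Measure.QuasiMeasurePreserving f volume volume) :
    L1 ℂ →L[ℂ] L1 ℂ :=
  LinearMap.mkContinuous
    { toFun := perronFrobenius f
      map_add' := perronFrobenius_add hf
      map_smul' := perronFrobenius_smul hf } 2 fun h => by
    change ‖perronFrobenius f h‖ ≤ 2 * ‖h‖
    rw [perronFrobenius_eq hf, two_mul]
    refine (norm_add_le _ _).trans (add_le_add ?_ ?_)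
    · exact (norm_ofRealL1_le _).trans ((norm_perronFrobenius_real_le hf _).trans (norm_rePart_le h))
    · rw [norm_smul]
      refine (mul_le_of_le_one_left (norm_nonneg _) (by simp)).trans ?_
      exact (norm_ofRealL1_le _).trans ((norm_perronFrobenius_real_le hf _).trans (norm_imPart_le h))

lemma Branches.mapsTo_perronFrobenius_BV {f : I → I} (B : Branches f) :
    MapsTo (perronFrobenius f) (BV ℂ) (BV ℂ) := by
  intro h hh
  obtain ⟨C, hC⟩ := B.exists_variation_perronFrobenius_le
  have key : ∀ g : L1 ℝ, variation g ≤ variation h →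
      variation (ofRealL1 (perronFrobenius f g) : L1 ℂ) < ∞ := by
    intro g hg
    refine (variation_ofRealL1_le _).trans_lt (ENNReal.mul_lt_top ENNReal.ofNat_lt_top ?_)
    refine (hC g).trans_lt (ENNReal.mul_lt_top ENNReal.coe_lt_top ?_)
    exact ENNReal.add_lt_top.2 ⟨hg.trans_lt hh, enorm_lt_top⟩
  change variation _ < ∞
  rw [perronFrobenius_eq B.quasiMeasurePreserving]
  refine (variation_add_le _ _).trans_lt (ENNReal.add_lt_top.2 ⟨key _ (variation_rePart_le h), ?_⟩)
  exact (variation_smul_le _ _).trans_lt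
    (ENNReal.mul_lt_top enorm_lt_top (key _ (variation_imPart_le h)))

/-- Above the essential spectral radius, the powers of the Perron-Frobenius operator decay on a
subspace of finite codimension; so among sufficiently many functions of bounded variation there is
a linear combination on which they do. -/
theorem Branches.exists_variation_iterate_sum_le {f : I → I} (B : Branches f) {r r' : ℝ}
    (hr : 0 < r) (hess : essSpectralRadius f < ENNReal.ofReal r) (hr' : r < r') :
    ∃ (d : ℕ) (C : ℝ), 0 ≤ C ∧ ∀ g : Fin (d + 1) → L1 ℂ, (∀ i, g i ∈ BV ℂ) →
      ∃ c : Fin (d + 1) → ℂ, c ≠ 0 ∧ ∀ M : ℝ≥0, ‖∑ i, c i • g i‖ ≤ M →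
        variation (∑ i, c i • g i) ≤ M → ∀ n,
          variation ((perronFrobenius f)^[n] (∑ i, c i • g i)) ≤ ENNReal.ofReal (C * r' ^ n * M) := by
  have hf := B.quasiMeasurePreserving
  obtain ⟨S, hS⟩ := BVSpace.exists_restrict (perronFrobeniusL1 f hf) B.mapsTo_perronFrobenius_BV
  replace hS : ∀ p, BVSpace.toL1 (S p) = perronFrobenius f (BVSpace.toL1 p) := hS
  obtain ⟨θ, hθ, hθr⟩ := sInf_lt_iff.1 hess
  obtain ⟨W, hW, C, hC, hpow⟩ := exists_cofg_norm_pow_le S (r := r) (fun z hz hrz => by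
    have hiso := hθ z ((BVSpace.mem_spectrum_iff hS z).1 hz) (hθr.trans_le (by
      rw [← ofReal_norm]; exact ENNReal.ofReal_le_ofReal hrz))
    refine ⟨?_, BVSpace.exists_isCompl_of_isIsolatedEigenvalueBV hS hiso⟩
    obtain ⟨δ, hδ, h⟩ := hiso.2.1
    exact ⟨δ, hδ, fun w hw => h w ((BVSpace.mem_spectrum_iff hS w).1 hw)⟩) hr hr'
  have hfin : FiniteDimensional ℂ (BVSpace ⧸ W) := hW
  refine ⟨Module.finrank ℂ (BVSpace ⧸ W), C, hC, fun g hg => ?_⟩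
  choose p hp using fun i => BVSpace.exists_toL1_eq (hg i)
  have hdep : ¬ LinearIndependent ℂ fun i => W.mkQ (p i) := fun hli => by
    have := hli.fintype_card_le_finrank
    simp at this
  obtain ⟨c, hc, i, hi⟩ := Fintype.not_linearIndependent_iff.1 hdep
  have hmem : ∑ i, c i • p i ∈ W := by
    refine (Submodule.Quotient.mk_eq_zero W).1 ((map_sum W.mkQ _ _).trans ?_)
    simpa only [map_smul] using hc
  have hsum : BVSpace.toL1 (∑ i, c i • p i) = ∑ i, c i • g i := by
    simp [hp]
  refine ⟨c, fun h => hi (congrFun h i), fun M hM1 hM2 n => ?_⟩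
  rw [← hsum] at hM1 hM2 ⊢
  rw [← BVSpace.toL1_iterate hS]
  refine (BVSpace.variation_toL1_le _).trans ?_
  rw [← ofReal_norm]
  have hr'0 : 0 < r' := hr.trans hr'
  refine ENNReal.ofReal_le_ofReal ((hpow n _ hmem).trans ?_)
  gcongr
  exact BVSpace.norm_le hM1 hM2

/-! ### Expansion from the essential spectral radius -/

/-- The part in `[0,1]` of the interval `[s, u]`. -/
def unitIcc (s u : ℝ) : Set I := Subtype.val ⁻¹' Icc s u

lemma measurableSet_unitIcc (s u : ℝ) : MeasurableSet (unitIcc s u) :=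
  measurable_subtype_coe measurableSet_Icc

lemma setIntegral_unitIcc {s u : ℝ} (h : Icc s u ⊆ Icc 0 1) (g : ℝ → ℂ) :
    ∫ x in unitIcc s u, g x = ∫ t in Icc s u, g t := by
  have := unitInterval.measurePreserving_coe.setIntegral_preimage_emb
    unitInterval.measurableEmbedding_coe g (Icc s u)
  rw [Measure.restrict_restrict measurableSet_Icc, inter_eq_left.2 h] at this
  exact this

lemma volume_real_unitIcc {s u : ℝ} (hsu : s ≤ u) (h : Icc s u ⊆ Icc 0 1) :
    (volume : Measure I).real (unitIcc s u) = u - s := by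
  rw [measureReal_def, unitInterval.volume_apply, unitIcc, Subtype.image_preimage_coe,
    inter_eq_right.2 h, Real.volume_Icc, ENNReal.toReal_ofReal (sub_nonneg.2 hsu)]

/-- The integral over an interval is bounded by the variation times the length: test with a
function that rises from `0` to `1` across the interval. -/
lemma enorm_setIntegral_unitIcc_le {α β : ℝ} (hαβ : α ≤ β) (g : L1 ℂ) :
    ‖∫ x in unitIcc α β, g x‖ₑ ≤ ENNReal.ofReal (β - α) * variation g := by
  have hne : ∀ᵐ x : I, (x : ℝ) ≠ α ∧ (x : ℝ) ≠ β := by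
    have h0 : ∀ᵐ x : ℝ, x ≠ α := by simp [ae_iff]
    have h1 : ∀ᵐ x : ℝ, x ≠ β := by simp [ae_iff]
    exact (ae_unitInterval_of_ae h0).and (ae_unitInterval_of_ae h1)
  rcases hαβ.eq_or_lt with rfl | hlt
  · have h0 : ∫ x in unitIcc α α, g x = 0 := by
      rw [← integral_indicator (measurableSet_unitIcc _ _)]
      refine integral_eq_zero_of_ae ?_
      filter_upwards [hne] with x hx
      refine indicator_of_notMem (fun hmem => hx.1 ?_) _
      exact le_antisymm hmem.2 hmem.1
    simp [h0]
  have hw : 0 < β - α := sub_pos.2 hlt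
  set Φ : ℝ → ℝ := fun t => (β - α)⁻¹ * (max α (min β t) - α) with hΦ
  have hLip : LipschitzWith (Real.toNNReal (β - α)⁻¹) Φ := by
    refine LipschitzWith.of_dist_le_mul fun s t => ?_
    rw [Real.coe_toNNReal _ (by positivity), Real.dist_eq, Real.dist_eq, hΦ]
    simp only
    rw [← mul_sub, abs_mul, abs_of_pos (inv_pos.2 hw), sub_sub_sub_cancel_right]
    refine mul_le_mul_of_nonneg_left ?_ (inv_nonneg.2 hw.le)
    have := ((LipschitzWith.id (α := ℝ)).const_min β).const_max α
    have h := this.dist_le_mul s t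
    rwa [NNReal.coe_one, one_mul, Real.dist_eq, Real.dist_eq] at h
  have hb : ∀ x : I, |Φ x| ≤ 1 := fun x => by
    have h1 : α ≤ max α (min β (x : ℝ)) := le_max_left _ _
    have h2 : max α (min β (x : ℝ)) ≤ β := max_le hαβ (min_le_left _ _)
    rw [hΦ, abs_of_nonneg (mul_nonneg (by positivity) (by linarith)), inv_mul_le_iff₀ hw]
    linarith
  have hd : ∀ᵐ x : I, (unitIcc α β).indicator (fun x => g x) x
      = ((β - α : ℝ) : ℂ) * (((deriv Φ x : ℝ) : ℂ) * g x) := by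
    filter_upwards [hne] with x hx
    by_cases hmem : x ∈ unitIcc α β
    · have hev : Φ =ᶠ[𝓝 (x : ℝ)] fun t => (β - α)⁻¹ * (t - α) := by
        filter_upwards [Ioo_mem_nhds (lt_of_le_of_ne hmem.1 hx.1.symm)
          (lt_of_le_of_ne hmem.2 hx.2)] with t ht
        simp only [hΦ]
        rw [min_eq_right ht.2.le, max_eq_right ht.1.le]
      have hder : deriv Φ x = (β - α)⁻¹ := by
        rw [hev.deriv_eq]; simp
      rw [indicator_of_mem hmem, hder, ← mul_assoc, ← Complex.ofReal_mul, mul_inv_cancel₀ hw.ne',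
        Complex.ofReal_one, one_mul]
    · have hder : deriv Φ x = 0 := by
        rcases lt_or_ge (x : ℝ) α with h | h
        · have hev : Φ =ᶠ[𝓝 (x : ℝ)] fun _ => 0 := by
            filter_upwards [Iio_mem_nhds h] with t ht
            simp only [hΦ]
            rw [max_eq_left ((min_le_right _ _).trans (le_of_lt ht)), sub_self, mul_zero]
          rw [hev.deriv_eq]; simp
        · have h' : β < x := lt_of_not_ge fun hle => hmem ⟨h, hle⟩
          have hev : Φ =ᶠ[𝓝 (x : ℝ)] fun _ => (β - α)⁻¹ * (β - α) := by
            filter_upwards [Ioi_mem_nhds h'] with t ht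
            simp only [hΦ]
            rw [min_eq_left (le_of_lt ht), max_eq_right hαβ]
          rw [hev.deriv_eq]; simp
      rw [indicator_of_notMem hmem, hder]; simp
  rw [← integral_indicator (measurableSet_unitIcc _ _), integral_congr_ae hd, integral_const_mul,
    enorm_mul]
  have hn : ‖((β - α : ℝ) : ℂ)‖ₑ = ENNReal.ofReal (β - α) := by
    rw [← ofReal_norm, Complex.norm_real, Real.norm_of_nonneg hw.le]
  rw [hn]
  gcongr
  exact enorm_integral_deriv_mul_le_variation hLip hb g

/-- The indicator function of an interval. -/
def indicatorIcc (s u : ℝ) : L1 ℂ :=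
  indicatorConstLp 1 (measurableSet_unitIcc s u) (measure_ne_top _ _) 1

lemma norm_indicatorIcc_le (s u : ℝ) : ‖indicatorIcc s u‖ ≤ 1 := by
  refine norm_indicatorConstLp_le.trans ?_
  rw [norm_one, one_mul, ENNReal.toReal_one, div_one, Real.rpow_one]
  exact measureReal_le_one

lemma setIntegral_indicatorIcc (s u : ℝ) {A : Set I} (hA : MeasurableSet A) :
    ∫ x in A, indicatorIcc s u x = ((volume : Measure I).real (unitIcc s u ∩ A) : ℂ) := by
  rw [indicatorIcc, setIntegral_indicatorConstLp hA]
  simp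

lemma variation_indicatorIcc_le {s u : ℝ} (hsu : s ≤ u) (h : Icc s u ⊆ Icc 0 1) :
    variation (indicatorIcc s u) ≤ 2 := by
  refine iSup₂_le fun φ hφ => ?_
  have h1 : ∫ x : I, deriv φ x * indicatorIcc s u x = φ u - φ s := by
    have h2 : ∀ᵐ x : I, deriv φ x * indicatorIcc s u x
        = (unitIcc s u).indicator (fun x : I => deriv φ x) x := by
      filter_upwards [indicatorConstLp_coeFn (p := 1) (hs := measurableSet_unitIcc s u)
        (hμs := measure_ne_top (volume : Measure I) _) (c := (1 : ℂ))] with x hx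
      rw [indicatorIcc, hx]
      by_cases hmem : x ∈ unitIcc s u
      · rw [indicator_of_mem hmem, indicator_of_mem hmem, mul_one]
      · rw [indicator_of_notMem hmem, indicator_of_notMem hmem, mul_zero]
    rw [integral_congr_ae h2, integral_indicator (measurableSet_unitIcc s u),
      setIntegral_unitIcc h, integral_Icc_eq_integral_Ioc, ← intervalIntegral.integral_of_le hsu]
    exact intervalIntegral.integral_deriv_eq_sub
      (fun t _ => (hφ.1.differentiable one_ne_zero).differentiableAt)
      ((hφ.1.continuous_deriv le_rfl).intervalIntegrable _ _)
  rw [h1, ← ofReal_norm, ← ENNReal.ofReal_ofNat]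
  refine ENNReal.ofReal_le_ofReal ((norm_sub_le _ _).trans ?_)
  linarith [hφ.2.2 u, hφ.2.2 s]

lemma realMap_iterate_coe (f : I → I) (n : ℕ) (x : I) :
    (realMap f)^[n] (x : ℝ) = (f^[n] x : I) := by
  induction n generalizing x with
  | zero => rfl
  | succ n ih => rw [Function.iterate_succ_apply, Branches.realMap_coe, ih]; rfl

namespace Branches

variable {f : I → I} (B : Branches f)

lemma hasStrictDerivAt_realMap {x : I} (hx : (x : ℝ) ∉ range B.a) :
    HasStrictDerivAt (realMap f) (deriv (realMap f) x) x ∧ deriv (realMap f) x ≠ 0 := by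
  obtain ⟨j, hj⟩ := B.exists_mem_inner hx
  have h := (B.hasStrictDerivAt_F hj).congr_of_eventuallyEq (B.eventually_eq_F hj).symm
  rw [h.hasDerivAt.deriv]
  exact ⟨h, B.slope_ne_zero (B.inner_subset_dom j hj)⟩

lemma hasStrictDerivAt_realMap_iterate {n : ℕ} {x : I}
    (hx : ∀ i < n, (f^[i] x : ℝ) ∉ range B.a) :
    HasStrictDerivAt ((realMap f)^[n])
      (∏ i ∈ Finset.range n, deriv (realMap f) (f^[i] x : I)) (x : ℝ) := by
  induction n with
  | zero => simpa using hasStrictDerivAt_id (x : ℝ)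
  | succ n ih =>
    rw [Function.iterate_succ', Finset.prod_range_succ, mul_comm]
    have h := (B.hasStrictDerivAt_realMap (hx n n.lt_succ_self)).1
    rw [← realMap_iterate_coe] at h ⊢
    exact h.comp (x : ℝ) (ih fun i hi => hx i (hi.trans n.lt_succ_self))

/-- Around a point whose orbit avoids the partition points, the iterate is injective and
Lipschitz with twice its derivative as constant. -/
lemma exists_ball_realMap_iterate {n : ℕ} {x : I} (hn : 0 < n)
    (hx : ∀ i < n, (f^[i] x : ℝ) ∉ range B.a) :
    ∃ δ > 0, Icc (x : ℝ) (x + δ) ⊆ Icc 0 1 ∧ InjOn ((realMap f)^[n]) (Icc (x : ℝ) (x + δ)) ∧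
      ∀ s ∈ Icc (x : ℝ) (x + δ), ∀ t ∈ Icc (x : ℝ) (x + δ),
        |(realMap f)^[n] s - (realMap f)^[n] t|
          ≤ 2 * (∏ i ∈ Finset.range n, |deriv (realMap f) (f^[i] x : I)|) * |s - t| := by
  set D : ℝ := ∏ i ∈ Finset.range n, deriv (realMap f) (f^[i] x : I) with hD
  have hD0 : 0 < |D| := abs_pos.2 (Finset.prod_ne_zero_iff.2 fun i hi =>
    (B.hasStrictDerivAt_realMap (hx i (Finset.mem_range.1 hi))).2)
  have hx1 : (x : ℝ) < 1 := lt_of_le_of_ne x.2.2 fun h =>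
    hx 0 hn ⟨Fin.last _, B.a_last.trans h.symm⟩
  have hstrict := (B.hasStrictDerivAt_realMap_iterate hx).hasStrictFDerivAt.isLittleO.def
    (half_pos hD0)
  rw [nhds_prod_eq] at hstrict
  obtain ⟨U, hU, hUD⟩ := mem_prod_self_iff.1 hstrict
  obtain ⟨δ₀, hδ₀, hball⟩ := Metric.mem_nhds_iff.1 hU
  set δ : ℝ := min (δ₀ / 2) (1 - x) with hδ
  have hδpos : 0 < δ := lt_min (half_pos hδ₀) (sub_pos.2 hx1)
  have hmem : ∀ s ∈ Icc (x : ℝ) (x + δ), s ∈ U := fun s hs => hball (by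
    rw [Metric.mem_ball, Real.dist_eq, abs_of_nonneg (sub_nonneg.2 hs.1)]
    have := min_le_left (δ₀ / 2) (1 - (x : ℝ))
    linarith [hs.2])
  have key : ∀ s ∈ Icc (x : ℝ) (x + δ), ∀ t ∈ Icc (x : ℝ) (x + δ),
      |(realMap f)^[n] s - (realMap f)^[n] t - (s - t) * D| ≤ |D| / 2 * |s - t| :=
    fun s hs t ht => by
      have := hUD (mk_mem_prod (hmem s hs) (hmem t ht))
      simpa [Real.norm_eq_abs] using this
  refine ⟨δ, hδpos, Icc_subset_Icc x.2.1 ?_, fun s hs t ht hst => ?_, fun s hs t ht => ?_⟩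
  · have := min_le_right (δ₀ / 2) (1 - (x : ℝ))
    linarith
  · have h := key s hs t ht
    rw [hst, sub_self, zero_sub, abs_neg, abs_mul] at h
    by_contra hne
    have := mul_pos hD0 (abs_pos.2 (sub_ne_zero.2 hne))
    linarith
  · have h := key s hs t ht
    rw [← Finset.abs_prod]
    have h2 := abs_sub_abs_le_abs_sub ((realMap f)^[n] s - (realMap f)^[n] t) ((s - t) * D)
    rw [abs_mul (s - t)] at h2
    have := mul_nonneg hD0.le (abs_nonneg (s - t))
    linarith

/-- Above the essential spectral radius of the Perron-Frobenius operator, iterates expand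
accordingly. Among functions constant on each of many small intervals near a point there is one,
`h`, such that the variation of `P^n h` decays at the rate `r'^n`; but on the interval where `|h|`
is largest, `P^n h` is of the size of `|(f^n)'|⁻¹` times this maximum. -/
theorem exists_expansionBound {r r' : ℝ} (hr : 0 < r)
    (hess : essSpectralRadius f < ENNReal.ofReal r) (hr' : r < r') :
    ∃ C, B.ExpansionBound C r' := by
  obtain ⟨d, C, hC, hsum⟩ := B.exists_variation_iterate_sum_le hr hess hr'
  have hr'0 : 0 < r' := hr.trans hr'
  refine ⟨1 + 4 * (d + 1) * C, fun n x hx => ?_⟩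
  rcases Nat.eq_zero_or_pos n with rfl | hn
  · simp only [Finset.range_zero, Finset.prod_empty, pow_zero, mul_one]
    have : 0 ≤ 4 * (d + 1) * C := by positivity
    linarith
  obtain ⟨δ, hδ, hsub, hinj, hlip⟩ := B.exists_ball_realMap_iterate hn hx
  rw [Finset.prod_inv_distrib]
  set D : ℝ := ∏ i ∈ Finset.range n, |deriv (realMap f) (f^[i] x : I)| with hD
  have hD0 : 0 < D := Finset.prod_pos fun i hi =>
    abs_pos.2 (B.hasStrictDerivAt_realMap (hx i (Finset.mem_range.1 hi))).2
  -- pairwise disjoint intervals `[s i, s i + l]` of equal length in `[x, x + δ]`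
  set l : ℝ := δ / (2 * (d + 1)) with hl
  have hl0 : 0 < l := by positivity
  set s : Fin (d + 1) → ℝ := fun i => x + 2 * l * i with hs
  have hJ : ∀ i, Icc (s i) (s i + l) ⊆ Icc (x : ℝ) (x + δ) := by
    intro i
    have h1 : ((i : ℕ) : ℝ) + 1 ≤ d + 1 := by exact_mod_cast i.2
    have h2 : 2 * l * (d + 1) = δ := by rw [hl]; field_simp
    have h3 : 2 * l * ((i : ℕ) + 1) ≤ δ := by rw [← h2]; gcongr
    have h4 : 0 ≤ 2 * l * ((i : ℕ) : ℝ) := by positivity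
    exact Icc_subset_Icc (by simp only [hs]; linarith) (by simp only [hs]; linarith)
  have hJd : ∀ i k, i ≠ k → Disjoint (Icc (s i) (s i + l)) (Icc (s k) (s k + l)) := by
    have : ∀ i k : Fin (d + 1), i < k → Disjoint (Icc (s i) (s i + l)) (Icc (s k) (s k + l)) := by
      intro i k hik
      rw [Set.disjoint_left]
      intro t ht ht'
      have h1 : ((i : ℕ) : ℝ) + 1 ≤ (k : ℕ) := by exact_mod_cast hik
      have h2 : 2 * l * ((i : ℕ) + 1) ≤ 2 * l * ((k : ℕ) : ℝ) := by gcongr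
      have h3 := ht.2
      have h4 := ht'.1
      simp only [hs] at h3 h4
      linarith
    intro i k hik
    rcases hik.lt_or_gt with h | h
    · exact this i k h
    · exact (this k i h).symm
  have hle : ∀ i, s i ≤ s i + l := fun i => by linarith
  obtain ⟨c, hc, hvar⟩ := hsum (fun i => indicatorIcc (s i) (s i + l)) fun i =>
    (variation_indicatorIcc_le (hle i) ((hJ i).trans hsub)).trans_lt ENNReal.ofNat_lt_top
  set h : L1 ℂ := ∑ i, c i • indicatorIcc (s i) (s i + l) with hh
  obtain ⟨i₀, -, hmax⟩ := Finset.exists_max_image Finset.univ (fun i => ‖c i‖₊)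
    Finset.univ_nonempty
  have hci : 0 < ‖c i₀‖ := by
    obtain ⟨i, hi⟩ := Function.ne_iff.1 hc
    exact (norm_pos_iff.2 hi).trans_le (hmax i (Finset.mem_univ i))
  have hvar' := hvar (2 * (d + 1) * ‖c i₀‖₊) (by
    have h1 : ‖h‖ ≤ ∑ _i : Fin (d + 1), ‖c i₀‖ := by
      refine (norm_sum_le _ _).trans (Finset.sum_le_sum fun i _ => ?_)
      rw [norm_smul]
      exact (mul_le_of_le_one_right (norm_nonneg _) (norm_indicatorIcc_le _ _)).trans
        (hmax i (Finset.mem_univ i))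
    refine h1.trans ?_
    rw [Finset.sum_const, Finset.card_univ, Fintype.card_fin, nsmul_eq_mul]
    push_cast
    have : 0 ≤ ((d : ℝ) + 1) * ‖c i₀‖ := by positivity
    linarith) (by
    have h1 : ∀ t : Finset (Fin (d + 1)),
        variation (∑ i ∈ t, c i • indicatorIcc (s i) (s i + l))
          ≤ ∑ _i ∈ t, (‖c i₀‖₊ * 2 : ℝ≥0∞) := by
      intro t
      induction t using Finset.induction_on with
      | empty => simp [variation_zero]
      | insert i t hi ih =>
        rw [Finset.sum_insert hi, Finset.sum_insert hi]
        refine (variation_add_le _ _).trans (add_le_add ?_ ih)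
        refine (variation_smul_le _ _).trans ?_
        gcongr
        · exact ENNReal.coe_le_coe.2 (hmax i (Finset.mem_univ i))
        · exact variation_indicatorIcc_le (hle i) ((hJ i).trans hsub)
    refine (h1 Finset.univ).trans (le_of_eq ?_)
    rw [Finset.sum_const, Finset.card_univ, Fintype.card_fin, nsmul_eq_mul]
    push_cast
    ring) n
  -- the image of the interval `i₀` is an interval of length at most `2 * D * l`
  set F : ℝ → ℝ := (realMap f)^[n] with hF
  have hFc : ContinuousOn F (Icc (s i₀) (s i₀ + l)) := by
    have : LipschitzOnWith (Real.toNNReal (2 * D)) F (Icc (s i₀) (s i₀ + l)) :=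
      LipschitzOnWith.of_dist_le_mul fun p hp q hq => by
        rw [Real.coe_toNNReal _ (by positivity)]
        exact hlip p (hJ i₀ hp) q (hJ i₀ hq)
    exact this.continuousOn
  have him := hFc.image_Icc (hle i₀)
  set α : ℝ := sInf (F '' Icc (s i₀) (s i₀ + l)) with hα
  set β : ℝ := sSup (F '' Icc (s i₀) (s i₀ + l)) with hβ
  have hαβ : α ≤ β := by
    rw [← nonempty_Icc, ← him]
    exact (nonempty_Icc.2 (hle i₀)).image F
  have hlen : β - α ≤ 2 * D * l := by
    obtain ⟨p, hp, hpα⟩ : α ∈ F '' Icc (s i₀) (s i₀ + l) := by rw [him]; exact left_mem_Icc.2 hαβ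
    obtain ⟨q, hq, hqβ⟩ : β ∈ F '' Icc (s i₀) (s i₀ + l) := by rw [him]; exact right_mem_Icc.2 hαβ
    rw [← hpα, ← hqβ]
    refine (le_abs_self _).trans ((hlip q (hJ i₀ hq) p (hJ i₀ hp)).trans ?_)
    gcongr
    rw [abs_le]
    constructor <;> linarith [hp.1, hp.2, hq.1, hq.2]
  have hpre : ∀ y : I, y ∈ f^[n] ⁻¹' unitIcc α β ↔ F y ∈ F '' Icc (s i₀) (s i₀ + l) := by
    intro y
    rw [him, hF, realMap_iterate_coe]
    rfl
  have hint : ∫ y in unitIcc α β, ((perronFrobenius f)^[n] h) y = c i₀ * l := by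
    have hmeas := B.measurable.iterate n (measurableSet_unitIcc α β)
    have hlin : ∀ t : Finset (Fin (d + 1)), ∫ y in f^[n] ⁻¹' unitIcc α β,
        (∑ i ∈ t, c i • indicatorIcc (s i) (s i + l) : L1 ℂ) y
          = ∑ i ∈ t, c i * ∫ y in f^[n] ⁻¹' unitIcc α β, indicatorIcc (s i) (s i + l) y := by
      intro t
      induction t using Finset.induction_on with
      | empty =>
        have := setIntegral_L1_smul (0 : ℂ) (0 : L1 ℂ) (f^[n] ⁻¹' unitIcc α β)
        simpa only [zero_smul, zero_mul, Finset.sum_empty] using this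
      | insert i t hi ih =>
        rw [Finset.sum_insert hi, Finset.sum_insert hi, setIntegral_L1_add, setIntegral_L1_smul, ih]
    rw [setIntegral_perronFrobenius_iterate B.quasiMeasurePreserving n h
      (measurableSet_unitIcc α β), hh, hlin, Finset.sum_eq_single i₀]
    · have : unitIcc (s i₀) (s i₀ + l) ∩ f^[n] ⁻¹' unitIcc α β = unitIcc (s i₀) (s i₀ + l) :=
        inter_eq_left.2 fun y hy => (hpre y).2 ⟨y, hy, rfl⟩
      rw [setIntegral_indicatorIcc _ _ hmeas, this,
        volume_real_unitIcc (hle i₀) ((hJ i₀).trans hsub), add_sub_cancel_left]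
    · intro i _ hi
      have : unitIcc (s i) (s i + l) ∩ f^[n] ⁻¹' unitIcc α β = ∅ := by
        refine eq_empty_of_forall_notMem fun y hy => ?_
        obtain ⟨t, ht, hty⟩ := (hpre y).1 hy.2
        have : t = y := hinj (hJ i₀ ht) (hJ i hy.1) hty
        exact Set.disjoint_left.1 (hJd i i₀ hi) hy.1 (this ▸ ht)
      rw [setIntegral_indicatorIcc _ _ hmeas, this]
      simp
    · simp
  have hfin : ‖c i₀‖ * l ≤ 2 * D * l * (C * r' ^ n * (2 * (d + 1) * ‖c i₀‖)) := by
    have h1 := enorm_setIntegral_unitIcc_le hαβ ((perronFrobenius f)^[n] h)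
    rw [hint] at h1
    have h2 := h1.trans (mul_le_mul' (ENNReal.ofReal_le_ofReal hlen) hvar')
    rw [← ENNReal.ofReal_mul (by positivity), ← ofReal_norm,
      ENNReal.ofReal_le_ofReal_iff (by positivity), norm_mul, Complex.norm_real,
      Real.norm_of_nonneg hl0.le] at h2
    exact h2
  have hmul : 1 ≤ D * (4 * (d + 1) * C * r' ^ n) := by
    refine le_of_mul_le_mul_right ?_ (mul_pos hci hl0)
    calc 1 * (‖c i₀‖ * l) ≤ 2 * D * l * (C * r' ^ n * (2 * (d + 1) * ‖c i₀‖)) := by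
          rw [one_mul]; exact hfin
      _ = D * (4 * (d + 1) * C * r' ^ n) * (‖c i₀‖ * l) := by ring
  rw [inv_le_iff_one_le_mul₀' hD0]
  refine hmul.trans ?_
  gcongr
  linarith

end Branches

/-! ### The Lasota-Yorke inequality for the perturbed operators -/

theorem proposition1 (f : I → I) (hf : IsPiecewiseExpanding f)
    (hPTP : periodicTurningPoints f = ∅)
    (Q : ℝ → Kernel I I) (hQ : IsPerturbationFamily Q)
    (hlocal : IsLocalFamily Q) (hsmall : IsSmallFamily Q) (hregular : IsRegularFamily Q)
    (θ : ℝ) (hθ : essSpectralRadius f < ENNReal.ofReal θ) (hθ1 : θ < 1) :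
    ∃ (C : ℝ≥0) (ε₀ : ℝ) (N : ℕ), 0 < ε₀ ∧ 1 ≤ N ∧
      ∀ ε ∈ Ioo 0 ε₀, ∀ h ∈ BV ℝ,
        variation ((perturbedOp f (Q ε))^[N] h) ≤
          ENNReal.ofReal (θ ^ N) * variation h + C * ‖h‖ₑ := by
  obtain ⟨B⟩ := hf.1.nonempty_branches
  obtain ⟨r, hr, hess, hrθ⟩ : ∃ r : ℝ, 0 < r ∧ essSpectralRadius f < ENNReal.ofReal r ∧ r < θ := by
    obtain ⟨q, hq, hqθ⟩ := exists_between hθ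
    have hqtop : q ≠ ∞ := ne_top_of_lt hqθ
    refine ⟨q.toReal, ENNReal.toReal_pos (ne_bot_of_gt hq) hqtop, ?_, ?_⟩
    · rwa [ENNReal.ofReal_toReal hqtop]
    · exact (ENNReal.lt_ofReal_iff_toReal_lt hqtop).1 hqθ
  obtain ⟨r', hr', hr'θ⟩ := exists_between hrθ
  have hr'0 : 0 < r' := hr.trans hr'
  have hθ0 : 0 < θ := hr'0.trans hr'θ
  obtain ⟨C, hC⟩ := B.exists_expansionBound hr hess hr'
  obtain ⟨K, hK, hlimit⟩ := B.exists_iterate_limitStep_le hPTP hr'0.le hC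
  obtain ⟨N, hN, hN1⟩ : ∃ N : ℕ, K * r' ^ N < θ ^ N ∧ 1 ≤ N := by
    have h := (tendsto_pow_atTop_nhds_zero_of_lt_one (div_nonneg hr'0.le hθ0.le)
      ((div_lt_one hθ0).2 hr'θ)).const_mul K
    rw [mul_zero] at h
    obtain ⟨N, hN, hN1⟩ := ((h.eventually_lt_const one_pos).and (eventually_ge_atTop 1)).exists
    refine ⟨N, ?_, hN1⟩
    rwa [div_pow, ← mul_div_assoc, div_lt_one (by positivity)] at hN
  have hM : ∀ x, B.limitStep^[N] (fun _ => 1) x < ENNReal.ofReal (θ ^ N) := fun x =>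
    (hlimit N x).trans_lt ((ENNReal.ofReal_lt_ofReal_iff (by positivity)).2 hN)
  obtain ⟨δ, hδ, hgap⟩ := B.exists_gap
  obtain ⟨R, hR, hR0⟩ := ((B.exists_forall_iterate_weightStep_le hM).and
    self_mem_nhdsWithin).exists
  have hR0' : 0 < R.toNNReal := Real.toNNReal_pos.2 hR0
  set ρ : ℝ≥0 := min (R.toNNReal / 2) (δ / 2) with hρ
  have hρ0 : 0 < ρ := lt_min (half_pos hR0') (half_pos hδ)
  have hρR : (ρ : ℝ) < R := by
    have : ρ < R.toNNReal := (min_le_left _ _).trans_lt (half_lt_self hR0')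
    rwa [← NNReal.coe_lt_coe, Real.coe_toNNReal _ (le_of_lt hR0)] at this
  have hρδ : 2 * (ρ : ℝ) ≤ δ := by
    have : ρ ≤ δ / 2 := min_le_right _ _
    rw [← NNReal.coe_le_coe] at this
    push_cast at this
    linarith
  obtain ⟨C', hC'⟩ := B.exists_weightedVariation_iterate_le hQ hlocal hregular hρ0
    (fun j => hρδ.trans (hgap j)) N
  refine ⟨C', ρ, N, hρ0, hN1, fun ε hε h hh => (hC' ε hε h hh).trans ?_⟩
  gcongr
  exact weightedVariation_le (hR ρ ⟨hρ0, hρR⟩) h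

end
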